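/- Conventions. A rational matrix $R(\lambda)\in\mathbb{C}(\lambda)^{m\times m}$ is Hermitian, skew-Hermitian, para-Hermitian or para-skew-Hermitian if, respectively, $[R(\lambda)]^*=R(\overline\lambda)$, $[R(\lambda)]^*=-R(\overline\lambda)$, $[R(\lambda)]^*=R(-\overline\lambda)$, $[R(\lambda)]^*=-R(-\overline\lambda)$ (wherever both sides are defined). A pencil $$L(\lambda)=\begin{bmatrix}A(\lambda)&-B(\lambda)\\ C(\lambda)&D(\lambda)\end{bmatrix},$$ with entries of degree at most $1$ and with $A(\lambda)$ square and $\det A(\lambda)\not\equiv 0$, is a strongly minimal linearization of $R(\lambda)$ if $R(\lambda)=D(\lambda)+C(\lambda)A(\lambda)^{-1}B(\lambda)$ and if $[A(\lambda)\;\,-B(\lambda)]$ has full row rank and $\begin{bmatrix}A(\lambda)\\ C(\lambda)\end{bmatrix}$ has full column rank at every $\lambda\in\mathbb{C}$ and at $\infty$, where the rank at $\infty$ is the rank of the coefficient of $\lambda$. Let $R(\lambda)\in\mathbb{C}(\lambda)^{m\times m}$ (regular or singular) have one of these four structures, and write $R(\lambda)=P(\lambda)+R_{sp}(\lambda)$ with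 $P(\lambda)=\sum_i P_i\lambda^i$ a polynomial matrix and $R_{sp}(\lambda)=R_{-1}\lambda^{-1}+R_{-2}\lambda^{-2}+\cdots$ strictly proper (Laurent expansion at $\infty$). Polynomial part. Let $d\ge\deg P$ be a nonnegative integer (for instance $d=\deg P$ if $P\neq 0$), and put $P_i=0$ for $i>d$. With $d-1$ block rows or columns (none if $d\le 1$) and $1\le i,j\le d-1$, let $T$ have the blocks $T_{ij}=P_{2d-i-j}$, and let the pencils $A_s,B_s,C_s$ have the blocks $(A_s)_{ij}=\lambda P_{2d-i-j+1}-P_{2d-i-j}$, $(-B_s)_i=\lambda P_{d-i+1}$, $(C_s)_j=\lambda P_{d-j+1}$; let $\widehat D_s=\lambda P_1+P_0$ and $S_P=\mathrm{diag}((-1)^{d-1}I_m,\ldots,(-1)^2I_m,-I_m)$. Let $U=[U_1\;U_2]$, $V=[V_1\;V_2]$ be unitary matrices with $U^*TV=\begin{bmatrix}0&0\\0&\widehat T\end{bmatrix}$, $\widehat T=U_2^*TV_2$ square and invertible, where $U=V$ in the Hermitian and skew-Hermitian cases and $U=S_PV$ in the other two cases. Put $\widehat A_s=U_2^*A_sV_2$,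 $\widehat B_s=U_2^*B_s$, $\widehat C_s=C_sV_2$. Strictly proper part. For $k\ge1$ and $1\le i,j\le k$ let $H$ and $H_\sigma$ be the matrices with blocks $H_{ij}=R_{-(i+j-1)}$ and $(H_\sigma)_{ij}=R_{-(i+j)}$, let $S=\mathrm{diag}(-I_m,(-1)^2I_m,\ldots,(-1)^kI_m)$, and let $k$ be so large that $\operatorname{rank}H$ equals the total polar degree of the finite poles of $R_{sp}$, i.e. the sum of the degrees of the denominators in the Smith--McMillan form of $R_{sp}$. Let $Y=[Y_1\;Y_2]$, $W=[W_1\;W_2]$ be unitary matrices with $Y^*HW=\begin{bmatrix}\widehat H&0\\0&0\end{bmatrix}$, $\widehat H=Y_1^*HW_1$ square and invertible, where $Y=W$ in the Hermitian and skew-Hermitian cases and $Y=SW$ in the other two cases. Let $W_{11}$ be the submatrix of the first $m$ rows of $W_1$. In the Hermitian and skew-Hermitian cases put $A_{sp}=W_1^*H_\sigma W_1-\lambda\widehat H$, $-B_{sp}=\widehat HW_{11}^*$, $C_{sp}=W_{11}\widehat H$; in the other two cases put $A_{sp}=W_1^*SH_\sigma W_1-\lambda\widehat H$, $-B_{sp}=\widehat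 HW_{11}^*$, $C_{sp}=-W_{11}\widehat H$. Theorem. Such data exist: every sufficiently large $k$ satisfies the rank condition, and unitary matrices $U,V$ and $Y,W$ as above exist for all $d\ge\deg P$ and all $k$. For every choice of the data, $$L(\lambda)=\left[\begin{array}{cc|c}\widehat A_s(\lambda)&0&-\widehat B_s(\lambda)\\0&A_{sp}(\lambda)&-B_{sp}(\lambda)\\ \hline \widehat C_s(\lambda)&C_{sp}(\lambda)&\widehat D_s(\lambda)\end{array}\right]$$ is a strongly minimal linearization of $R(\lambda)$ (with $A(\lambda)=\mathrm{diag}(\widehat A_s,A_{sp})$) that has the same self-conjugate structure as $R(\lambda)$. -/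

import Mathlib

open Polynomial Matrix

noncomputable section

namespace StrongLin

/-! ### Rational matrices -/

/-- A rational matrix is strictly proper if every entry `n / d` has `deg n < deg d`. -/
def IsStrictlyProper {m n : Type*} (R : Matrix m n (RatFunc ℂ)) : Prop :=
  ∀ i j, (R i j).num.degree < (R i j).denom.degree

/-- A polynomial matrix seen as a rational matrix. -/
def toRat {m n : Type*} (P : Matrix m n ℂ[X]) : Matrix m n (RatFunc ℂ) :=
  P.map (algebraMap ℂ[X] (RatFunc ℂ))

/-- The value `P(z)` of a polynomial matrix. -/
def polyEval {m n : Type*} (P : Matrix m n ℂ[X]) (z : ℂ) : Matrix m n ℂ :=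
  P.map (fun p => p.eval z)

/-- The matrix coefficient `P_i` of `λ ^ i` in a polynomial matrix. -/
def polyCoeff {m n : Type*} (P : Matrix m n ℂ[X]) (i : ℕ) : Matrix m n ℂ :=
  P.map (fun p => p.coeff i)

/-- A constant matrix seen as a polynomial matrix. -/
def const {m n : Type*} (M : Matrix m n ℂ) : Matrix m n ℂ[X] := M.map C

/-- The value `R(z)` of a rational matrix (meaningful when `z` is not a pole). -/
def ratEval {m n : Type*} (R : Matrix m n (RatFunc ℂ)) (z : ℂ) : Matrix m n ℂ :=
  R.map (fun f => f.eval (RingHom.id ℂ) z)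

/-- No entry of the rational matrix `R` has a pole at `z`. -/
def DefinedAt {m n : Type*} (R : Matrix m n (RatFunc ℂ)) (z : ℂ) : Prop :=
  ∀ i j, (R i j).denom.eval z ≠ 0

/-- The coefficient of `λ ^ i` in the Laurent expansion at infinity of a rational function:
substitute `λ = t⁻¹`, expand in Laurent series in `t`, and read off the coefficient of `t ^ (-i)`. -/
def laurentCoeff (f : RatFunc ℂ) (i : ℤ) : ℂ :=
  (f.eval (HahnSeries.C : ℂ →+* LaurentSeries ℂ)
    (HahnSeries.single (-1 : ℤ) (1 : ℂ) : LaurentSeries ℂ)).coeff (-i)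

/-! ### The four self-conjugate structures -/

/-- The four self-conjugate structures. -/
inductive SelfConj where
  | hermitian
  | skewHermitian
  | paraHermitian
  | paraSkewHermitian

/-- The reflected point: `z̄` for the two structures with respect to the real line,
`-z̄` for the two structures with respect to the imaginary axis. -/
def SelfConj.reflect : SelfConj → ℂ → ℂ
  | .hermitian, z => star z
  | .skewHermitian, z => star z
  | .paraHermitian, z => -star z
  | .paraSkewHermitian, z => -star z

/-- The sign in the defining identity: `1` for (para-)Hermitian, `-1` for (para-)skew-Hermitian. -/
def SelfConj.sign : SelfConj → ℂ
  | .hermitian => 1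
  | .skewHermitian => -1
  | .paraHermitian => 1
  | .paraSkewHermitian => -1

/-- The rational matrix `R` has the structure `τ`:
`R(z)* = R(z̄)`, `R(z)* = -R(z̄)`, `R(z)* = R(-z̄)`, `R(z)* = -R(-z̄)` respectively,
wherever both sides are defined. -/
def SelfConj.RatHas {n : Type*} (τ : SelfConj) (R : Matrix n n (RatFunc ℂ)) : Prop :=
  ∀ z : ℂ, DefinedAt R z → DefinedAt R (τ.reflect z) →
    (ratEval R z)ᴴ = τ.sign • ratEval R (τ.reflect z)

/-- The polynomial matrix `P` has the structure `τ`. -/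
def SelfConj.PolyHas {n : Type*} (τ : SelfConj) (P : Matrix n n ℂ[X]) : Prop :=
  ∀ z : ℂ, (polyEval P z)ᴴ = τ.sign • polyEval P (τ.reflect z)

/-! ### Strongly minimal linearizations -/

/-- The transfer function `D + C A⁻¹ B` of `L = [A, -B; C, D]`. -/
def transferFunction {s m n : Type*} [Fintype s] [DecidableEq s]
    (L : Matrix (s ⊕ m) (s ⊕ n) ℂ[X]) : Matrix m n (RatFunc ℂ) :=
  toRat L.toBlocks₂₂ + toRat L.toBlocks₂₁ * (toRat L.toBlocks₁₁)⁻¹ * toRat (-L.toBlocks₁₂)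

/-- `L = [A, -B; C, D]` is a linear polynomial system matrix: all entries have degree at most `1`
and `A` is regular. -/
structure IsLinearSystemMatrix {s m n : Type*} [Fintype s] [DecidableEq s]
    (L : Matrix (s ⊕ m) (s ⊕ n) ℂ[X]) : Prop where
  pencil : ∀ i j, (L i j).natDegree ≤ 1
  regular : L.toBlocks₁₁.det ≠ 0

/-- `L = [A, -B; C, D]` is strongly minimal: `[A, -B]` has full row rank and `[A; C]` has full
column rank at every finite point and at infinity, where the rank at infinity is the rank of the
coefficient of `λ`. -/
structure IsStronglyMinimal {s m n : Type*} [Fintype s] [Fintype n]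
    (L : Matrix (s ⊕ m) (s ⊕ n) ℂ[X]) : Prop where
  row_finite : ∀ z : ℂ, (polyEval L.toRows₁ z).rank = Fintype.card s
  col_finite : ∀ z : ℂ, (polyEval L.toCols₁ z).rank = Fintype.card s
  row_infinity : (polyCoeff L.toRows₁ 1).rank = Fintype.card s
  col_infinity : (polyCoeff L.toCols₁ 1).rank = Fintype.card s

/-- `L` is a strongly minimal linearization of the rational matrix `R`. -/
structure IsStronglyMinimalLinearization {s m n : Type*} [Fintype s] [DecidableEq s] [Fintype n]
    (L : Matrix (s ⊕ m) (s ⊕ n) ℂ[X]) (R : Matrix m n (RatFunc ℂ)) : Prop where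
  system : IsLinearSystemMatrix L
  minimal : IsStronglyMinimal L
  transfer : transferFunction L = R

/-! ### The polynomial part -/

/-- A matrix with rows indexed by `ι` and columns by `κ` (of equal cardinality) is unitary. -/
def IsUnitary {ι κ : Type*} [Fintype ι] [Fintype κ] [DecidableEq ι] [DecidableEq κ]
    (U : Matrix ι κ ℂ) : Prop :=
  Uᴴ * U = 1 ∧ U * Uᴴ = 1

/-- The block Hankel matrix `T` with `d - 1` block rows and columns, block rows and columns being
numbered from `0`: the first block row is `0, …, 0, P_d`, the last one is `P_d, …, P_2`.
(The coefficients `P_i` with `i > d` vanish when `P` has degree at most `d`.) -/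
def blockT {m : ℕ} (P : Matrix (Fin m) (Fin m) ℂ[X]) (d : ℕ) :
    Matrix (Fin (d - 1) × Fin m) (Fin (d - 1) × Fin m) ℂ :=
  Matrix.of fun x y => polyCoeff P (2 * d - 2 - (x.1 : ℕ) - (y.1 : ℕ)) x.2 y.2

/-- The pencil `A_s`, with blocks `λ P_(i+1) - P_i` where `T` has the block `P_i`. -/
def pencilA {m : ℕ} (P : Matrix (Fin m) (Fin m) ℂ[X]) (d : ℕ) :
    Matrix (Fin (d - 1) × Fin m) (Fin (d - 1) × Fin m) ℂ[X] :=
  Matrix.of fun x y =>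
    X * C (polyCoeff P (2 * d - 1 - (x.1 : ℕ) - (y.1 : ℕ)) x.2 y.2)
      - C (polyCoeff P (2 * d - 2 - (x.1 : ℕ) - (y.1 : ℕ)) x.2 y.2)

/-- The pencil `-B_s`, the block column `λ P_d, …, λ P_2`. -/
def pencilNegB {m : ℕ} (P : Matrix (Fin m) (Fin m) ℂ[X]) (d : ℕ) :
    Matrix (Fin (d - 1) × Fin m) (Fin m) ℂ[X] :=
  Matrix.of fun x b => X * C (polyCoeff P (d - (x.1 : ℕ)) x.2 b)

/-- The pencil `C_s`, the block row `λ P_d, …, λ P_2`. -/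
def pencilC {m : ℕ} (P : Matrix (Fin m) (Fin m) ℂ[X]) (d : ℕ) :
    Matrix (Fin m) (Fin (d - 1) × Fin m) ℂ[X] :=
  Matrix.of fun a y => X * C (polyCoeff P (d - (y.1 : ℕ)) a y.2)

/-- The pencil `D_s = λ P_1 + P_0`. -/
def pencilD {m : ℕ} (P : Matrix (Fin m) (Fin m) ℂ[X]) : Matrix (Fin m) (Fin m) ℂ[X] :=
  Matrix.of fun a b => X * C (polyCoeff P 1 a b) + C (polyCoeff P 0 a b)

/-- The matrix relating `U` and `V` for the polynomial part: `I` in the Hermitian and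
skew-Hermitian cases, `S = diag((-1)^(d-1) I, …, (-1)^2 I, -I)` in the other two cases. -/
def polyScaling (τ : SelfConj) (m d : ℕ) :
    Matrix (Fin (d - 1) × Fin m) (Fin (d - 1) × Fin m) ℂ :=
  match τ with
  | .hermitian => 1
  | .skewHermitian => 1
  | .paraHermitian => Matrix.diagonal fun x => (-1 : ℂ) ^ (d - 1 - (x.1 : ℕ))
  | .paraSkewHermitian => Matrix.diagonal fun x => (-1 : ℂ) ^ (d - 1 - (x.1 : ℕ))

/-- `U`, `V` are unitary with `U = V` or `U = S V` according to the structure, and they compress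
`T`: `U* T V = diag(0, T̂)` with `T̂` invertible. -/
structure IsPolyCompression (τ : SelfConj) {m : ℕ} (P : Matrix (Fin m) (Fin m) ℂ[X]) (d : ℕ)
    {p r : ℕ} (U V : Matrix (Fin (d - 1) × Fin m) (Fin p ⊕ Fin r) ℂ)
    (That : Matrix (Fin r) (Fin r) ℂ) : Prop where
  unitary_left : IsUnitary U
  unitary_right : IsUnitary V
  left_eq : U = polyScaling τ m d * V
  compress : Uᴴ * blockT P d * V = Matrix.fromBlocks 0 0 0 That
  invertible : IsUnit That

/-- `Â_s = U₂* A_s V₂`, where `U₂`, `V₂` are the last columns of `U`, `V`. -/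
def hatA {m p r : ℕ} (P : Matrix (Fin m) (Fin m) ℂ[X]) (d : ℕ)
    (U V : Matrix (Fin (d - 1) × Fin m) (Fin p ⊕ Fin r) ℂ) : Matrix (Fin r) (Fin r) ℂ[X] :=
  const U.toCols₂ᴴ * pencilA P d * const V.toCols₂

/-- `-B̂_s = U₂* (-B_s)`. -/
def hatNegB {m p r : ℕ} (P : Matrix (Fin m) (Fin m) ℂ[X]) (d : ℕ)
    (U : Matrix (Fin (d - 1) × Fin m) (Fin p ⊕ Fin r) ℂ) : Matrix (Fin r) (Fin m) ℂ[X] :=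
  const U.toCols₂ᴴ * pencilNegB P d

/-- `Ĉ_s = C_s V₂`. -/
def hatC {m p r : ℕ} (P : Matrix (Fin m) (Fin m) ℂ[X]) (d : ℕ)
    (V : Matrix (Fin (d - 1) × Fin m) (Fin p ⊕ Fin r) ℂ) : Matrix (Fin m) (Fin r) ℂ[X] :=
  pencilC P d * const V.toCols₂

/-! ### The strictly proper part -/

/-- The block Hankel matrix `H` with `k` block rows and columns, numbered from `0`, whose block
`(i, j)` is `R_(-i-j-1)`. -/
def hankel {m : ℕ} (R : Matrix (Fin m) (Fin m) (RatFunc ℂ)) (k : ℕ) :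
    Matrix (Fin k × Fin m) (Fin k × Fin m) ℂ :=
  Matrix.of fun x y => laurentCoeff (R x.2 y.2) (-((x.1 : ℤ) + (y.1 : ℤ) + 1))

/-- The shifted block Hankel matrix `H_σ`, whose block `(i, j)` is `R_(-i-j-2)`. -/
def shiftedHankel {m : ℕ} (R : Matrix (Fin m) (Fin m) (RatFunc ℂ)) (k : ℕ) :
    Matrix (Fin k × Fin m) (Fin k × Fin m) ℂ :=
  Matrix.of fun x y => laurentCoeff (R x.2 y.2) (-((x.1 : ℤ) + (y.1 : ℤ) + 2))

/-- `diag(ε_1/ψ_1, …, ε_m/ψ_m)` is the Smith-McMillan form of the square rational matrix `R`: it is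
unimodularly equivalent to `R`, the fractions are reduced with `ψ_i` monic and `ε_i` monic or zero,
`ε_i` divides `ε_(i+1)`, and `ψ_(i+1)` divides `ψ_i`. -/
structure IsSmithMcMillanForm {m : ℕ} (R : Matrix (Fin m) (Fin m) (RatFunc ℂ))
    (ε ψ : Fin m → ℂ[X]) : Prop where
  monic_num : ∀ i, ε i = 0 ∨ (ε i).Monic
  monic_den : ∀ i, (ψ i).Monic
  coprime : ∀ i, IsCoprime (ε i) (ψ i)
  dvd_num : ∀ i j, i ≤ j → ε i ∣ ε j
  dvd_den : ∀ i j, i ≤ j → ψ j ∣ ψ i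
  equiv : ∃ E F : Matrix (Fin m) (Fin m) ℂ[X], IsUnit E.det ∧ IsUnit F.det ∧
    toRat E * R * toRat F = Matrix.diagonal fun i =>
      algebraMap ℂ[X] (RatFunc ℂ) (ε i) / algebraMap ℂ[X] (RatFunc ℂ) (ψ i)

/-- `δ` is the total polar degree of the finite poles of `R`, i.e. the sum of the degrees of the
denominators in the Smith-McMillan form of `R`. -/
def IsFinitePolarDegree {m : ℕ} (R : Matrix (Fin m) (Fin m) (RatFunc ℂ)) (δ : ℕ) : Prop :=
  ∃ ε ψ : Fin m → ℂ[X], IsSmithMcMillanForm R ε ψ ∧ δ = ∑ i, (ψ i).natDegree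

/-- `k` is large enough: the rank of the block Hankel matrix `H` of size `k` equals the total polar
degree of the finite poles of `R`. -/
def IsLargeEnough {m : ℕ} (R : Matrix (Fin m) (Fin m) (RatFunc ℂ)) (k : ℕ) : Prop :=
  IsFinitePolarDegree R (hankel R k).rank

/-- The matrix relating `U` and `V` for the strictly proper part: `I` in the Hermitian and
skew-Hermitian cases, `S = diag(-I, (-1)^2 I, …, (-1)^k I)` in the other two cases. -/
def hankelScaling (τ : SelfConj) (m k : ℕ) : Matrix (Fin k × Fin m) (Fin k × Fin m) ℂ :=
  match τ with
  | .hermitian => 1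
  | .skewHermitian => 1
  | .paraHermitian => Matrix.diagonal fun x => (-1 : ℂ) ^ ((x.1 : ℕ) + 1)
  | .paraSkewHermitian => Matrix.diagonal fun x => (-1 : ℂ) ^ ((x.1 : ℕ) + 1)

/-- `U`, `V` are unitary with `U = V` or `U = S V` according to the structure, and they compress
`H`: `U* H V = diag(Ĥ, 0)` with `Ĥ` invertible. -/
structure IsHankelCompression (τ : SelfConj) {m : ℕ} (R : Matrix (Fin m) (Fin m) (RatFunc ℂ))
    (k : ℕ) {r q : ℕ} (U V : Matrix (Fin k × Fin m) (Fin r ⊕ Fin q) ℂ)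
    (Hhat : Matrix (Fin r) (Fin r) ℂ) : Prop where
  unitary_left : IsUnitary U
  unitary_right : IsUnitary V
  left_eq : U = hankelScaling τ m k * V
  compress : Uᴴ * hankel R k * V = Matrix.fromBlocks Hhat 0 0 0
  invertible : IsUnit Hhat

/-- `V₁₁`, the first block row of the first columns `V₁` of `V`. -/
def firstBlock {m k r q : ℕ} (hk : 0 < k) (V : Matrix (Fin k × Fin m) (Fin r ⊕ Fin q) ℂ) :
    Matrix (Fin m) (Fin r) ℂ :=
  Matrix.of fun a j => V (⟨0, hk⟩, a) (Sum.inl j)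

/-- `A_sp = V₁* H_σ V₁ - λ Ĥ` in the Hermitian and skew-Hermitian cases and
`A_sp = V₁* S H_σ V₁ - λ Ĥ` in the other two cases. -/
def spA (τ : SelfConj) {m k r q : ℕ} (R : Matrix (Fin m) (Fin m) (RatFunc ℂ))
    (V : Matrix (Fin k × Fin m) (Fin r ⊕ Fin q) ℂ) (Hhat : Matrix (Fin r) (Fin r) ℂ) :
    Matrix (Fin r) (Fin r) ℂ[X] :=
  const (V.toCols₁ᴴ * (hankelScaling τ m k * shiftedHankel R k) * V.toCols₁)
    - (X : ℂ[X]) • const Hhat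

/-- `-B_sp = Ĥ V₁₁*`. -/
def spNegB {m k r q : ℕ} (hk : 0 < k) (V : Matrix (Fin k × Fin m) (Fin r ⊕ Fin q) ℂ)
    (Hhat : Matrix (Fin r) (Fin r) ℂ) : Matrix (Fin r) (Fin m) ℂ[X] :=
  const (Hhat * (firstBlock hk V)ᴴ)

/-- `C_sp = V₁₁ Ĥ` in the Hermitian and skew-Hermitian cases, `C_sp = -V₁₁ Ĥ` in the others. -/
def spC (τ : SelfConj) {m k r q : ℕ} (hk : 0 < k)
    (V : Matrix (Fin k × Fin m) (Fin r ⊕ Fin q) ℂ) (Hhat : Matrix (Fin r) (Fin r) ℂ) :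
    Matrix (Fin m) (Fin r) ℂ[X] :=
  match τ with
  | .hermitian => const (firstBlock hk V * Hhat)
  | .skewHermitian => const (firstBlock hk V * Hhat)
  | .paraHermitian => const (-(firstBlock hk V * Hhat))
  | .paraSkewHermitian => const (-(firstBlock hk V * Hhat))

/-! ### The combined pencil -/

/-- The pencil
`[Â_s, 0, -B̂_s; 0, A_sp, -B_sp; Ĉ_s, C_sp, D̂_s]`. -/
def combined (τ : SelfConj) {m p r k rf q : ℕ} (hk : 0 < k)
    (P : Matrix (Fin m) (Fin m) ℂ[X]) (d : ℕ)
    (U V : Matrix (Fin (d - 1) × Fin m) (Fin p ⊕ Fin r) ℂ)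
    (Rsp : Matrix (Fin m) (Fin m) (RatFunc ℂ))
    (W : Matrix (Fin k × Fin m) (Fin rf ⊕ Fin q) ℂ) (Hhat : Matrix (Fin rf) (Fin rf) ℂ) :
    Matrix ((Fin r ⊕ Fin rf) ⊕ Fin m) ((Fin r ⊕ Fin rf) ⊕ Fin m) ℂ[X] :=
  Matrix.fromBlocks
    (Matrix.fromBlocks (hatA P d U V) 0 0 (spA τ Rsp W Hhat))
    (Matrix.fromRows (hatNegB P d U) (spNegB hk W Hhat))
    (Matrix.fromCols (hatC P d V) (spC τ hk W Hhat))
    (pencilD P)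

end StrongLin

end

noncomputable section

namespace StrongLin

section

/-! ### Laurent expansion at infinity -/

/-! The polynomial part and the strictly proper part are realized separately, and the two
realizations do not disturb each other.

Strictly proper part. The vectors `(R p)_sp`, with `p` a polynomial vector, form the state space. A
Smith-McMillan form identifies it with tuples of polynomials of degree below `deg ψ_i`, so its
dimension is the finite polar degree (`finrank_stateSpace`). The shift `f ↦ (λ f)_sp` acts on it,
and a basis gives a minimal realization `R = c (λ - S)⁻¹ b` (`exists_isMinimalRealization`). The
Hankel matrices factor as `H = O Γ` and `H_σ = O S Γ` through the observability and controllability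
matrices, which have full rank for large `k`. If `rank H` is the polar degree, then `G = Y₁* O` and
`K = Γ W₁` are square with `G K = Ĥ` invertible, and the pencil of the construction is `[G (S - λ)
K, G b; c K, 0]`, strictly equivalent to a minimal realization (`exists_sp_factorization`).

Polynomial part. With the nilpotent block shift `N` one has `A_s = λ N T - T` and `N T = T Nᵀ`. The
compression removes exactly the kernels of `T`. Nilpotency makes `Â_s` invertible at every finite
point (`hatA_eval_isUnit`); at infinity `N` loses only the last block, which `B_s` and `C_s` supply
(`hat_row_infinity`, `hat_col_infinity`). The column `(λ^(d-1), …, λ)` solves the linear system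
behind the transfer function (`hat_transfer`).

Combination. At finite points the component of a null vector in the polynomial part vanishes by
itself, at infinity the component in the strictly proper part does; what remains is a statement
about one part (`isStronglyMinimal_combine`).

Structure. Put `η = 1` or `-1` for the real line or the imaginary axis, and let `σ` be the sign of
the structure. Comparing coefficients gives `P_n* = σ η^n P_n` and `R_(-n)* = σ η^n R_(-n)`
(`SelfConj.RatHas.coeff`). Hence the scaled matrices `S T`, `S H`, `S H_σ` are Hermitian up to the
signs `σ`, `σ η`, `σ`. The spectral theorem then yields the unitary compressions, and the same
identities give the structure of each block. -/

/-- The expansion of a polynomial in powers of `t = λ⁻¹`. -/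
def polyLaurent : ℂ[X] →+* LaurentSeries ℂ :=
  Polynomial.eval₂RingHom (HahnSeries.C : ℂ →+* LaurentSeries ℂ) (HahnSeries.single (-1 : ℤ) (1 : ℂ))

lemma polyLaurent_coeff_neg (p : ℂ[X]) (n : ℕ) : (polyLaurent p).coeff (-(n : ℤ)) = p.coeff n := by
  induction p using Polynomial.induction_on' with
  | add p q hp hq => simp [hp, hq]
  | monomial k a =>
    have : polyLaurent (monomial k a) = HahnSeries.single (-(k : ℤ)) a := by
      simp [polyLaurent, eval₂_monomial, HahnSeries.single_pow, HahnSeries.C_apply,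
        HahnSeries.single_mul_single]
    rw [this, coeff_monomial, HahnSeries.coeff_single]
    simp [eq_comm]

lemma polyLaurent_coeff_pos (p : ℂ[X]) {n : ℤ} (hn : 0 < n) : (polyLaurent p).coeff n = 0 := by
  induction p using Polynomial.induction_on' with
  | add p q hp hq => simp [hp, hq]
  | monomial k a =>
    have : polyLaurent (monomial k a) = HahnSeries.single (-(k : ℤ)) a := by
      simp [polyLaurent, eval₂_monomial, HahnSeries.single_pow, HahnSeries.C_apply,
        HahnSeries.single_mul_single]
    rw [this, HahnSeries.coeff_single_of_ne]
    omega

lemma polyLaurent_injective : Function.Injective polyLaurent := by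
  rw [injective_iff_map_eq_zero]
  intro p hp
  ext n
  rw [← polyLaurent_coeff_neg, hp]
  simp

lemma polyLaurent_order {p : ℂ[X]} (hp : p ≠ 0) : (polyLaurent p).order = -(p.natDegree : ℤ) := by
  apply le_antisymm
  · apply HahnSeries.order_le_of_coeff_ne_zero
    rw [polyLaurent_coeff_neg]
    simpa using hp
  · have hne : polyLaurent p ≠ 0 := by
      simpa using (map_ne_zero_iff _ polyLaurent_injective).2 hp
    by_contra! h
    have h0 := HahnSeries.coeff_order_eq_zero.not.2 hne
    obtain ⟨k, hk⟩ : ∃ k : ℕ, (polyLaurent p).order = -(k : ℤ) :=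
      ⟨(-(polyLaurent p).order).toNat, by omega⟩
    rw [hk, polyLaurent_coeff_neg] at h0
    exact h0 (coeff_eq_zero_of_natDegree_lt (by omega))

/-- The Laurent expansion at infinity. -/
def laurentHom : RatFunc ℂ →+* LaurentSeries ℂ :=
  RatFunc.liftRingHom polyLaurent
    (nonZeroDivisors_le_comap_nonZeroDivisors_of_injective _ polyLaurent_injective)

lemma laurentHom_algebraMap (p : ℂ[X]) : laurentHom (algebraMap _ _ p) = polyLaurent p := by
  simp [laurentHom]

lemma laurentCoeff_eq (f : RatFunc ℂ) (i : ℤ) : laurentCoeff f i = (laurentHom f).coeff (-i) := by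
  rw [laurentHom, RatFunc.liftRingHom_apply]
  rfl

@[simp] lemma laurentCoeff_zero (i : ℤ) : laurentCoeff 0 i = 0 := by simp [laurentCoeff_eq]

lemma laurentCoeff_add (f g : RatFunc ℂ) (i : ℤ) :
    laurentCoeff (f + g) i = laurentCoeff f i + laurentCoeff g i := by simp [laurentCoeff_eq]

lemma laurentCoeff_sub (f g : RatFunc ℂ) (i : ℤ) :
    laurentCoeff (f - g) i = laurentCoeff f i - laurentCoeff g i := by simp [laurentCoeff_eq]

lemma laurentCoeff_C_mul (c : ℂ) (f : RatFunc ℂ) (i : ℤ) :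
    laurentCoeff (RatFunc.C c * f) i = c * laurentCoeff f i := by
  rw [laurentCoeff_eq, map_mul, ← RatFunc.algebraMap_C, laurentHom_algebraMap]
  simp [polyLaurent, laurentCoeff_eq]

/-- The coefficient of `λ ^ i` as a linear functional. -/
def laurentCoeffLinear (i : ℤ) : RatFunc ℂ →ₗ[ℂ] ℂ where
  toFun f := laurentCoeff f i
  map_add' f g := laurentCoeff_add f g i
  map_smul' c f := by simp [RatFunc.smul_eq_C_mul, laurentCoeff_C_mul]

lemma laurentCoeff_sum {ι : Type*} (s : Finset ι) (f : ι → RatFunc ℂ) (i : ℤ) :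
    laurentCoeff (∑ j ∈ s, f j) i = ∑ j ∈ s, laurentCoeff (f j) i :=
  map_sum (laurentCoeffLinear i) f s

lemma laurentCoeff_X_mul (f : RatFunc ℂ) (i : ℤ) :
    laurentCoeff (RatFunc.X * f) i = laurentCoeff f (i - 1) := by
  rw [laurentCoeff_eq, map_mul, ← RatFunc.algebraMap_X, laurentHom_algebraMap]
  simp only [polyLaurent, coe_eval₂RingHom, eval₂_X, HahnSeries.coeff_single_mul, one_mul]
  rw [laurentCoeff_eq]
  congr 1
  ring

lemma laurentCoeff_polynomial (p : ℂ[X]) (n : ℕ) :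
    laurentCoeff (algebraMap _ _ p) n = p.coeff n := by
  rw [laurentCoeff_eq, laurentHom_algebraMap, polyLaurent_coeff_neg]

lemma laurentCoeff_polynomial_neg (p : ℂ[X]) {i : ℤ} (hi : i < 0) :
    laurentCoeff (algebraMap _ _ p) i = 0 := by
  rw [laurentCoeff_eq, laurentHom_algebraMap, polyLaurent_coeff_pos _ (by omega)]

/-! ### Strictly proper rational functions -/

/-- The strictly proper rational functions. -/
def strictlyProper : Submodule ℂ (RatFunc ℂ) where
  carrier := {f | ∀ n : ℕ, laurentCoeff f n = 0}
  add_mem' hf hg n := by simp [laurentCoeff_add, hf n, hg n]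
  zero_mem' n := by simp
  smul_mem' c f hf n := by simp [RatFunc.smul_eq_C_mul, laurentCoeff_C_mul, hf n]

/-- The expansion of the quotient has order `deg q - deg p > 0` in `t = λ⁻¹`, by additivity of
orders. -/
lemma div_mem_strictlyProper {p q : ℂ[X]} (h : p.degree < q.degree) :
    algebraMap ℂ[X] (RatFunc ℂ) p / algebraMap _ _ q ∈ strictlyProper := by
  intro n
  have hq : q ≠ 0 := by rintro rfl; simp at h
  by_cases hp : p = 0
  · simp [hp]
  have hdeg : p.natDegree < q.natDegree := natDegree_lt_natDegree hp h
  have hq' : polyLaurent q ≠ 0 := (map_ne_zero_iff _ polyLaurent_injective).2 hq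
  have hp' : polyLaurent p ≠ 0 := (map_ne_zero_iff _ polyLaurent_injective).2 hp
  have key : laurentHom (algebraMap ℂ[X] (RatFunc ℂ) p / algebraMap _ _ q) * polyLaurent q
      = polyLaurent p := by
    rw [map_div₀, laurentHom_algebraMap, laurentHom_algebraMap, div_mul_cancel₀ _ hq']
  have hf : laurentHom (algebraMap ℂ[X] (RatFunc ℂ) p / algebraMap _ _ q) ≠ 0 := by
    intro h0
    rw [h0, zero_mul] at key
    exact hp' key.symm
  have hord := HahnSeries.order_mul hf hq'
  rw [key, polyLaurent_order hp, polyLaurent_order hq] at hord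
  rw [laurentCoeff_eq]
  apply HahnSeries.coeff_eq_zero_of_lt_order
  omega

lemma exists_polynomial_add_strictlyProper (f : RatFunc ℂ) :
    ∃ p : ℂ[X], ∃ g ∈ strictlyProper, f = algebraMap _ _ p + g ∧
      g = algebraMap _ _ (f.num % f.denom) / algebraMap _ _ f.denom := by
  refine ⟨f.num / f.denom, _, div_mem_strictlyProper
    (EuclideanDomain.mod_lt f.num f.denom_ne_zero), ?_, rfl⟩
  have hd : algebraMap ℂ[X] (RatFunc ℂ) f.denom ≠ 0 := by simpa using f.denom_ne_zero
  conv_lhs => rw [← RatFunc.num_div_denom f, ← EuclideanDomain.div_add_mod f.num f.denom]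
  rw [map_add, map_mul]
  field_simp

lemma polynomial_mem_strictlyProper {p : ℂ[X]}
    (h : algebraMap ℂ[X] (RatFunc ℂ) p ∈ strictlyProper) : p = 0 := by
  ext n
  rw [← laurentCoeff_polynomial, h n, coeff_zero]

/-- Vanishing of coefficients is visibly a linear condition, unlike the comparison of degrees. To
return to degrees: the polynomial quotient of numerator by denominator is itself strictly proper,
hence zero, so the numerator equals its own remainder. -/
lemma mem_strictlyProper_iff_degree (f : RatFunc ℂ) :
    f ∈ strictlyProper ↔ f.num.degree < f.denom.degree := by
  constructor
  · intro hf
    obtain ⟨p, g, hg, hfg, hg'⟩ := exists_polynomial_add_strictlyProper f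
    have hp : p = 0 := by
      apply polynomial_mem_strictlyProper
      have := sub_mem hf hg
      rwa [hfg, add_sub_cancel_right] at this
    rw [hp, map_zero, zero_add] at hfg
    have hd : algebraMap ℂ[X] (RatFunc ℂ) f.denom ≠ 0 := by simpa using f.denom_ne_zero
    have h1 : f * algebraMap _ _ f.denom = algebraMap _ _ (f.num % f.denom) := by
      conv_lhs => lhs; rw [hfg, hg']
      rw [div_mul_cancel₀ _ hd]
    have h2 : f * algebraMap _ _ f.denom = algebraMap _ _ f.num := by
      conv_lhs => lhs; rw [← RatFunc.num_div_denom f]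
      rw [div_mul_cancel₀ _ hd]
    rw [h1] at h2
    rw [← RatFunc.algebraMap_injective ℂ h2]
    exact EuclideanDomain.mod_lt f.num f.denom_ne_zero
  · intro h
    rw [← RatFunc.num_div_denom f]
    exact div_mem_strictlyProper h

lemma eq_zero_of_laurentCoeff {f : RatFunc ℂ} (hf : f ∈ strictlyProper)
    (h : ∀ n : ℕ, laurentCoeff f (-((n : ℤ) + 1)) = 0) : f = 0 := by
  rw [← map_eq_zero laurentHom]
  ext i
  obtain hi | hi := le_or_gt i 0
  · have := hf (-i).toNat
    rw [laurentCoeff_eq] at this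
    rw [HahnSeries.coeff_zero, ← this]
    congr 1
    omega
  · have := h (i - 1).toNat
    rw [laurentCoeff_eq] at this
    rw [HahnSeries.coeff_zero, ← this]
    congr 1
    omega

/-- The polynomials inside the rational functions. -/
def polynomials : Submodule ℂ (RatFunc ℂ) :=
  LinearMap.range (Algebra.linearMap ℂ[X] (RatFunc ℂ) |>.restrictScalars ℂ)

lemma isCompl_strictlyProper : IsCompl strictlyProper polynomials := by
  constructor
  · rw [Submodule.disjoint_def]
    rintro _ h ⟨p, rfl⟩
    have := polynomial_mem_strictlyProper h
    simp [this]
  · rw [codisjoint_iff, eq_top_iff]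
    intro f _
    obtain ⟨p, g, hg, hfg, -⟩ := exists_polynomial_add_strictlyProper f
    rw [hfg, add_comm]
    exact Submodule.add_mem_sup hg ⟨p, rfl⟩

/-- The strictly proper part of a rational function. -/
def spPart : RatFunc ℂ →ₗ[ℂ] RatFunc ℂ :=
  strictlyProper.subtype ∘ₗ Submodule.projectionOnto _ _ isCompl_strictlyProper

lemma spPart_mem (f : RatFunc ℂ) : spPart f ∈ strictlyProper := by
  simp [spPart]

lemma spPart_of_mem {f : RatFunc ℂ} (hf : f ∈ strictlyProper) : spPart f = f := by
  exact congrArg Subtype.val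
    (Submodule.projectionOnto_apply_left isCompl_strictlyProper ⟨f, hf⟩)

lemma spPart_polynomial (p : ℂ[X]) : spPart (algebraMap _ _ p) = 0 := by
  have : algebraMap ℂ[X] (RatFunc ℂ) p ∈ polynomials := ⟨p, rfl⟩
  exact congrArg Subtype.val
    (Submodule.projectionOnto_apply_of_mem_right isCompl_strictlyProper this)

lemma exists_eq_spPart_add (f : RatFunc ℂ) : ∃ p : ℂ[X], f = spPart f + algebraMap _ _ p := by
  obtain ⟨p, g, hg, hfg, -⟩ := exists_polynomial_add_strictlyProper f
  refine ⟨p, ?_⟩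
  conv_rhs => rw [hfg, map_add, spPart_polynomial, spPart_of_mem hg, zero_add]
  rw [hfg, add_comm]

lemma X_mul_sub_mem_strictlyProper {f : RatFunc ℂ} (hf : f ∈ strictlyProper) :
    RatFunc.X * f - RatFunc.C (laurentCoeff f (-1)) ∈ strictlyProper := by
  intro n
  rw [laurentCoeff_sub, laurentCoeff_X_mul, ← RatFunc.algebraMap_C, laurentCoeff_polynomial]
  cases n with
  | zero => simp
  | succ n =>
    simp [hf n]

end

section

/-! ### Smith form of a polynomial matrix -/

section Pivot

variable {n : Type*} [Fintype n] [DecidableEq n]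

/-- The `(i₀, i₀)` entry of `B` has minimal degree among all nonzero entries of all matrices
unimodularly equivalent to `B`. -/
def IsMinimalPivot (i₀ : n) (B : Matrix n n ℂ[X]) : Prop :=
  B i₀ i₀ ≠ 0 ∧ ∀ E F : Matrix n n ℂ[X], IsUnit E.det → IsUnit F.det → ∀ i j,
    (E * B * F) i j ≠ 0 → (B i₀ i₀).degree ≤ ((E * B * F) i j).degree

lemma isUnit_det_transvection {i j : n} (hij : i ≠ j) (c : ℂ[X]) :
    IsUnit (transvection i j c).det := by
  simp [det_transvection_of_ne i j hij]

lemma IsMinimalPivot.mul_left {i₀ : n} {B : Matrix n n ℂ[X]} (h : IsMinimalPivot i₀ B)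
    {E : Matrix n n ℂ[X]} (hE : IsUnit E.det) (h₀ : (E * B) i₀ i₀ = B i₀ i₀) :
    IsMinimalPivot i₀ (E * B) := by
  refine ⟨h₀ ▸ h.1, fun E' F hE' hF i j hne => ?_⟩
  rw [h₀]
  have := h.2 (E' * E) F (by rw [det_mul]; exact hE'.mul hE) hF i j
  rw [Matrix.mul_assoc E' E B] at this
  exact this hne

/-- A nonzero remainder modulo the pivot would be an entry of smaller degree in an equivalent
matrix. -/
lemma IsMinimalPivot.dvd_col {i₀ : n} {B : Matrix n n ℂ[X]} (h : IsMinimalPivot i₀ B) (i : n) :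
    B i₀ i₀ ∣ B i i₀ := by
  by_cases hi : i = i₀
  · rw [hi]
  rw [← EuclideanDomain.mod_eq_zero]
  by_contra hne
  have key : (transvection i i₀ (-(B i i₀ / B i₀ i₀)) * B * (1 : Matrix n n ℂ[X])) i i₀ = B i i₀ % B i₀ i₀ := by
    rw [Matrix.mul_one, transvection_mul_apply_same, EuclideanDomain.mod_eq_sub_mul_div]
    ring
  have := h.2 _ 1 (isUnit_det_transvection hi (-(B i i₀ / B i₀ i₀))) (by simp) i i₀
  rw [key] at this
  exact absurd (EuclideanDomain.mod_lt (B i i₀) h.1) (not_lt.2 (this hne))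

lemma IsMinimalPivot.dvd_row {i₀ : n} {B : Matrix n n ℂ[X]} (h : IsMinimalPivot i₀ B) (j : n) :
    B i₀ i₀ ∣ B i₀ j := by
  have ht : IsMinimalPivot i₀ Bᵀ := by
    refine ⟨h.1, fun E F hE hF i j hne => ?_⟩
    have := h.2 Fᵀ Eᵀ (by rwa [det_transpose]) (by rwa [det_transpose]) j i
    rw [← transpose_apply (Fᵀ * B * Eᵀ), transpose_mul, transpose_mul, transpose_transpose,
      transpose_transpose, ← Matrix.mul_assoc] at this
    exact this hne
  exact ht.dvd_col j

/-- Row `i` is first reduced so that its entry in column `i₀` vanishes. Adding it to row `i₀` then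
leaves the pivot unchanged, hence still minimal, and the row case applies to the sum. -/
lemma IsMinimalPivot.dvd {i₀ : n} {B : Matrix n n ℂ[X]} (h : IsMinimalPivot i₀ B) (i j : n) :
    B i₀ i₀ ∣ B i j := by
  by_cases hi : i = i₀
  · rw [hi]; exact h.dvd_row j
  obtain ⟨q, hq⟩ := h.dvd_col i
  set B₁ := transvection i i₀ (-q) * B with hB₁
  have e₁ : ∀ j, B₁ i₀ j = B i₀ j := fun j =>
    transvection_mul_apply_of_ne i i₀ i₀ j (Ne.symm hi) _ B
  have e₂ : ∀ j, B₁ i j = B i j - q * B i₀ j := fun j => by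
    rw [hB₁, transvection_mul_apply_same]; ring
  have h₁ : IsMinimalPivot i₀ B₁ := h.mul_left (isUnit_det_transvection hi _) (e₁ i₀)
  have e₃ : ∀ j, ((transvection i₀ i 1 * B₁ : Matrix n n ℂ[X])) i₀ j = B i₀ j + (B i j - q * B i₀ j) := fun j => by
    rw [transvection_mul_apply_same, e₁, e₂, one_mul]
  have e₄ : ((transvection i₀ i 1 * B₁ : Matrix n n ℂ[X])) i₀ i₀ = B i₀ i₀ := by rw [e₃, hq]; ring
  have h₂ := (h₁.mul_left (isUnit_det_transvection (Ne.symm hi) 1) (e₄.trans (e₁ i₀).symm)).dvd_row j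
  rw [e₄, e₃] at h₂
  have h₃ := h.dvd_row j
  have := dvd_add (dvd_sub h₂ h₃) (h₃.mul_left q)
  convert this using 1
  ring

lemma isUnit_det_swap (i j : n) : IsUnit (Matrix.swap ℂ[X] i j).det := by
  rw [← isUnit_iff_isUnit_det]
  exact IsUnit.of_mul_eq_one _ (Matrix.swap_mul_self i j)

/-- Degrees are well founded, so some entry of some equivalent matrix has minimal degree; two swaps
bring it to `(i₀, i₀)`. -/
lemma exists_isMinimalPivot (i₀ : n) {A : Matrix n n ℂ[X]} (hA : A ≠ 0) :
    ∃ E F : Matrix n n ℂ[X], IsUnit E.det ∧ IsUnit F.det ∧ IsMinimalPivot i₀ (E * A * F) := by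
  let S : Set ℂ[X] := {p | p ≠ 0 ∧ ∃ E F : Matrix n n ℂ[X], IsUnit E.det ∧ IsUnit F.det ∧
    ∃ i j, (E * A * F) i j = p}
  have hS : S.Nonempty := by
    obtain ⟨i, j, hij⟩ : ∃ i j, A i j ≠ 0 := by
      by_contra! h
      exact hA (by ext1 i j; exact h i j)
    exact ⟨A i j, hij, 1, 1, by simp, by simp, i, j, by simp⟩
  have wf : WellFounded fun p q : ℂ[X] => p.degree < q.degree := degree_lt_wf
  obtain ⟨hp, E, F, hE, hF, i, j, hij⟩ := wf.min_mem S hS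
  set p := wf.min S hS with hpdef
  have key : (Matrix.swap ℂ[X] i i₀ * E * A * (F * Matrix.swap ℂ[X] j i₀)) i₀ i₀ = p := by
    rw [← hij]
    have : Matrix.swap ℂ[X] i i₀ * E * A * (F * Matrix.swap ℂ[X] j i₀)
      = Matrix.swap ℂ[X] i i₀ * (E * A * F) * Matrix.swap ℂ[X] j i₀ := by
      simp only [Matrix.mul_assoc]
    rw [this, Matrix.mul_swap_apply_right, Matrix.swap_mul_apply_right]
  refine ⟨Matrix.swap ℂ[X] i i₀ * E, F * Matrix.swap ℂ[X] j i₀, ?_, ?_, ?_, ?_⟩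
  · rw [det_mul]; exact (isUnit_det_swap _ _).mul hE
  · rw [det_mul]; exact hF.mul (isUnit_det_swap _ _)
  · rwa [key]
  · intro E' F' hE' hF' k l hne
    rw [key]
    refine not_lt.1 (wf.not_lt_min S (x := _) ⟨hne, E' * (Matrix.swap ℂ[X] i i₀ * E),
      F * Matrix.swap ℂ[X] j i₀ * F', ?_, ?_, k, l, ?_⟩)
    · rw [det_mul, det_mul]; exact hE'.mul ((isUnit_det_swap _ _).mul hE)
    · rw [det_mul, det_mul]; exact (hF.mul (isUnit_det_swap _ _)).mul hF'
    · simp only [Matrix.mul_assoc]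

/-- Every nonzero polynomial matrix is unimodularly equivalent to a multiple `g • B` of a matrix `B`
with a unit pivot. -/
lemma exists_equiv_smul (i₀ : n) {A : Matrix n n ℂ[X]} (hA : A ≠ 0) :
    ∃ E F : Matrix n n ℂ[X], IsUnit E.det ∧ IsUnit F.det ∧ ∃ (g : ℂ[X]) (B : Matrix n n ℂ[X]),
      B i₀ i₀ = 1 ∧ E * A * F = g • B := by
  obtain ⟨E, F, hE, hF, h⟩ := exists_isMinimalPivot i₀ hA
  choose q hq using h.dvd
  refine ⟨E, F, hE, hF, (E * A * F) i₀ i₀, Matrix.of q, ?_, ?_⟩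
  · have := hq i₀ i₀
    exact (mul_right_eq_self₀.1 this.symm).resolve_right h.1
  · ext1 i j
    simpa using hq i j

end Pivot

/-- The pivot `g` is factored out of the whole matrix before the first row and column are cleared.
The induction then runs on the Schur complement `D - c b`, and the divisibility chain is `g` times
the chain `1 ∣ d₀ ∣ d₁ ∣ …`. -/
lemma exists_smith (m : ℕ) (A : Matrix (Fin m) (Fin m) ℂ[X]) :
    ∃ E F : Matrix (Fin m) (Fin m) ℂ[X], IsUnit E.det ∧ IsUnit F.det ∧ ∃ d : Fin m → ℂ[X],
      E * A * F = diagonal d ∧ ∀ i j, i ≤ j → d i ∣ d j := by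
  induction m with
  | zero => exact ⟨1, 1, by simp, by simp, 0, by ext1 i; exact i.elim0, fun i => i.elim0⟩
  | succ m ih =>
    by_cases hA : A = 0
    · exact ⟨1, 1, by simp, by simp, 0, by simp [hA], by simp⟩
    obtain ⟨E, F, hE, hF, g, B, hB, hEF⟩ := exists_equiv_smul 0 hA
    let e : Unit ⊕ Fin m ≃ Fin (m + 1) :=
      (Equiv.sumComm _ _).trans ((Equiv.optionEquivSumPUnit _).symm.trans (finSuccEquiv m).symm)
    have e0 : e (Sum.inl ()) = 0 := by simp [e]
    have eS : ∀ i, e (Sum.inr i) = i.succ := fun i => by simp [e]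
    let B' := B.submatrix e e
    have hB' : B' = fromBlocks 1 B'.toBlocks₁₂ B'.toBlocks₂₁ B'.toBlocks₂₂ := by
      conv_lhs => rw [← fromBlocks_toBlocks B']
      congr 1
      ext1 i j
      simp [B', toBlocks₁₁, e0, hB]
    set b := B'.toBlocks₁₂
    set c := B'.toBlocks₂₁
    set D := B'.toBlocks₂₂
    obtain ⟨E₁, F₁, hE₁, hF₁, d, hd, hdvd⟩ := ih (D - c * b)
    let E₂ : Matrix (Unit ⊕ Fin m) (Unit ⊕ Fin m) ℂ[X] :=
      fromBlocks 1 0 0 E₁ * fromBlocks 1 0 (-c) 1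
    let F₂ : Matrix (Unit ⊕ Fin m) (Unit ⊕ Fin m) ℂ[X] :=
      fromBlocks 1 (-b) 0 1 * fromBlocks 1 0 0 F₁
    have hE₂ : IsUnit E₂.det := by
      simp [E₂, det_mul, hE₁]
    have hF₂ : IsUnit F₂.det := by
      simp [F₂, det_mul, det_fromBlocks_zero₂₁, hF₁]
    have key : E₂ * B' * F₂ = diagonal (Sum.elim (fun _ => 1) d) := by
      have h1 : fromBlocks 1 0 (-c) 1 * B' * fromBlocks 1 (-b) 0 1 =
          fromBlocks 1 0 0 (D - c * b) := by
        rw [hB']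
        simp [fromBlocks_multiply, sub_eq_add_neg, add_comm]
      calc E₂ * B' * F₂ = fromBlocks 1 0 0 E₁ *
            (fromBlocks 1 0 (-c) 1 * B' * fromBlocks 1 (-b) 0 1) * fromBlocks 1 0 0 F₁ := by
            simp only [E₂, F₂, Matrix.mul_assoc]
        _ = fromBlocks 1 0 0 (diagonal d) := by
            rw [h1, ← hd]
            simp [fromBlocks_multiply, Matrix.mul_assoc]
        _ = _ := by
            rw [← diagonal_one, fromBlocks_diagonal]
    let E₃ := E₂.submatrix e.symm e.symm
    let F₃ := F₂.submatrix e.symm e.symm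
    have hB3 : B = B'.submatrix e.symm e.symm := by ext1 i j; simp [B']
    refine ⟨E₃ * E, F * F₃, ?_, ?_, fun i => g * (Sum.elim (fun _ => 1) d (e.symm i)), ?_, ?_⟩
    · rw [det_mul, det_submatrix_equiv_self]
      exact hE₂.mul hE
    · rw [det_mul, det_submatrix_equiv_self]
      exact hF.mul hF₂
    · have : E₃ * E * A * (F * F₃) = E₃ * (E * A * F) * F₃ := by simp only [Matrix.mul_assoc]
      rw [this, hEF, Matrix.mul_smul, Matrix.smul_mul, hB3, submatrix_mul_equiv,
        submatrix_mul_equiv, key, submatrix_diagonal_equiv, ← diagonal_smul]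
      rfl
    · have s0 : e.symm 0 = Sum.inl () := by rw [← e0, e.symm_apply_apply]
      have sS : ∀ i : Fin m, e.symm i.succ = Sum.inr i := fun i => by
        rw [← eS, e.symm_apply_apply]
      intro i j hij
      apply mul_dvd_mul_left
      cases i using Fin.cases with
      | zero => simp [s0]
      | succ i =>
        cases j using Fin.cases with
        | zero => exact absurd hij (by simp)
        | succ j => simpa [sS] using hdvd i j (Fin.succ_le_succ_iff.1 hij)

/-! ### Smith–McMillan form -/

lemma toRat_mul {l m n : Type*} [Fintype m] (A : Matrix l m ℂ[X]) (B : Matrix m n ℂ[X]) :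
    toRat (A * B) = toRat A * toRat B := Matrix.map_mul

lemma toRat_diagonal {m : Type*} [DecidableEq m] (d : m → ℂ[X]) :
    toRat (diagonal d) = diagonal fun i => algebraMap ℂ[X] (RatFunc ℂ) (d i) := by
  simp [toRat, diagonal_map]

lemma exists_smithMcMillan {m : ℕ} (R : Matrix (Fin m) (Fin m) (RatFunc ℂ)) :
    ∃ ε ψ : Fin m → ℂ[X], IsSmithMcMillanForm R ε ψ := by
  obtain ⟨b, hb⟩ := IsLocalization.exist_integer_multiples_of_finite (nonZeroDivisors ℂ[X])
    (fun x : Fin m × Fin m => R x.1 x.2)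
  choose N hN using hb
  have hb0 : algebraMap ℂ[X] (RatFunc ℂ) b ≠ 0 := by
    simp
  have hNR : toRat (Matrix.of fun i j => N (i, j)) = algebraMap ℂ[X] (RatFunc ℂ) b • R := by
    ext i j
    simp [toRat, hN, Algebra.smul_def]
  obtain ⟨E, F, hE, hF, d, hd, hdvd⟩ := exists_smith m (Matrix.of fun i j => N (i, j))
  let f : Fin m → RatFunc ℂ := fun i => algebraMap _ _ (d i) / algebraMap _ _ (b : ℂ[X])
  have hER : toRat E * R * toRat F = diagonal f := by
    have := congrArg toRat hd
    rw [toRat_mul, toRat_mul, hNR, toRat_diagonal, Matrix.mul_smul, Matrix.smul_mul] at this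
    have h2 := congrArg (fun M => (algebraMap ℂ[X] (RatFunc ℂ) b)⁻¹ • M) this
    simp only [smul_smul, inv_mul_cancel₀ hb0, one_smul] at h2
    rw [h2, ← diagonal_smul]
    congr 1
    ext i
    simp [f, div_eq_inv_mul]
  -- Each fraction is a polynomial multiple of the earlier ones; after reduction this makes the
  -- numerators divide upwards and the denominators downwards.
  have hf : ∀ i j, i ≤ j → ∃ q : ℂ[X], f j = f i * algebraMap _ _ q := by
    intro i j hij
    obtain ⟨q, hq⟩ := hdvd i j hij
    exact ⟨q, by simp [f, hq]; ring⟩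
  -- A reduced numerator need not be monic; the normalizing units are absorbed into the left
  -- unimodular factor.
  refine ⟨fun i => normalize (f i).num, fun i => (f i).denom, ?_, ?_, ?_, ?_, ?_, ?_⟩
  · intro i
    by_cases h : (f i).num = 0
    · left; simp [h]
    · right; exact Polynomial.monic_normalize h
  · exact fun i => RatFunc.monic_denom _
  · intro i
    rw [normalize_apply]
    exact (isCoprime_mul_unit_right_left (Units.isUnit _) _ _).2 (RatFunc.isCoprime_num_denom _)
  · intro i j hij
    rw [normalize_dvd_iff, dvd_normalize_iff]
    obtain ⟨q, hq⟩ := hf i j hij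
    have h1 : (f i).num * q * (f j).denom = (f j).num * (f i).denom := by
      apply RatFunc.algebraMap_injective ℂ
      have hi : algebraMap ℂ[X] (RatFunc ℂ) (f i).denom ≠ 0 := by
        simpa using (f i).denom_ne_zero
      have hj : algebraMap ℂ[X] (RatFunc ℂ) (f j).denom ≠ 0 := by
        simpa using (f j).denom_ne_zero
      have h2 := hq
      rw [← RatFunc.num_div_denom (f i), ← RatFunc.num_div_denom (f j)] at h2
      simp only [map_mul]
      field_simp at h2
      rw [h2]
      ring
    exact (RatFunc.isCoprime_num_denom (f i)).dvd_of_dvd_mul_right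
      ⟨q * (f j).denom, by rw [← h1]; ring⟩
  · intro i j hij
    obtain ⟨q, hq⟩ := hf i j hij
    have := RatFunc.denom_mul_dvd (f i) (algebraMap _ _ q)
    rw [← hq, RatFunc.denom_algebraMap, mul_one] at this
    exact this
  · refine ⟨diagonal (fun i => ((normUnit (f i).num : ℂ[X]ˣ) : ℂ[X])) * E, F, ?_, hF, ?_⟩
    · rw [det_mul, det_diagonal]
      refine IsUnit.mul ?_ hE
      exact IsUnit.prod_univ_iff.2 fun i => Units.isUnit _
    · rw [toRat_mul, Matrix.mul_assoc, Matrix.mul_assoc, ← Matrix.mul_assoc _ R, hER,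
        toRat_diagonal, diagonal_mul_diagonal]
      congr 1
      ext i
      rw [normalize_apply, map_mul, mul_comm, mul_div_right_comm, RatFunc.num_div_denom]

end

section

/-! ### The state space of a rational matrix -/

/-- A vector of polynomials seen as a vector of rational functions. -/
def toRatVec {n : Type*} (p : n → ℂ[X]) : n → RatFunc ℂ := fun i => algebraMap _ _ (p i)

lemma toRat_mulVec {m n : Type*} [Fintype n] (A : Matrix m n ℂ[X]) (p : n → ℂ[X]) :
    toRat A *ᵥ toRatVec p = toRatVec (A *ᵥ p) := by
  ext i
  simp [toRatVec, toRat, mulVec, dotProduct]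

/-- The strictly proper part of a vector of rational functions. -/
def spVec (n : Type*) : (n → RatFunc ℂ) →ₗ[ℂ] (n → RatFunc ℂ) := spPart.compLeft n

lemma spVec_toRatVec {n : Type*} (p : n → ℂ[X]) : spVec n (toRatVec p) = 0 := by
  ext i
  exact spPart_polynomial (p i)

lemma spVec_of_mem {n : Type*} {v : n → RatFunc ℂ} (h : ∀ i, v i ∈ strictlyProper) :
    spVec n v = v := by
  ext i
  exact spPart_of_mem (h i)

lemma exists_eq_spVec_add {n : Type*} (v : n → RatFunc ℂ) : ∃ p, v = spVec n v + toRatVec p := by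
  choose p hp using fun i => exists_eq_spPart_add (v i)
  exact ⟨p, funext hp⟩

variable {m : ℕ}

/-- The map `p ↦ (R p)_sp` whose range is the state space. -/
def stateMap (R : Matrix (Fin m) (Fin m) (RatFunc ℂ)) :
    (Fin m → ℂ[X]) →ₗ[ℂ] (Fin m → RatFunc ℂ) :=
  spVec (Fin m) ∘ₗ (R.mulVecLin.restrictScalars ℂ) ∘ₗ
    ((Algebra.linearMap ℂ[X] (RatFunc ℂ)).restrictScalars ℂ).compLeft (Fin m)

lemma stateMap_apply (R : Matrix (Fin m) (Fin m) (RatFunc ℂ)) (p : Fin m → ℂ[X]) :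
    stateMap R p = spVec _ (R *ᵥ toRatVec p) := rfl

lemma stateMap_mem (R : Matrix (Fin m) (Fin m) (RatFunc ℂ)) (p : Fin m → ℂ[X]) (i : Fin m) :
    stateMap R p i ∈ strictlyProper := spPart_mem _

/-- The polynomial part of `R p` stays polynomial after multiplication by `λ`. Hence the state space
is invariant under `f ↦ (λ f)_sp`. -/
lemma stateMap_X_smul (R : Matrix (Fin m) (Fin m) (RatFunc ℂ)) (p : Fin m → ℂ[X]) :
    stateMap R ((X : ℂ[X]) • p) = spVec _ ((RatFunc.X : RatFunc ℂ) • stateMap R p) := by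
  obtain ⟨q, hq⟩ := exists_eq_spVec_add (R *ᵥ toRatVec p)
  have h1 : toRatVec ((X : ℂ[X]) • p) = (RatFunc.X : RatFunc ℂ) • toRatVec p := by
    ext i; simp [toRatVec]
  have h2 : (RatFunc.X : RatFunc ℂ) • toRatVec q = toRatVec ((X : ℂ[X]) • q) := by
    ext i; simp [toRatVec]
  rw [stateMap_apply, h1, mulVec_smul, hq, smul_add, map_add, h2, spVec_toRatVec, add_zero]
  rfl

/-- Polynomial vectors over the denominators of a Smith–McMillan form, moved to the state space. -/
def polarMap (E : Matrix (Fin m) (Fin m) ℂ[X]) (ψ : Fin m → ℂ[X]) :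
    (∀ i, degreeLT ℂ (ψ i).natDegree) →ₗ[ℂ] (Fin m → RatFunc ℂ) where
  toFun r := spVec _ (toRat E *ᵥ fun i => algebraMap _ _ (r i : ℂ[X]) / algebraMap _ _ (ψ i))
  map_add' r s := by
    rw [← map_add, ← mulVec_add]
    congr 2
    ext i
    simp [add_div]
  map_smul' c r := by
    rw [RingHom.id_apply, ← map_smul, ← mulVec_smul]
    congr 2
    ext i
    simp [Algebra.smul_def, mul_div_assoc, ← RatFunc.algebraMap_C]

lemma polarMap_apply (E : Matrix (Fin m) (Fin m) ℂ[X]) (ψ : Fin m → ℂ[X])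
    (r : ∀ i, degreeLT ℂ (ψ i).natDegree) :
    polarMap E ψ r = spVec _ (toRat E *ᵥ fun i => algebraMap _ _ (r i : ℂ[X]) / algebraMap _ _ (ψ i)) :=
  rfl

lemma toRat_one {n : Type*} [DecidableEq n] : toRat (1 : Matrix n n ℂ[X]) = 1 := by
  simp [toRat]

lemma degree_lt_of_mem_degreeLT {ψ : ℂ[X]} (hψ : ψ ≠ 0) (r : degreeLT ℂ ψ.natDegree) :
    (r : ℂ[X]).degree < ψ.degree := by
  rw [degree_eq_natDegree hψ]
  exact mem_degreeLT.1 r.2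

/-- If the strictly proper part of `E f` vanishes, then `E f` is polynomial, and so is `f` because
`E` is unimodular. But `f` is strictly proper, so it is zero. -/
lemma polarMap_injective {E : Matrix (Fin m) (Fin m) ℂ[X]} (hE : IsUnit E.det) {ψ : Fin m → ℂ[X]}
    (hψ : ∀ i, (ψ i).Monic) : Function.Injective (polarMap E ψ) := by
  rw [injective_iff_map_eq_zero]
  intro r hr
  set f : Fin m → RatFunc ℂ := fun i => algebraMap _ _ (r i : ℂ[X]) / algebraMap _ _ (ψ i) with hf
  rw [polarMap_apply] at hr
  obtain ⟨q, hq⟩ := exists_eq_spVec_add (toRat E *ᵥ f)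
  rw [hr, zero_add] at hq
  have h1 : f = toRatVec (E⁻¹ *ᵥ q) := by
    rw [← toRat_mulVec, ← hq, mulVec_mulVec, ← toRat_mul, nonsing_inv_mul _ hE, toRat_one,
      one_mulVec]
  ext1 i
  have h2 : f i ∈ strictlyProper :=
    div_mem_strictlyProper (degree_lt_of_mem_degreeLT (hψ i).ne_zero (r i))
  have h3 : f i = 0 := by
    rw [h1] at h2 ⊢
    rw [toRatVec, polynomial_mem_strictlyProper h2, map_zero]
  have h4 : algebraMap ℂ[X] (RatFunc ℂ) (ψ i) ≠ 0 := by simpa using (hψ i).ne_zero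
  rw [hf] at h3
  simp only [div_eq_zero_iff, h4, or_false] at h3
  ext1
  simpa using h3

/-- In the coordinates of the Smith-McMillan form, states are the classes of `ε_i s_i / ψ_i` modulo
polynomials. Coprimality makes `ε_i` invertible modulo `ψ_i`, so every remainder modulo `ψ_i`
occurs. -/
lemma range_polarMap {R : Matrix (Fin m) (Fin m) (RatFunc ℂ)} {ε ψ : Fin m → ℂ[X]}
    (hψ : ∀ i, (ψ i).Monic) (hc : ∀ i, IsCoprime (ε i) (ψ i)) {E F : Matrix (Fin m) (Fin m) ℂ[X]}
    (hE : IsUnit E.det) (hF : IsUnit F.det)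
    (h : toRat E * R * toRat F = Matrix.diagonal fun i =>
      algebraMap ℂ[X] (RatFunc ℂ) (ε i) / algebraMap ℂ[X] (RatFunc ℂ) (ψ i)) :
    LinearMap.range (polarMap E⁻¹ ψ) = LinearMap.range (stateMap R) := by
  have hψ0 : ∀ i, algebraMap ℂ[X] (RatFunc ℂ) (ψ i) ≠ 0 := fun i => by
    simpa using (hψ i).ne_zero
  have hRF : ∀ s : Fin m → ℂ[X], R *ᵥ toRatVec (F *ᵥ s) = toRat E⁻¹ *ᵥ fun i =>
      algebraMap ℂ[X] (RatFunc ℂ) (ε i * s i) / algebraMap ℂ[X] (RatFunc ℂ) (ψ i) := by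
    intro s
    have h1 : R * toRat F = toRat E⁻¹ * (toRat E * R * toRat F) := by
      rw [Matrix.mul_assoc (toRat E), ← Matrix.mul_assoc, ← toRat_mul, nonsing_inv_mul _ hE,
        toRat_one, Matrix.one_mul]
    rw [← toRat_mulVec, mulVec_mulVec, h1, h, ← mulVec_mulVec]
    congr 1
    ext i
    rw [mulVec_diagonal]
    simp [toRatVec, mul_div_right_comm]
  apply le_antisymm
  · rintro _ ⟨r, rfl⟩
    choose a b hab using hc
    -- From `a ε + b ψ = 1`, the numerator `ε (a r)` agrees with `r` modulo `ψ`.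
    refine ⟨F *ᵥ fun i => a i * r i, ?_⟩
    have key : (fun i => algebraMap ℂ[X] (RatFunc ℂ) (r i : ℂ[X]) / algebraMap _ _ (ψ i)) =
        (fun i => algebraMap ℂ[X] (RatFunc ℂ) (ε i * (a i * r i)) / algebraMap ℂ[X] (RatFunc ℂ) (ψ i))
          + toRatVec fun i => b i * r i := by
      ext1 i
      have h1 : (r i : ℂ[X]) = ε i * (a i * r i) + ψ i * (b i * r i) := by
        linear_combination (-(r i : ℂ[X])) * hab i
      conv_lhs => rw [h1]
      simp only [Pi.add_apply, toRatVec, map_add, map_mul, add_div]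
      congr 1
      rw [mul_div_cancel_left₀ _ (hψ0 i)]
    rw [stateMap_apply, hRF, polarMap_apply, key, mulVec_add, map_add, toRat_mulVec, spVec_toRatVec,
      add_zero]
  · rintro _ ⟨p, rfl⟩
    set s := F⁻¹ *ᵥ p with hs
    have hp : p = F *ᵥ s := by rw [hs, mulVec_mulVec, mul_nonsing_inv _ hF, one_mulVec]
    refine ⟨fun i => ⟨(ε i * s i) %ₘ ψ i, ?_⟩, ?_⟩
    · rw [mem_degreeLT, ← degree_eq_natDegree (hψ i).ne_zero]
      exact degree_modByMonic_lt _ (hψ i)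
    · have key : (fun i => algebraMap ℂ[X] (RatFunc ℂ) (ε i * s i) / algebraMap _ _ (ψ i)) =
          (fun i => algebraMap ℂ[X] (RatFunc ℂ) ((ε i * s i) %ₘ ψ i) / algebraMap _ _ (ψ i))
            + toRatVec fun i => (ε i * s i) /ₘ ψ i := by
        ext1 i
        conv_lhs => rw [← modByMonic_add_div (ε i * s i) (ψ i)]
        simp only [Pi.add_apply, toRatVec, map_add, map_mul, add_div]
        congr 1
        rw [mul_div_cancel_left₀ _ (hψ0 i)]
      rw [stateMap_apply, hp, hRF, key, mulVec_add, map_add, toRat_mulVec, spVec_toRatVec, add_zero]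
      rfl

lemma isUnit_det_inv {n : Type*} [Fintype n] [DecidableEq n] {E : Matrix n n ℂ[X]}
    (hE : IsUnit E.det) : IsUnit E⁻¹.det := by
  rwa [isUnit_nonsing_inv_det_iff]

lemma finrank_stateSpace {R : Matrix (Fin m) (Fin m) (RatFunc ℂ)} {ε ψ : Fin m → ℂ[X]}
    (h : IsSmithMcMillanForm R ε ψ) :
    FiniteDimensional ℂ (LinearMap.range (stateMap R)) ∧
      Module.finrank ℂ (LinearMap.range (stateMap R)) = ∑ i, (ψ i).natDegree := by
  obtain ⟨E, F, hE, hF, hEF⟩ := h.equiv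
  have hfd : ∀ i, FiniteDimensional ℂ (degreeLT ℂ (ψ i).natDegree) := fun i =>
    Module.Finite.equiv (degreeLTEquiv ℂ (ψ i).natDegree).symm
  rw [← range_polarMap h.monic_den h.coprime hE hF hEF]
  refine ⟨inferInstance, ?_⟩
  rw [LinearMap.finrank_range_of_inj (polarMap_injective (isUnit_det_inv hE) h.monic_den),
    Module.finrank_pi_fintype]
  refine Finset.sum_congr rfl fun i _ => ?_
  rw [(degreeLTEquiv ℂ (ψ i).natDegree).finrank_eq, Module.finrank_fin_fun]

/-! ### Minimal realizations -/

/-- A constant matrix seen as a rational matrix. -/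
def ratConst {m n : Type*} (M : Matrix m n ℂ) : Matrix m n (RatFunc ℂ) := M.map RatFunc.C

/-- A minimal state space realization of a strictly proper rational matrix: `V` is a matrix whose
columns are a basis of the state space, on which the shift acts by `S`. -/
structure IsMinimalRealization {δ : ℕ} (R : Matrix (Fin m) (Fin m) (RatFunc ℂ))
    (V : Matrix (Fin m) (Fin δ) (RatFunc ℂ)) (S : Matrix (Fin δ) (Fin δ) ℂ)
    (b : Matrix (Fin δ) (Fin m) ℂ) (c : Matrix (Fin m) (Fin δ) ℂ) : Prop where
  strictlyProper : ∀ i l, V i l ∈ strictlyProper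
  shift : (RatFunc.X : RatFunc ℂ) • V = V * ratConst S + ratConst c
  out : R = V * ratConst b
  observable : ∀ w : Fin δ → ℂ, V *ᵥ (fun l => RatFunc.C (w l)) = 0 → w = 0
  controllable : ∀ u : Fin δ → ℂ, (∀ n : ℕ, u ᵥ* (S ^ n * b) = 0) → u = 0

theorem exists_isMinimalRealization {R : Matrix (Fin m) (Fin m) (RatFunc ℂ)}
    (hR : IsStrictlyProper R) {ε ψ : Fin m → ℂ[X]} (h : IsSmithMcMillanForm R ε ψ) {δ : ℕ}
    (hδ : δ = ∑ i, (ψ i).natDegree) :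
    ∃ (V : Matrix (Fin m) (Fin δ) (RatFunc ℂ)) (S : Matrix (Fin δ) (Fin δ) ℂ)
      (b : Matrix (Fin δ) (Fin m) ℂ) (c : Matrix (Fin m) (Fin δ) ℂ),
      IsMinimalRealization R V S b c := by
  obtain ⟨hfd, hrank⟩ := finrank_stateSpace h
  let B := Module.finBasisOfFinrankEq ℂ (LinearMap.range (stateMap R)) (hrank.trans hδ.symm)
  let V : Matrix (Fin m) (Fin δ) (RatFunc ℂ) := Matrix.of fun i l => (B l : Fin m → RatFunc ℂ) i
  have hV : ∀ w : Fin δ → ℂ, V *ᵥ (fun l => RatFunc.C (w l)) =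
      ((B.equivFun.symm w : LinearMap.range (stateMap R)) : Fin m → RatFunc ℂ) := by
    intro w
    ext i
    simp [V, mulVec, dotProduct, Module.Basis.equivFun_symm_apply, RatFunc.smul_eq_C_mul, mul_comm]
  have hVr : ∀ v : LinearMap.range (stateMap R),
      V *ᵥ (fun l => RatFunc.C (B.equivFun v l)) = (v : Fin m → RatFunc ℂ) := by
    intro v
    rw [hV, LinearEquiv.symm_apply_apply]
  have hsp : ∀ (v : LinearMap.range (stateMap R)) i, (v : Fin m → RatFunc ℂ) i ∈ strictlyProper := by
    rintro ⟨_, p, rfl⟩ i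
    exact stateMap_mem R p i
  -- Multiplication by `λ` pushes exactly the coefficient of `λ⁻¹` into the polynomial part; this is
  -- the output matrix.
  let c : Matrix (Fin m) (Fin δ) ℂ := Matrix.of fun i l => laurentCoeff (V i l) (-1)
  have hshift : ∀ l, ∃ w : Fin δ → ℂ, (RatFunc.X : RatFunc ℂ) • (B l : Fin m → RatFunc ℂ) =
      V *ᵥ (fun l => RatFunc.C (w l)) + fun i => RatFunc.C (c i l) := by
    intro l
    obtain ⟨p, hp⟩ := (B l).2
    refine ⟨B.equivFun ⟨stateMap R ((X : ℂ[X]) • p), _, rfl⟩, ?_⟩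
    rw [hVr]
    simp only
    rw [stateMap_X_smul, hp]
    have h1 : (RatFunc.X : RatFunc ℂ) • (B l : Fin m → RatFunc ℂ) =
        ((RatFunc.X : RatFunc ℂ) • (B l : Fin m → RatFunc ℂ) - fun i => RatFunc.C (c i l)) +
          fun i => RatFunc.C (c i l) := by rw [sub_add_cancel]
    have h2 : (fun i => RatFunc.C (c i l)) = toRatVec fun i => C (c i l) := by
      ext i
      rw [toRatVec, RatFunc.algebraMap_C]
    conv_rhs => rw [h1, map_add, h2, spVec_toRatVec, add_zero, ← h2]
    rw [spVec_of_mem, sub_add_cancel]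
    intro i
    exact X_mul_sub_mem_strictlyProper (hsp (B l) i)
  choose S hS using hshift
  have hcol : ∀ j, (fun i => R i j) = stateMap R (Pi.single j 1) := by
    intro j
    have h1 : toRatVec (Pi.single j (1 : ℂ[X])) = Pi.single j 1 := by
      ext i
      simp only [toRatVec, Pi.single_apply]
      split_ifs <;> simp
    rw [stateMap_apply, h1, mulVec_single_one, spVec_of_mem]
    · rfl
    · intro i
      exact (mem_strictlyProper_iff_degree _).2 (hR i j)
  let b : Matrix (Fin δ) (Fin m) ℂ :=
    Matrix.of fun l j => B.equivFun ⟨stateMap R (Pi.single j 1), _, rfl⟩ l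
  let S' : Matrix (Fin δ) (Fin δ) ℂ := Matrix.of fun l l' => S l' l
  have hshiftV : (RatFunc.X : RatFunc ℂ) • V = V * ratConst S' + ratConst c := by
    ext i l
    exact congrFun (hS l) i
  have hSw : ∀ w : Fin δ → ℂ, spVec _ ((RatFunc.X : RatFunc ℂ) • (V *ᵥ fun l => RatFunc.C (w l))) =
      V *ᵥ fun l => RatFunc.C ((S' *ᵥ w) l) := by
    intro w
    have h1 : (fun l => RatFunc.C ((S' *ᵥ w) l)) = ratConst S' *ᵥ fun l => RatFunc.C (w l) := by
      ext l; simp [mulVec, dotProduct, ratConst]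
    have h2 : (ratConst c *ᵥ fun l => RatFunc.C (w l)) = toRatVec fun i => C ((c *ᵥ w) i) := by
      ext l
      rw [toRatVec, RatFunc.algebraMap_C]
      simp [mulVec, dotProduct, ratConst]
    rw [h1, mulVec_mulVec, ← smul_mulVec, hshiftV, add_mulVec, map_add, h2, spVec_toRatVec, add_zero,
      ← mulVec_mulVec, ← h1, hV]
    exact spVec_of_mem (hsp _)
  have hpow : ∀ (n : ℕ) j, stateMap R (Pi.single j (X ^ n)) =
      V *ᵥ fun l => RatFunc.C ((S' ^ n * b) l j) := by
    intro n j
    induction n with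
    | zero =>
      rw [pow_zero, pow_zero, Matrix.one_mul]
      exact (hVr ⟨stateMap R (Pi.single j 1), _, rfl⟩).symm
    | succ n ih =>
      have h1 : (Pi.single j (X ^ (n + 1)) : Fin m → ℂ[X]) =
          (X : ℂ[X]) • (Pi.single j (X ^ n) : Fin m → ℂ[X]) := by
        rw [← Pi.single_smul, smul_eq_mul, pow_succ']
      rw [h1, stateMap_X_smul, ih, hSw, pow_succ', Matrix.mul_assoc S']
      rfl
  refine ⟨V, S', b, c, fun i l => hsp (B l) i, hshiftV, ?_, ?_, ?_⟩
  · ext i j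
    have h1 := congrFun (hVr ⟨stateMap R (Pi.single j 1), _, rfl⟩) i
    exact (congrFun (hcol j) i).trans h1.symm
  · intro w hw
    rw [hV] at hw
    rw [Submodule.coe_eq_zero, LinearEquiv.map_eq_zero_iff] at hw
    exact hw
  · intro u hu
    let ℓ : LinearMap.range (stateMap R) →ₗ[ℂ] ℂ :=
      (Fintype.linearCombination ℂ u) ∘ₗ B.equivFun.toLinearMap
    have hℓ : ℓ ∘ₗ (stateMap R).rangeRestrict = 0 := by
      -- The vectors `λ^n e_j` span all polynomial vectors, so their images `S^n b e_j` span the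
      -- state space, and a functional killing all of them is zero.
      refine LinearMap.pi_ext' fun j => Polynomial.lhom_ext' fun n => LinearMap.ext_ring ?_
      have h1 : (stateMap R).rangeRestrict (Pi.single j (X ^ n)) =
          B.equivFun.symm fun l => (S' ^ n * b) l j := by
        ext1
        rw [← hV]
        exact hpow n j
      have h2 : ∑ l, u l * (S' ^ n * b) l j = 0 := congrFun (hu n) j
      simp only [LinearMap.comp_apply, LinearMap.zero_apply, LinearMap.single_apply]
      rw [← X_pow_eq_monomial, h1]
      simp only [ℓ, LinearMap.comp_apply, LinearEquiv.coe_coe, LinearEquiv.apply_symm_apply,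
        Fintype.linearCombination_apply, smul_eq_mul]
      simpa only [mul_comm] using h2
    have h0 : ℓ = 0 := by
      ext v
      obtain ⟨p, rfl⟩ := (stateMap R).surjective_rangeRestrict v
      exact LinearMap.congr_fun hℓ p
    ext l
    have := LinearMap.congr_fun h0 (B l)
    simpa [ℓ, Fintype.linearCombination_apply, Finsupp.single_apply] using this

end

section

/-! ### Rank criteria -/

lemma rank_eq_card_iff_mulVec {m n : Type*} [Fintype m] [Fintype n] (A : Matrix m n ℂ) :
    A.rank = Fintype.card n ↔ ∀ w : n → ℂ, A *ᵥ w = 0 → w = 0 := by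
  have h := LinearMap.finrank_range_add_finrank_ker A.mulVecLin
  rw [Module.finrank_fintype_fun_eq_card] at h
  have h2 : (∀ w : n → ℂ, A *ᵥ w = 0 → w = 0) ↔ LinearMap.ker A.mulVecLin = ⊥ := by
    rw [LinearMap.ker_eq_bot']
    rfl
  rw [h2, ← Submodule.finrank_eq_zero, Matrix.rank]
  omega

lemma rank_eq_card_iff_vecMul {m n : Type*} [Fintype m] [Fintype n] (A : Matrix m n ℂ) :
    A.rank = Fintype.card m ↔ ∀ u : m → ℂ, u ᵥ* A = 0 → u = 0 := by
  rw [← rank_transpose, rank_eq_card_iff_mulVec]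
  simp_rw [mulVec_transpose]

/-- Full row rank makes `B` surjective, so `A B` and `A` have the same range. -/
lemma rank_mul_of_full {l m n : Type*} [Fintype l] [Fintype m] [Fintype n] {A : Matrix l m ℂ}
    {B : Matrix m n ℂ} (hA : A.rank = Fintype.card m) (hB : B.rank = Fintype.card m) :
    (A * B).rank = Fintype.card m := by
  rw [Matrix.rank, mulVecLin_mul, LinearMap.range_comp_of_range_eq_top, ← hA, Matrix.rank]
  apply Submodule.eq_top_of_finrank_eq
  rw [Module.finrank_fintype_fun_eq_card]
  exact hB

/-- If finitely many unknowns are determined by infinitely many linear equations, then finitely many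
of these equations suffice. -/
lemma exists_finite_equations {ι n : Type*} [Fintype n] (A : ℕ → Matrix ι n ℂ)
    (h : ∀ w : n → ℂ, (∀ i, A i *ᵥ w = 0) → w = 0) :
    ∃ K : ℕ, ∀ k, K ≤ k → ∀ w : n → ℂ, (∀ i < k, A i *ᵥ w = 0) → w = 0 := by
  -- The common kernels of the first `k` equations decrease, and a descending chain of subspaces of
  -- a finite-dimensional space stabilizes.
  let f : ℕ →o (Submodule ℂ (n → ℂ))ᵒᵈ :=
    { toFun := fun k => OrderDual.toDual (⨅ i, ⨅ (_ : i < k), LinearMap.ker (A i).mulVecLin)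
      monotone' := fun a b hab => OrderDual.toDual_le_toDual.2
        (biInf_mono fun i (hi : i < a) => lt_of_lt_of_le hi hab) }
  have hf : ∀ k (w : n → ℂ), w ∈ OrderDual.ofDual (f k) ↔ ∀ i < k, A i *ᵥ w = 0 := by
    intro k w
    simp [f, Submodule.mem_iInf]
  obtain ⟨K, hK⟩ := IsArtinian.monotone_stabilizes f
  refine ⟨K, fun k hk w hw => h w fun i => ?_⟩
  have h1 : w ∈ OrderDual.ofDual (f K) := (hf K w).2 fun i hi => hw i (lt_of_lt_of_le hi hk)
  rw [hK (max K (i + 1)) (le_max_left _ _)] at h1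
  exact (hf _ w).1 h1 i (lt_of_lt_of_le (Nat.lt_succ_self i) (le_max_right _ _))

/-! ### Factorization of the Hankel matrices -/

variable {m δ : ℕ}

/-- The observability matrix with blocks `c S ^ i`. -/
def obsMatrix (S : Matrix (Fin δ) (Fin δ) ℂ) (c : Matrix (Fin m) (Fin δ) ℂ) (k : ℕ) :
    Matrix (Fin k × Fin m) (Fin δ) ℂ :=
  Matrix.of fun x l => (c * S ^ (x.1 : ℕ)) x.2 l

/-- The controllability matrix with blocks `S ^ j b`. -/
def ctrMatrix (S : Matrix (Fin δ) (Fin δ) ℂ) (b : Matrix (Fin δ) (Fin m) ℂ) (k : ℕ) :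
    Matrix (Fin δ) (Fin k × Fin m) ℂ :=
  Matrix.of fun l y => (S ^ (y.1 : ℕ) * b) l y.2

lemma obsMatrix_mulVec {S : Matrix (Fin δ) (Fin δ) ℂ} {c : Matrix (Fin m) (Fin δ) ℂ} {k : ℕ}
    {w : Fin δ → ℂ} (h : obsMatrix S c k *ᵥ w = 0) : ∀ i < k, (c * S ^ i) *ᵥ w = 0 := by
  intro i hi
  ext a
  exact congrFun h (⟨i, hi⟩, a)

lemma vecMul_ctrMatrix {S : Matrix (Fin δ) (Fin δ) ℂ} {b : Matrix (Fin δ) (Fin m) ℂ} {k : ℕ}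
    {u : Fin δ → ℂ} (h : u ᵥ* ctrMatrix S b k = 0) : ∀ i < k, u ᵥ* (S ^ i * b) = 0 := by
  intro i hi
  ext a
  exact congrFun h (⟨i, hi⟩, a)

variable {R : Matrix (Fin m) (Fin m) (RatFunc ℂ)} {V : Matrix (Fin m) (Fin δ) (RatFunc ℂ)}
  {S : Matrix (Fin δ) (Fin δ) ℂ} {b : Matrix (Fin δ) (Fin m) ℂ} {c : Matrix (Fin m) (Fin δ) ℂ}

lemma laurentCoeff_mul_ratConst {l n p : Type*} [Fintype n] (V : Matrix l n (RatFunc ℂ))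
    (M : Matrix n p ℂ) (a : l) (j : p) (i : ℤ) :
    laurentCoeff ((V * ratConst M) a j) i = ∑ q, laurentCoeff (V a q) i * M q j := by
  simp only [mul_apply, ratConst, map_apply, laurentCoeff_sum]
  refine Finset.sum_congr rfl fun q _ => ?_
  rw [mul_comm, laurentCoeff_C_mul, mul_comm]

namespace IsMinimalRealization

/-- Coefficient comparison in `λ V = V S + c`: the power `λ^0` gives the start `c`, and each lower
power gives one more factor `S`. -/
lemma laurentCoeff_state (h : IsMinimalRealization R V S b c) (n : ℕ) (a : Fin m) (l : Fin δ) :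
    laurentCoeff (V a l) (-((n : ℤ) + 1)) = (c * S ^ n) a l := by
  induction n generalizing l with
  | zero =>
    have h1 := congrArg (fun f => laurentCoeff f 0) (congrFun (congrFun h.shift a) l)
    simp only [Matrix.smul_apply, smul_eq_mul, Matrix.add_apply, laurentCoeff_X_mul, laurentCoeff_add,
      laurentCoeff_mul_ratConst] at h1
    have h2 : ∀ q, laurentCoeff (V a q) 0 = 0 := fun q => h.strictlyProper a q 0
    have h3 : laurentCoeff (ratConst c a l) 0 = c a l := by
      have := laurentCoeff_polynomial (C (c a l)) 0
      rw [RatFunc.algebraMap_C] at this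
      simpa [ratConst] using this
    simpa [h2, h3] using h1
  | succ n ih =>
    have h1 := congrArg (fun f => laurentCoeff f (-((n : ℤ) + 1))) (congrFun (congrFun h.shift a) l)
    simp only [Matrix.smul_apply, smul_eq_mul, Matrix.add_apply, laurentCoeff_X_mul, laurentCoeff_add,
      laurentCoeff_mul_ratConst, ih] at h1
    have h3 : laurentCoeff (ratConst c a l) (-((n : ℤ) + 1)) = 0 := by
      have := laurentCoeff_polynomial_neg (C (c a l)) (i := -((n : ℤ) + 1)) (by omega)
      rwa [RatFunc.algebraMap_C] at this
    rw [h3, add_zero] at h1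
    rw [pow_succ, ← Matrix.mul_assoc, mul_apply, ← h1]
    congr 1

lemma laurentCoeff_out (h : IsMinimalRealization R V S b c) (n : ℕ) (a j : Fin m) :
    laurentCoeff (R a j) (-((n : ℤ) + 1)) = (c * S ^ n * b) a j := by
  rw [h.out, laurentCoeff_mul_ratConst, mul_apply]
  simp_rw [h.laurentCoeff_state]

lemma hankel_eq (h : IsMinimalRealization R V S b c) (k : ℕ) :
    hankel R k = obsMatrix S c k * ctrMatrix S b k := by
  ext x y
  have h1 := h.laurentCoeff_out (x.1 + y.1) x.2 y.2
  have h2 : c * S ^ ((x.1 : ℕ) + y.1) * b = c * S ^ (x.1 : ℕ) * (S ^ (y.1 : ℕ) * b) := by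
    rw [pow_add]; simp only [Matrix.mul_assoc]
  rw [h2] at h1
  simp only [hankel, of_apply]
  push_cast at h1
  rw [h1]
  rfl

lemma shiftedHankel_eq (h : IsMinimalRealization R V S b c) (k : ℕ) :
    shiftedHankel R k = obsMatrix S c k * S * ctrMatrix S b k := by
  ext x y
  have h1 := h.laurentCoeff_out (x.1 + 1 + y.1) x.2 y.2
  have h2 : c * S ^ ((x.1 : ℕ) + 1 + y.1) * b = c * S ^ (x.1 : ℕ) * S * (S ^ (y.1 : ℕ) * b) := by
    rw [pow_add, pow_add, pow_one]; simp only [Matrix.mul_assoc]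
  have h3 : -((x.1 : ℤ) + (y.1 : ℤ) + 2) = -(((x.1 + 1 + y.1 : ℕ) : ℤ) + 1) := by
    push_cast; ring
  rw [h2] at h1
  simp only [shiftedHankel, of_apply]
  rw [h3, h1]
  rfl

/-- The vectors `c S^n w` are the Laurent coefficients of `V w`, so observability is the linear
independence of the columns of `V` over `ℂ`. -/
lemma eq_zero_of_obs (h : IsMinimalRealization R V S b c) (w : Fin δ → ℂ)
    (hw : ∀ n, (c * S ^ n) *ᵥ w = 0) : w = 0 := by
  apply h.observable
  have hcol : (fun l => RatFunc.C (w l)) = fun l => ratConst (Matrix.of fun l (_ : Unit) => w l) l () := rfl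
  ext a
  change (V * ratConst (Matrix.of fun l (_ : Unit) => w l)) a () = 0
  apply eq_zero_of_laurentCoeff
  · intro n
    rw [laurentCoeff_mul_ratConst]
    exact Finset.sum_eq_zero fun q _ => by rw [h.strictlyProper a q n, zero_mul]
  · intro n
    rw [laurentCoeff_mul_ratConst]
    simp_rw [h.laurentCoeff_state]
    exact congrFun (hw n) a

lemma exists_full_rank (h : IsMinimalRealization R V S b c) :
    ∃ K : ℕ, ∀ k, K ≤ k → (obsMatrix S c k).rank = δ ∧ (ctrMatrix S b k).rank = δ := by
  obtain ⟨K₁, hK₁⟩ := exists_finite_equations (fun n => c * S ^ n) h.eq_zero_of_obs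
  obtain ⟨K₂, hK₂⟩ := exists_finite_equations (fun n => (S ^ n * b)ᵀ)
    (fun u hu => h.controllable u fun n => by rw [← mulVec_transpose]; exact hu n)
  refine ⟨max K₁ K₂, fun k hk => ⟨?_, ?_⟩⟩
  · have := (rank_eq_card_iff_mulVec (obsMatrix S c k)).2 fun w hw =>
      hK₁ k (le_of_max_le_left hk) w (obsMatrix_mulVec hw)
    rwa [Fintype.card_fin] at this
  · have := (rank_eq_card_iff_vecMul (ctrMatrix S b k)).2 fun w hw =>
      hK₂ k (le_of_max_le_right hk) w fun i hi => by
        rw [mulVec_transpose]; exact vecMul_ctrMatrix hw i hi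
    rwa [Fintype.card_fin] at this

end IsMinimalRealization

theorem exists_isLargeEnough {R : Matrix (Fin m) (Fin m) (RatFunc ℂ)} (hR : IsStrictlyProper R) :
    ∃ K : ℕ, ∀ k : ℕ, K ≤ k → IsLargeEnough R k := by
  obtain ⟨ε, ψ, h⟩ := exists_smithMcMillan R
  obtain ⟨V, S, b, c, hr⟩ := exists_isMinimalRealization hR h rfl
  obtain ⟨K, hK⟩ := hr.exists_full_rank
  refine ⟨K, fun k hk => ⟨ε, ψ, h, ?_⟩⟩
  have := rank_mul_of_full (A := obsMatrix S c k) (B := ctrMatrix S b k)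
    (by rw [(hK k hk).1, Fintype.card_fin]) (by rw [(hK k hk).2, Fintype.card_fin])
  rw [hr.hankel_eq, this, Fintype.card_fin]

/-! ### The reflection sign -/

/-- `1` for the structures with respect to the real line, `-1` for those with respect to the
imaginary axis. -/
def SelfConj.eta : SelfConj → ℂ
  | .hermitian => 1
  | .skewHermitian => 1
  | .paraHermitian => -1
  | .paraSkewHermitian => -1

lemma SelfConj.eta_mul_self (τ : SelfConj) : τ.eta * τ.eta = 1 := by
  cases τ <;> simp [SelfConj.eta]

lemma SelfConj.star_eta (τ : SelfConj) : star τ.eta = τ.eta := by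
  cases τ <;> simp [SelfConj.eta]

lemma SelfConj.reflect_eq (τ : SelfConj) (z : ℂ) : τ.reflect z = τ.eta * star z := by
  cases τ <;> simp [SelfConj.eta, SelfConj.reflect]

lemma SelfConj.star_sign (τ : SelfConj) : star τ.sign = τ.sign := by
  cases τ <;> simp [SelfConj.sign]

lemma SelfConj.sign_mul_self (τ : SelfConj) : τ.sign * τ.sign = 1 := by
  cases τ <;> simp [SelfConj.sign]

/-- With powers of `η` the four structures are treated by a single computation. -/
lemma hankelScaling_eq (τ : SelfConj) (m k : ℕ) :
    hankelScaling τ m k = Matrix.diagonal fun x => τ.eta ^ ((x.1 : ℕ) + 1) := by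
  cases τ <;> simp [hankelScaling, SelfConj.eta]

lemma polyScaling_eq (τ : SelfConj) (m d : ℕ) :
    polyScaling τ m d = Matrix.diagonal fun x => τ.eta ^ (d - 1 - (x.1 : ℕ)) := by
  cases τ <;> simp [polyScaling, SelfConj.eta]

lemma spC_eq (τ : SelfConj) {k r q : ℕ} (hk : 0 < k)
    (W : Matrix (Fin k × Fin m) (Fin r ⊕ Fin q) ℂ) (Hhat : Matrix (Fin r) (Fin r) ℂ) :
    spC τ hk W Hhat = const (τ.eta • (firstBlock hk W * Hhat)) := by
  cases τ <;> simp [spC, SelfConj.eta]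

lemma hankelScaling_conjTranspose (τ : SelfConj) (m k : ℕ) :
    (hankelScaling τ m k)ᴴ = hankelScaling τ m k := by
  rw [hankelScaling_eq, diagonal_conjTranspose]
  congr 1
  ext x
  simp [τ.star_eta]

lemma polyScaling_conjTranspose (τ : SelfConj) (m d : ℕ) :
    (polyScaling τ m d)ᴴ = polyScaling τ m d := by
  rw [polyScaling_eq, diagonal_conjTranspose]
  congr 1
  ext x
  simp [τ.star_eta]

/-! ### The strictly proper part of the pencil -/

lemma const_mul {l m n : Type*} [Fintype m] (A : Matrix l m ℂ) (B : Matrix m n ℂ) :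
    const (A * B) = const A * const B := Matrix.map_mul

lemma toRat_const {m n : Type*} (M : Matrix m n ℂ) : toRat (const M) = ratConst M := by
  ext i j
  simp [toRat, const, ratConst]

lemma ratConst_mul {l m n : Type*} [Fintype m] (A : Matrix l m ℂ) (B : Matrix m n ℂ) :
    ratConst (A * B) = ratConst A * ratConst B := Matrix.map_mul

lemma ratConst_one {n : Type*} [DecidableEq n] : ratConst (1 : Matrix n n ℂ) = 1 := by
  simp [ratConst]

/-! ### Unitary compressions, read off on block columns -/

section Compression

lemma mul_toCols₁ {ι κ₁ κ₂ : Type*} [Fintype ι] (H : Matrix ι ι ℂ) 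
    (W : Matrix ι (κ₁ ⊕ κ₂) ℂ) :
    H * W.toCols₁ = (H * W).toCols₁ := rfl

lemma mul_toCols₂ {ι κ₁ κ₂ : Type*} [Fintype ι] (H : Matrix ι ι ℂ) 
    (W : Matrix ι (κ₁ ⊕ κ₂) ℂ) :
    H * W.toCols₂ = (H * W).toCols₂ := rfl

variable {ι κ₁ κ₂ : Type*} [Fintype ι] [Fintype κ₁] [Fintype κ₂] [DecidableEq ι] [DecidableEq κ₁]
  [DecidableEq κ₂]

/-- A compression by unitary matrices to a block diagonal matrix, in terms of block columns. -/
lemma compression_mul {H : Matrix ι ι ℂ} {Y W : Matrix ι (κ₁ ⊕ κ₂) ℂ} {H₁ : Matrix κ₁ κ₁ ℂ}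
    {H₂ : Matrix κ₂ κ₂ ℂ} (hY : IsUnitary Y) (h : Yᴴ * H * W = fromBlocks H₁ 0 0 H₂) :
    H * W.toCols₁ = Y.toCols₁ * H₁ ∧ H * W.toCols₂ = Y.toCols₂ * H₂ := by
  have h1 : H * W = Y * fromBlocks H₁ 0 0 H₂ := by
    rw [← h, Matrix.mul_assoc, ← Matrix.mul_assoc Y, hY.2, Matrix.one_mul]
  constructor
  · rw [mul_toCols₁, h1]
    ext i j
    simp [mul_apply, toCols₁]
  · rw [mul_toCols₂, h1]
    ext i j
    simp [mul_apply, toCols₂]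

/-- The adjoint of the compression is a compression of `Hᴴ` with the two unitary matrices
interchanged. -/
lemma mul_compression {H : Matrix ι ι ℂ} {Y W : Matrix ι (κ₁ ⊕ κ₂) ℂ} {H₁ : Matrix κ₁ κ₁ ℂ}
    {H₂ : Matrix κ₂ κ₂ ℂ} (hW : IsUnitary W) (h : Yᴴ * H * W = fromBlocks H₁ 0 0 H₂) :
    Y.toCols₁ᴴ * H = H₁ * W.toCols₁ᴴ ∧ Y.toCols₂ᴴ * H = H₂ * W.toCols₂ᴴ := by
  have h1 : Wᴴ * Hᴴ * Y = fromBlocks H₁ᴴ 0 0 H₂ᴴ := by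
    have := congrArg conjTranspose h
    simpa [conjTranspose_mul, Matrix.mul_assoc, fromBlocks_conjTranspose] using this
  obtain ⟨h2, h3⟩ := compression_mul hW h1
  constructor
  · simpa [conjTranspose_mul] using congrArg conjTranspose h2
  · simpa [conjTranspose_mul] using congrArg conjTranspose h3

lemma isUnitary_toCols (Y : Matrix ι (κ₁ ⊕ κ₂) ℂ) (hY : IsUnitary Y) :
    Y.toCols₁ᴴ * Y.toCols₁ = 1 ∧ Y.toCols₂ᴴ * Y.toCols₂ = 1 ∧ Y.toCols₁ᴴ * Y.toCols₂ = 0 ∧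
      Y.toCols₂ᴴ * Y.toCols₁ = 0 ∧ Y.toCols₁ * Y.toCols₁ᴴ + Y.toCols₂ * Y.toCols₂ᴴ = 1 := by
  have h1 := hY.1
  rw [← fromBlocks_one] at h1
  refine ⟨?_, ?_, ?_, ?_, ?_⟩
  · ext i j; exact congrFun (congrFun h1 (Sum.inl i)) (Sum.inl j)
  · ext i j; exact congrFun (congrFun h1 (Sum.inr i)) (Sum.inr j)
  · ext i j; exact congrFun (congrFun h1 (Sum.inl i)) (Sum.inr j)
  · ext i j; exact congrFun (congrFun h1 (Sum.inr i)) (Sum.inl j)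
  · rw [← hY.2]
    ext i j
    simp [mul_apply, toCols₁, toCols₂]

end Compression

/-- Under `IsLargeEnough` this turns the size `r` of `Ĥ` into the polar degree, so the state space
has dimension `r` and the transforming matrices `G`, `K` below are square. -/
lemma IsHankelCompression.rank_eq {τ : SelfConj} {k r q : ℕ}
    {Y W : Matrix (Fin k × Fin m) (Fin r ⊕ Fin q) ℂ} {Hhat : Matrix (Fin r) (Fin r) ℂ}
    (h : IsHankelCompression τ R k Y W Hhat) : (hankel R k).rank = r := by
  obtain ⟨h1, -⟩ := mul_compression h.unitary_right h.compress
  obtain ⟨h2, -⟩ := compression_mul h.unitary_left h.compress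
  obtain ⟨y1, y2, y3, y4, y5⟩ := isUnitary_toCols Y h.unitary_left
  obtain ⟨w1, -, -, -, -⟩ := isUnitary_toCols W h.unitary_right
  have hH : hankel R k = Y.toCols₁ * (Hhat * W.toCols₁ᴴ) := by
    have h3 := (mul_compression h.unitary_right h.compress).2
    rw [Matrix.zero_mul] at h3
    rw [← h1, ← Matrix.mul_assoc]
    conv_lhs => rw [← Matrix.one_mul (hankel R k), ← y5, Matrix.add_mul,
      Matrix.mul_assoc Y.toCols₂, h3, Matrix.mul_zero, add_zero]
  apply le_antisymm
  · rw [hH]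
    refine (rank_mul_le_left _ _).trans ((rank_le_card_width _).trans ?_)
    simp
  · have h4 : Y.toCols₁ᴴ * hankel R k * W.toCols₁ = Hhat := by
      rw [h1, Matrix.mul_assoc, w1, Matrix.mul_one]
    have h5 : Hhat.rank = r := by simpa using rank_of_isUnit Hhat h.invertible
    rw [← h5, ← h4]
    exact (rank_mul_le_left _ _).trans (rank_mul_le_right _ _)

/-- The strictly proper part of the pencil is a strict equivalence transform of a minimal
realization. -/
theorem exists_sp_factorization {τ : SelfConj} {k r q : ℕ} (hk : 0 < k) (hR : IsStrictlyProper R)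
    (hl : IsLargeEnough R k) {Y W : Matrix (Fin k × Fin m) (Fin r ⊕ Fin q) ℂ}
    {Hhat : Matrix (Fin r) (Fin r) ℂ} (h : IsHankelCompression τ R k Y W Hhat) :
    ∃ (V : Matrix (Fin m) (Fin r) (RatFunc ℂ)) (S : Matrix (Fin r) (Fin r) ℂ)
      (b : Matrix (Fin r) (Fin m) ℂ) (c : Matrix (Fin m) (Fin r) ℂ) (G K : Matrix (Fin r) (Fin r) ℂ),
      IsMinimalRealization R V S b c ∧ IsUnit G ∧ IsUnit K ∧
      spA τ R W Hhat = const G * (const S - (X : ℂ[X]) • (1 : Matrix (Fin r) (Fin r) ℂ[X])) * const K ∧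
      spNegB hk W Hhat = const (G * b) ∧ spC τ hk W Hhat = const (c * K) := by
  obtain ⟨ε, ψ, hsm, hrank⟩ := hl
  rw [h.rank_eq] at hrank
  obtain ⟨V, S, b, c, hr⟩ := exists_isMinimalRealization hR hsm hrank
  obtain ⟨h1, -⟩ := mul_compression h.unitary_right h.compress
  obtain ⟨h2, -⟩ := compression_mul h.unitary_left h.compress
  obtain ⟨w1, -, -, -, -⟩ := isUnitary_toCols W h.unitary_right
  have hY1 : Y.toCols₁ = hankelScaling τ m k * W.toCols₁ := by
    rw [mul_toCols₁, ← h.left_eq]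
  have hY1H : Y.toCols₁ᴴ = W.toCols₁ᴴ * hankelScaling τ m k := by
    rw [hY1, conjTranspose_mul, hankelScaling_conjTranspose]
  set O := obsMatrix S c k with hO
  set Ct := ctrMatrix S b k with hCt
  -- The product of two square matrices is the invertible `Ĥ`, so both factors are invertible.
  have hGK : (Y.toCols₁ᴴ * O) * (Ct * W.toCols₁) = Hhat := by
    have : (Y.toCols₁ᴴ * O) * (Ct * W.toCols₁) = Y.toCols₁ᴴ * (O * Ct) * W.toCols₁ := by
      simp only [Matrix.mul_assoc]
    rw [this, ← hr.hankel_eq, h1, Matrix.mul_assoc, w1, Matrix.mul_one]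
  have hdet : IsUnit ((Y.toCols₁ᴴ * O).det * (Ct * W.toCols₁).det) := by
    rw [← det_mul, hGK]
    exact (isUnit_iff_isUnit_det _).1 h.invertible
  refine ⟨V, S, b, c, Y.toCols₁ᴴ * O, Ct * W.toCols₁, hr,
    (isUnit_iff_isUnit_det _).2 (isUnit_of_mul_isUnit_left hdet),
    (isUnit_iff_isUnit_det _).2 (isUnit_of_mul_isUnit_right hdet), ?_, ?_, ?_⟩
  · rw [Matrix.mul_sub, Matrix.sub_mul, Matrix.mul_smul, Matrix.smul_mul, Matrix.mul_one,
      ← const_mul, ← const_mul, ← const_mul, hGK, spA, hr.shiftedHankel_eq, ← Matrix.mul_assoc,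
      ← hY1H]
    simp only [Matrix.mul_assoc]
    rfl
  · rw [spNegB]
    congr 1
    -- The first block column of `Y₁* H = Ĥ W₁*`: there the controllability matrix has the block
    -- `b`.
    rw [hr.hankel_eq, ← Matrix.mul_assoc] at h1
    ext l a
    have h3 := congrFun (congrFun h1 l) (⟨0, hk⟩, a)
    have h4 : (Hhat * (firstBlock hk W)ᴴ) l a = (Hhat * W.toCols₁ᴴ) l (⟨0, hk⟩, a) := rfl
    have h5 : (Y.toCols₁ᴴ * O * b) l a = (Y.toCols₁ᴴ * O * Ct) l (⟨0, hk⟩, a) := by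
      simp [mul_apply (M := Y.toCols₁ᴴ * O), hCt, ctrMatrix]
    rw [h4, h5, h3]
  · rw [spC_eq]
    congr 1
    -- The first block row of `H W₁ = Y₁ Ĥ`: there the observability matrix has the block `c`, and
    -- `Y₁` is `η W₁`, which accounts for the sign in `C_sp`.
    rw [hr.hankel_eq, Matrix.mul_assoc] at h2
    ext a l
    have h3 := congrFun (congrFun h2 (⟨0, hk⟩, a)) l
    have h4 : (τ.eta • (firstBlock hk W * Hhat)) a l = (Y.toCols₁ * Hhat) (⟨0, hk⟩, a) l := by
      rw [hY1, hankelScaling_eq, Matrix.smul_apply, mul_apply, mul_apply, Finset.smul_sum]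
      refine Finset.sum_congr rfl fun j _ => ?_
      rw [diagonal_mul]
      simp [firstBlock, toCols₁, mul_assoc]
    have h5 : (c * (Ct * W.toCols₁)) a l = (O * (Ct * W.toCols₁)) (⟨0, hk⟩, a) l := by
      simp [mul_apply (N := Ct * W.toCols₁), hO, obsMatrix]
    rw [h4, h5, h3]

end

section

/-! ### Evaluation and coefficients of polynomial matrices -/

lemma polyEval_mul {l m n : Type*} [Fintype m] (A : Matrix l m ℂ[X]) (B : Matrix m n ℂ[X]) (z : ℂ) :
    polyEval (A * B) z = polyEval A z * polyEval B z :=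
  Matrix.map_mul (f := evalRingHom z)

lemma polyEval_sub {m n : Type*} (A B : Matrix m n ℂ[X]) (z : ℂ) :
    polyEval (A - B) z = polyEval A z - polyEval B z := by
  ext i j; simp [polyEval]

lemma polyEval_X_smul {m n : Type*} (A : Matrix m n ℂ[X]) (z : ℂ) :
    polyEval ((X : ℂ[X]) • A) z = z • polyEval A z := by
  ext i j; simp [polyEval]

lemma polyEval_const {m n : Type*} (M : Matrix m n ℂ) (z : ℂ) : polyEval (const M) z = M := by
  ext i j; simp [polyEval, const]

lemma polyCoeff_const_mul {l m n : Type*} [Fintype m] (M : Matrix l m ℂ) (A : Matrix m n ℂ[X])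
    (i : ℕ) : polyCoeff (const M * A) i = M * polyCoeff A i := by
  ext a b; simp [polyCoeff, const, mul_apply]

lemma polyCoeff_mul_const {l m n : Type*} [Fintype m] (A : Matrix l m ℂ[X]) (M : Matrix m n ℂ)
    (i : ℕ) : polyCoeff (A * const M) i = polyCoeff A i * M := by
  ext a b; simp [polyCoeff, const, mul_apply]

lemma polyEval_det {n : Type*} [Fintype n] [DecidableEq n] (A : Matrix n n ℂ[X]) (z : ℂ) :
    (polyEval A z).det = A.det.eval z :=
  ((evalRingHom z).map_det A).symm

lemma toRat_det {n : Type*} [Fintype n] [DecidableEq n] (A : Matrix n n ℂ[X]) :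
    (toRat A).det = algebraMap ℂ[X] (RatFunc ℂ) A.det :=
  ((algebraMap ℂ[X] (RatFunc ℂ)).map_det A).symm

lemma isUnit_toRat_det {n : Type*} [Fintype n] [DecidableEq n] {A : Matrix n n ℂ[X]}
    (h : A.det ≠ 0) : IsUnit (toRat A).det := by
  rw [toRat_det, isUnit_iff_ne_zero]
  simpa using h

lemma toRat_neg {m n : Type*} (A : Matrix m n ℂ[X]) : toRat (-A) = -toRat A := by
  ext i j; simp [toRat]

lemma toRat_add {m n : Type*} (A B : Matrix m n ℂ[X]) : toRat (A + B) = toRat A + toRat B := by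
  ext i j; simp [toRat]

lemma mulVec_injective_of_isUnit {n : Type*} [Fintype n] [DecidableEq n] {A : Matrix n n ℂ}
    (h : IsUnit A) {w : n → ℂ} (hw : A *ᵥ w = 0) : w = 0 := by
  by_contra hne
  exact ((isUnit_iff_isUnit_det A).1 h).ne_zero (exists_mulVec_eq_zero_iff.1 ⟨w, hne, hw⟩)

lemma vecMul_injective_of_isUnit {n : Type*} [Fintype n] [DecidableEq n] {A : Matrix n n ℂ}
    (h : IsUnit A) {u : n → ℂ} (hu : u ᵥ* A = 0) : u = 0 := by
  by_contra hne
  exact ((isUnit_iff_isUnit_det A).1 h).ne_zero (exists_vecMul_eq_zero_iff.1 ⟨u, hne, hu⟩)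

/-! ### The block shift -/

variable {m : ℕ}

/-- The nilpotent block down shift. -/
def blockShift (n m : ℕ) : Matrix (Fin n × Fin m) (Fin n × Fin m) ℂ :=
  Matrix.of fun x y => if (x.1 : ℕ) = y.1 + 1 ∧ x.2 = y.2 then 1 else 0

lemma blockShift_mulVec_zero {n : ℕ} (v : Fin n × Fin m → ℂ) (x : Fin n × Fin m)
    (hx : (x.1 : ℕ) = 0) : (blockShift n m *ᵥ v) x = 0 := by
  refine Finset.sum_eq_zero fun y _ => ?_
  have : ¬ ((x.1 : ℕ) = y.1 + 1 ∧ x.2 = y.2) := by omega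
  simp [blockShift, this]

lemma blockShift_mulVec_succ {n : ℕ} (v : Fin n × Fin m → ℂ) (i : ℕ) (hi : i + 1 < n)
    (a : Fin m) : (blockShift n m *ᵥ v) (⟨i + 1, hi⟩, a) = v (⟨i, by omega⟩, a) := by
  rw [mulVec, dotProduct, Finset.sum_eq_single (⟨i, by omega⟩, a)]
  · simp [blockShift]
  · rintro ⟨y, b⟩ - hne
    have : ¬ (i + 1 = (y : ℕ) + 1 ∧ a = b) := by
      rintro ⟨h1, rfl⟩
      apply hne
      ext <;> simp
      omega
    simp only [blockShift, of_apply, if_neg this, zero_mul]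
  · simp

/-- A vector fixed by a multiple of a nilpotent shift vanishes block by block, starting from the
first. -/
lemma eq_zero_of_smul_blockShift {n : ℕ} {z : ℂ} {v : Fin n × Fin m → ℂ}
    (h : z • (blockShift n m *ᵥ v) = v) : v = 0 := by
  have key : ∀ (i : ℕ) (hi : i < n) (a : Fin m), v (⟨i, hi⟩, a) = 0 := by
    intro i
    induction i with
    | zero =>
      intro hi a
      rw [← h, Pi.smul_apply, blockShift_mulVec_zero v _ rfl, smul_zero]
    | succ i ih =>
      intro hi a
      rw [← h, Pi.smul_apply, blockShift_mulVec_succ, ih, smul_zero]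
  ext ⟨i, a⟩
  exact key i i.2 a

lemma eq_zero_of_blockShift {n : ℕ} {v : Fin n × Fin m → ℂ} (h : blockShift n m *ᵥ v = 0)
    (hlast : ∀ x : Fin n × Fin m, (x.1 : ℕ) + 1 = n → v x = 0) : v = 0 := by
  ext ⟨i, a⟩
  by_cases hi : (i : ℕ) + 1 = n
  · exact hlast _ hi
  · have := congrFun h (⟨i + 1, by omega⟩, a)
    rwa [blockShift_mulVec_succ] at this

/-! ### The polynomial part of the pencil -/

section PolynomialPart

variable {P : Matrix (Fin m) (Fin m) ℂ[X]} {d : ℕ}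

lemma polyCoeff_eq_zero (hd : ∀ i j, (P i j).natDegree ≤ d) {n : ℕ} (hn : d < n) (i j : Fin m) :
    polyCoeff P n i j = 0 :=
  coeff_eq_zero_of_natDegree_lt (lt_of_le_of_lt (hd i j) hn)

lemma blockShift_mul_blockT (hd : ∀ i j, (P i j).natDegree ≤ d) :
    blockShift (d - 1) m * blockT P d =
      Matrix.of fun x y => polyCoeff P (2 * d - 1 - (x.1 : ℕ) - (y.1 : ℕ)) x.2 y.2 := by
  ext ⟨⟨i, hi⟩, a⟩ y
  change (blockShift (d - 1) m *ᵥ fun x => blockT P d x y) _ = _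
  cases i with
  | zero =>
    -- The first block row of the shifted matrix involves only `P_(2d-1-j)` with `j ≤ d - 2`, of
    -- index above `d`.
    rw [blockShift_mulVec_zero _ _ rfl]
    have := y.1.2
    exact (polyCoeff_eq_zero hd (by simp only; omega) _ _).symm
  | succ i =>
    rw [blockShift_mulVec_succ]
    simp only [blockT, of_apply]
    congr 1
    omega

lemma blockT_transpose (P : Matrix (Fin m) (Fin m) ℂ[X]) (d : ℕ) :
    (blockT P d)ᵀ = blockT Pᵀ d := by
  ext x y
  simp only [blockT, transpose_apply, of_apply, polyCoeff, map_apply]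
  congr 1
  omega

/-- Block Hankel matrices depend on `i + j` only, so shifting rows down and shifting columns right
agree; formally, transpose the row statement for `Pᵀ`. -/
lemma blockT_mul_blockShift (hd : ∀ i j, (P i j).natDegree ≤ d) :
    blockT P d * (blockShift (d - 1) m)ᵀ = blockShift (d - 1) m * blockT P d := by
  have h1 := blockShift_mul_blockT (P := Pᵀ) (d := d) fun i j => hd j i
  rw [← transpose_inj, transpose_mul, transpose_transpose, blockT_transpose, h1,
    blockShift_mul_blockT hd]
  ext x y
  simp only [transpose_apply, of_apply, polyCoeff, map_apply]
  congr 1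
  omega

lemma pencilA_eq (hd : ∀ i j, (P i j).natDegree ≤ d) :
    pencilA P d = (X : ℂ[X]) • const (blockShift (d - 1) m * blockT P d) - const (blockT P d) := by
  rw [blockShift_mul_blockT hd]
  rfl

/-- The last block column of `T`. -/
lemma pencilNegB_eq (P : Matrix (Fin m) (Fin m) ℂ[X]) (d : ℕ) (x y : Fin (d - 1) × Fin m)
    (hy : (y.1 : ℕ) + 1 = d - 1) : polyCoeff (pencilNegB P d) 1 x y.2 = blockT P d x y := by
  simp only [pencilNegB, blockT, polyCoeff, map_apply, of_apply]
  rw [coeff_X_mul, coeff_C_zero]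
  congr 1
  omega

/-- The last block row of `T`. -/
lemma pencilC_eq (P : Matrix (Fin m) (Fin m) ℂ[X]) (d : ℕ) (x y : Fin (d - 1) × Fin m)
    (hx : (x.1 : ℕ) + 1 = d - 1) : polyCoeff (pencilC P d) 1 x.2 y = blockT P d x y := by
  simp only [pencilC, blockT, polyCoeff, map_apply, of_apply]
  rw [coeff_X_mul, coeff_C_zero]
  congr 1
  omega

variable {p r : ℕ} {U V : Matrix (Fin (d - 1) × Fin m) (Fin p ⊕ Fin r) ℂ}
  {That : Matrix (Fin r) (Fin r) ℂ}

lemma polyEval_pencilA (hd : ∀ i j, (P i j).natDegree ≤ d) (z : ℂ) :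
    polyEval (pencilA P d) z = z • (blockShift (d - 1) m * blockT P d) - blockT P d := by
  rw [pencilA_eq hd, polyEval_sub, polyEval_X_smul, polyEval_const, polyEval_const]

lemma polyCoeff_pencilA (hd : ∀ i j, (P i j).natDegree ≤ d) :
    polyCoeff (pencilA P d) 1 = blockShift (d - 1) m * blockT P d := by
  rw [pencilA_eq hd]
  ext x y
  simp only [polyCoeff, const, map_apply, Matrix.sub_apply, Matrix.smul_apply, smul_eq_mul,
    coeff_sub, coeff_X_mul, coeff_C_zero, coeff_C_succ, sub_zero]

/-- `T V₂ = U₂ T̂` is injective, since `U₂` has orthonormal columns and `T̂` is invertible. -/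
lemma polyCompression_unit (hU : IsUnitary U) (hc : Uᴴ * blockT P d * V = Matrix.fromBlocks 0 0 0 That)
    (hT : IsUnit That) (w : Fin r → ℂ) (hw : blockT P d *ᵥ (V.toCols₂ *ᵥ w) = 0) : w = 0 := by
  obtain ⟨-, h2⟩ := compression_mul hU hc
  obtain ⟨-, u2, -, -, -⟩ := isUnitary_toCols U hU
  rw [mulVec_mulVec, h2] at hw
  have := congrArg (fun v => U.toCols₂ᴴ *ᵥ v) hw
  simp only [mulVec_zero, mulVec_mulVec, ← Matrix.mul_assoc, u2, Matrix.one_mul] at this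
  exact mulVec_injective_of_isUnit hT this

/-- Since `A_s(z) = z T Nᵀ - T` and `U₁* T = 0`, the compression on the left loses nothing: `Â_s(z)
w = 0` gives `A_s(z) V₂ w = 0`. This reads `z N v = v` for `v = T V₂ w`, so `v = 0` by nilpotency
and `w = 0`. -/
lemma hatA_eval_isUnit (hd : ∀ i j, (P i j).natDegree ≤ d) (hU : IsUnitary U)
    (hV : IsUnitary V) (hc : Uᴴ * blockT P d * V = Matrix.fromBlocks 0 0 0 That)
    (hT : IsUnit That) (z : ℂ) : IsUnit (polyEval (hatA P d U V) z) := by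
  rw [isUnit_iff_isUnit_det, isUnit_iff_ne_zero, Ne, ← exists_mulVec_eq_zero_iff]
  rintro ⟨w, hne, hw⟩
  apply hne
  obtain ⟨h1, -⟩ := mul_compression hV hc
  obtain ⟨-, -, -, -, u5⟩ := isUnitary_toCols U hU
  rw [Matrix.zero_mul] at h1
  rw [hatA, polyEval_mul, polyEval_mul, polyEval_const, polyEval_const, Matrix.mul_assoc,
    ← mulVec_mulVec] at hw
  have h3 : U.toCols₁ᴴ * polyEval (pencilA P d) z = 0 := by
    rw [polyEval_pencilA hd, ← blockT_mul_blockShift hd, Matrix.mul_sub, Matrix.mul_smul,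
      ← Matrix.mul_assoc, h1, Matrix.zero_mul, smul_zero, sub_zero]
  have h4 : (polyEval (pencilA P d) z * V.toCols₂) *ᵥ w = 0 := by
    rw [← one_mulVec ((polyEval (pencilA P d) z * V.toCols₂) *ᵥ w), ← u5, add_mulVec,
      ← mulVec_mulVec (M := U.toCols₂), hw, mulVec_mulVec, ← Matrix.mul_assoc,
      Matrix.mul_assoc U.toCols₁, h3]
    simp
  apply polyCompression_unit hU hc hT
  rw [← mulVec_mulVec, polyEval_pencilA hd, sub_mulVec, sub_eq_zero, smul_mulVec,
    ← mulVec_mulVec] at h4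
  exact eq_zero_of_smul_blockShift h4

lemma hatA_det_ne_zero (hd : ∀ i j, (P i j).natDegree ≤ d) (hU : IsUnitary U)
    (hV : IsUnitary V) (hc : Uᴴ * blockT P d * V = Matrix.fromBlocks 0 0 0 That)
    (hT : IsUnit That) : (hatA P d U V).det ≠ 0 := by
  intro h
  have := (isUnit_iff_isUnit_det _).1 (hatA_eval_isUnit hd hU hV hc hT 0)
  rw [polyEval_det, h] at this
  simp at this

/-- From `T V₁ = 0` one gets `u U₂* N T = 0`, and `N T = T Nᵀ` makes every block of `u U₂* T` but
the last vanish. The last one is the coefficient of `λ` in `u (-B̂_s)`. -/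
lemma hat_row_infinity (hd : ∀ i j, (P i j).natDegree ≤ d) (hU : IsUnitary U)
    (hV : IsUnitary V) (hc : Uᴴ * blockT P d * V = Matrix.fromBlocks 0 0 0 That)
    (hT : IsUnit That) {u : Fin r → ℂ} (h₁ : u ᵥ* polyCoeff (hatA P d U V) 1 = 0)
    (h₂ : u ᵥ* polyCoeff (hatNegB P d U) 1 = 0) : u = 0 := by
  obtain ⟨-, e2⟩ := mul_compression hV hc
  obtain ⟨e3, -⟩ := compression_mul hU hc
  obtain ⟨-, v2, -, -, v5⟩ := isUnitary_toCols V hV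
  rw [Matrix.mul_zero] at e3
  rw [hatA, polyCoeff_mul_const, polyCoeff_const_mul, polyCoeff_pencilA hd] at h₁
  rw [hatNegB, polyCoeff_const_mul, ← vecMul_vecMul] at h₂
  have h3 : u ᵥ* (U.toCols₂ᴴ * (blockShift (d - 1) m * blockT P d)) = 0 := by
    rw [← vecMul_one (u ᵥ* (U.toCols₂ᴴ * (blockShift (d - 1) m * blockT P d))), ← v5, vecMul_add,
      ← vecMul_vecMul (M := V.toCols₂), vecMul_vecMul (M := U.toCols₂ᴴ * _) (N := V.toCols₂), h₁,
      vecMul_vecMul, ← Matrix.mul_assoc, Matrix.mul_assoc _ _ V.toCols₁,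
      Matrix.mul_assoc _ _ V.toCols₁, e3]
    simp
  have h4 : u ᵥ* (U.toCols₂ᴴ * blockT P d) = 0 := by
    apply eq_zero_of_blockShift
    · rw [← vecMul_transpose, vecMul_vecMul, Matrix.mul_assoc, blockT_mul_blockShift hd, h3]
    · intro y hy
      have := congrFun h₂ y.2
      rw [← vecMul_vecMul]
      simp only [vecMul, dotProduct, pencilNegB_eq P d _ y hy] at this ⊢
      exact this
  rw [e2] at h4
  have := congrArg (fun v => v ᵥ* V.toCols₂) h4
  simp only [zero_vecMul, vecMul_vecMul, Matrix.mul_assoc, v2, Matrix.mul_one] at this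
  exact vecMul_injective_of_isUnit hT this

lemma hat_col_infinity (hd : ∀ i j, (P i j).natDegree ≤ d) (hU : IsUnitary U)
    (hV : IsUnitary V) (hc : Uᴴ * blockT P d * V = Matrix.fromBlocks 0 0 0 That)
    (hT : IsUnit That) {w : Fin r → ℂ} (h₁ : polyCoeff (hatA P d U V) 1 *ᵥ w = 0)
    (h₂ : polyCoeff (hatC P d V) 1 *ᵥ w = 0) : w = 0 := by
  obtain ⟨e1, -⟩ := mul_compression hV hc
  obtain ⟨-, -, -, -, u5⟩ := isUnitary_toCols U hU
  rw [Matrix.zero_mul] at e1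
  rw [hatA, polyCoeff_mul_const, polyCoeff_const_mul, polyCoeff_pencilA hd, Matrix.mul_assoc,
    ← mulVec_mulVec] at h₁
  rw [hatC, polyCoeff_mul_const, ← mulVec_mulVec] at h₂
  have h3 : (blockShift (d - 1) m * blockT P d * V.toCols₂) *ᵥ w = 0 := by
    rw [← one_mulVec ((blockShift (d - 1) m * blockT P d * V.toCols₂) *ᵥ w), ← u5, add_mulVec,
      ← mulVec_mulVec (M := U.toCols₂), h₁, mulVec_mulVec, ← blockT_mul_blockShift hd,
      Matrix.mul_assoc U.toCols₁, ← Matrix.mul_assoc U.toCols₁ᴴ, ← Matrix.mul_assoc U.toCols₁ᴴ, e1]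
    simp
  apply polyCompression_unit hU hc hT
  apply eq_zero_of_blockShift
  · rw [mulVec_mulVec, mulVec_mulVec, h3]
  · intro x hx
    have := congrFun h₂ x.2
    simp only [mulVec, dotProduct, pencilC_eq P d x _ hx] at this ⊢
    exact this

/-! ### The transfer function of the polynomial part -/

/-- The block column `λ ^ (d - 1), …, λ`. -/
def powerColumn (m d : ℕ) : Matrix (Fin (d - 1) × Fin m) (Fin m) ℂ[X] :=
  Matrix.of fun y b => if y.2 = b then X ^ (d - 1 - (y.1 : ℕ)) else 0

lemma mul_powerColumn {ι : Type*} (A : Matrix ι (Fin (d - 1) × Fin m) ℂ[X]) (i : ι) (b : Fin m) :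
    (A * powerColumn m d) i b = ∑ y : Fin (d - 1), A i (y, b) * X ^ (d - 1 - (y : ℕ)) := by
  rw [mul_apply, Fintype.sum_prod_type]
  refine Finset.sum_congr rfl fun y _ => ?_
  simp [powerColumn]

/-- Telescoping: the term of block column `y` is `g y - g (y + 1)` with `g y = λ^(d-y)
P_(2d-1-x-y)`. The start `g 0` vanishes because its index exceeds `d`, and the end `g (d - 1)` is `λ
P_(d-x)`. -/
lemma pencilA_mul_powerColumn (hd : ∀ i j, (P i j).natDegree ≤ d) :
    pencilA P d * powerColumn m d = -pencilNegB P d := by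
  ext1 x b
  rw [mul_powerColumn]
  have hx := x.1.2
  let g : ℕ → ℂ[X] := fun y => X ^ (d - y) * C (polyCoeff P (2 * d - 1 - (x.1 : ℕ) - y) x.2 b)
  have h1 : ∀ y : Fin (d - 1), pencilA P d x (y, b) * X ^ (d - 1 - (y : ℕ)) =
      g (y : ℕ) - g ((y : ℕ) + 1) := by
    intro y
    have hy := y.2
    have e1 : d - (y : ℕ) = d - 1 - y + 1 := by omega
    have e2 : d - ((y : ℕ) + 1) = d - 1 - y := by omega
    have e3 : 2 * d - 1 - (x.1 : ℕ) - ((y : ℕ) + 1) = 2 * d - 2 - x.1 - y := by omega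
    simp only [g, pencilA, of_apply]
    rw [e2, e3, e1]
    ring
  rw [Finset.sum_congr rfl fun y _ => h1 y, Fin.sum_univ_eq_sum_range (fun y => g y - g (y + 1)),
    Finset.sum_range_sub']
  have e1 : g 0 = 0 := by
    simp only [g]
    rw [polyCoeff_eq_zero hd (by omega), C_0, mul_zero]
  have e2 : d - (d - 1) = 1 := by omega
  have e3 : 2 * d - 1 - (x.1 : ℕ) - (d - 1) = d - x.1 := by omega
  rw [e1, zero_sub]
  simp only [g, e2, e3, pow_one]
  rfl

lemma pencilC_mul_powerColumn (hd : ∀ i j, (P i j).natDegree ≤ d) :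
    pencilD P + pencilC P d * powerColumn m d = P := by
  ext1 a b
  rw [Matrix.add_apply, mul_powerColumn]
  have h1 : ∀ y : Fin (d - 1), pencilC P d a (y, b) * X ^ (d - 1 - (y : ℕ)) =
      (fun j => C ((P a b).coeff (j + 2)) * X ^ (j + 2)) (d - 1 - 1 - (y : ℕ)) := by
    intro y
    have hy := y.2
    have e1 : d - (y : ℕ) = d - 1 - 1 - y + 2 := by omega
    have e2 : d - 1 - (y : ℕ) = d - 1 - 1 - y + 1 := by omega
    simp only [pencilC, of_apply, polyCoeff, map_apply]
    rw [e1, e2]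
    ring
  rw [Finset.sum_congr rfl fun y _ => h1 y,
    Fin.sum_univ_eq_sum_range
      (fun y => (fun j => C ((P a b).coeff (j + 2)) * X ^ (j + 2)) (d - 1 - 1 - y)),
    Finset.sum_range_reflect (fun j => C ((P a b).coeff (j + 2)) * X ^ (j + 2))]
  conv_rhs => rw [(P a b).as_sum_range_C_mul_X_pow' (n := d - 1 + 2)
    (by have := hd a b; omega)]
  rw [Finset.sum_range_succ', Finset.sum_range_succ']
  simp only [pencilD, of_apply, polyCoeff, map_apply]
  ring

/-- The witness is `V₂*` times the power column. It serves because `T V₁ = 0` makes `A_s V₁` and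
`C_s V₁` vanish, so that `V₂ V₂*` acts as the identity behind both. No inverse of `Â_s` has to be
computed. -/
lemma hat_transfer (hd : ∀ i j, (P i j).natDegree ≤ d) (hU : IsUnitary U)
    (hV : IsUnitary V) (hc : Uᴴ * blockT P d * V = Matrix.fromBlocks 0 0 0 That) :
    ∃ Z : Matrix (Fin r) (Fin m) ℂ[X], hatA P d U V * Z = -hatNegB P d U ∧
      pencilD P + hatC P d V * Z = P := by
  obtain ⟨e3, -⟩ := compression_mul hU hc
  rw [Matrix.mul_zero] at e3
  obtain ⟨-, v2, -, -, v5⟩ := isUnitary_toCols V hV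
  have hproj : ∀ {ι : Type} (A : Matrix ι (Fin (d - 1) × Fin m) ℂ[X]), A * const V.toCols₁ = 0 →
      A * const V.toCols₂ * (const V.toCols₂ᴴ * powerColumn m d) = A * powerColumn m d := by
    intro ι A hA
    have h1 : const V.toCols₁ * const V.toCols₁ᴴ + const V.toCols₂ * const V.toCols₂ᴴ = 1 := by
      rw [← const_mul, ← const_mul]
      have := congrArg const v5
      simpa [const, Matrix.map_add] using this
    conv_rhs => rw [← Matrix.mul_one A, ← h1, Matrix.mul_add, ← Matrix.mul_assoc, hA,
      Matrix.zero_mul, zero_add]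
    simp only [Matrix.mul_assoc]
  refine ⟨const V.toCols₂ᴴ * powerColumn m d, ?_, ?_⟩
  · rw [hatA, Matrix.mul_assoc (const U.toCols₂ᴴ), Matrix.mul_assoc (const U.toCols₂ᴴ), hproj,
      pencilA_mul_powerColumn hd, hatNegB, Matrix.mul_neg]
    rw [pencilA_eq hd, Matrix.sub_mul, Matrix.smul_mul, ← const_mul, ← const_mul, Matrix.mul_assoc,
      e3]
    simp [const]
  · rw [hatC, hproj, pencilC_mul_powerColumn hd]
    ext1 a j
    have h1 : ∀ y : Fin (d - 1) × Fin m, pencilC P d a y * const V.toCols₁ y j =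
        X * C (polyCoeff (pencilC P d) 1 a y * V.toCols₁ y j) := by
      intro y
      simp only [pencilC, of_apply, const, map_apply, polyCoeff, C_mul]
      rw [coeff_X_mul, coeff_C_zero]
      ring
    rw [mul_apply, Finset.sum_congr rfl fun y _ => h1 y, ← Finset.mul_sum, ← map_sum]
    -- The coefficient of `C_s` is the last block row of `T`, numbered `d - 2`; for `d ≤ 1` there is
    -- no such row and the sum is empty.
    obtain hd1 | hd1 := Nat.eq_zero_or_pos (d - 1)
    · have : IsEmpty (Fin (d - 1) × Fin m) := by rw [hd1]; infer_instance
      simp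
    · have h2 := congrFun (congrFun e3 (⟨d - 2, by omega⟩, a)) j
      rw [mul_apply] at h2
      rw [Finset.sum_congr rfl fun y _ => by
        rw [pencilC_eq P d (⟨d - 2, by omega⟩, a) y (by simp only; omega)], h2]
      simp

end PolynomialPart

/-! ### Minimality and transfer function of the strictly proper part -/

section StrictlyProperPart

variable {R : Matrix (Fin m) (Fin m) (RatFunc ℂ)} {r : ℕ} {V : Matrix (Fin m) (Fin r) (RatFunc ℂ)}
  {S : Matrix (Fin r) (Fin r) ℂ} {b : Matrix (Fin r) (Fin m) ℂ} {c : Matrix (Fin m) (Fin r) ℂ}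
  {G K : Matrix (Fin r) (Fin r) ℂ}

lemma polyEval_pencil (G S K : Matrix (Fin r) (Fin r) ℂ) (z : ℂ) :
    polyEval (const G * (const S - (X : ℂ[X]) • (1 : Matrix (Fin r) (Fin r) ℂ[X])) * const K) z =
      G * (S - z • 1) * K := by
  have : (1 : Matrix (Fin r) (Fin r) ℂ[X]) = const 1 := by simp [const]
  rw [polyEval_mul, polyEval_mul, polyEval_const, polyEval_const, polyEval_sub, polyEval_X_smul,
    this, polyEval_const, polyEval_const]

/-- The Popov-Belevitch-Hautus argument: `u G` is a left eigenvector of `S` killing `b`, so it kills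
every `S^n b`. -/
lemma IsMinimalRealization.row_finite (h : IsMinimalRealization R V S b c) (hG : IsUnit G)
    (hK : IsUnit K) (z : ℂ) {u : Fin r → ℂ} (h₁ : u ᵥ* (G * (S - z • 1) * K) = 0)
    (h₂ : u ᵥ* (G * b) = 0) : u = 0 := by
  rw [← vecMul_vecMul] at h₁ h₂
  have h3 := vecMul_injective_of_isUnit hK h₁
  rw [← vecMul_vecMul, vecMul_sub, vecMul_smul, vecMul_one, sub_eq_zero] at h3
  apply vecMul_injective_of_isUnit hG
  apply h.controllable
  intro n
  induction n with
  | zero => rw [pow_zero, Matrix.one_mul, h₂]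
  | succ n ih => rw [pow_succ', Matrix.mul_assoc, ← vecMul_vecMul, h3, smul_vecMul, ih, smul_zero]

lemma IsMinimalRealization.col_finite (h : IsMinimalRealization R V S b c) (hG : IsUnit G)
    (hK : IsUnit K) (z : ℂ) {w : Fin r → ℂ} (h₁ : (G * (S - z • 1) * K) *ᵥ w = 0)
    (h₂ : (c * K) *ᵥ w = 0) : w = 0 := by
  rw [Matrix.mul_assoc, ← mulVec_mulVec] at h₁
  rw [← mulVec_mulVec] at h₂
  have h3 := mulVec_injective_of_isUnit hG h₁
  rw [← mulVec_mulVec, sub_mulVec, smul_mulVec, one_mulVec, sub_eq_zero] at h3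
  apply mulVec_injective_of_isUnit hK
  apply h.eq_zero_of_obs
  intro n
  induction n with
  | zero => rw [pow_zero, Matrix.mul_one, h₂]
  | succ n ih => rw [pow_succ, ← Matrix.mul_assoc, ← mulVec_mulVec, h3, mulVec_smul, ih, smul_zero]

lemma det_pencil_ne_zero (hG : IsUnit G) (hK : IsUnit K) :
    (const G * (const S - (X : ℂ[X]) • (1 : Matrix (Fin r) (Fin r) ℂ[X])) * const K).det ≠ 0 := by
  have hc : ∀ {M : Matrix (Fin r) (Fin r) ℂ}, IsUnit M → (const M).det ≠ 0 := by
    intro M hM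
    have h1 : (const M).det = C M.det := (C.map_det M).symm
    rw [h1, Ne, C_eq_zero]
    exact ((isUnit_iff_isUnit_det _).1 hM).ne_zero
  have h2 : const S - (X : ℂ[X]) • (1 : Matrix (Fin r) (Fin r) ℂ[X]) = -charmatrix S := by
    ext i j
    simp [charmatrix, const, diagonal_apply, one_apply]
  rw [det_mul, det_mul, h2, det_neg]
  refine mul_ne_zero (mul_ne_zero (hc hG) (mul_ne_zero ?_ ?_)) (hc hK)
  · exact pow_ne_zero _ (by simp)
  · exact S.charpoly_monic.ne_zero

/-- The relation `V (λ - S) = c` shows `c K = -(V G⁻¹) A`, so `c K A⁻¹ (-G b) = V b = R`. -/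
lemma IsMinimalRealization.transfer (h : IsMinimalRealization R V S b c) (hG : IsUnit G)
    (hK : IsUnit K) :
    toRat (const (c * K)) *
      (toRat (const G * (const S - (X : ℂ[X]) • (1 : Matrix (Fin r) (Fin r) ℂ[X])) * const K))⁻¹ *
        toRat (-const (G * b)) = R := by
  set A := const G * (const S - (X : ℂ[X]) • (1 : Matrix (Fin r) (Fin r) ℂ[X])) * const K with hA
  have hAu : IsUnit (toRat A).det := isUnit_toRat_det (det_pencil_ne_zero hG hK)
  have hGu : IsUnit G.det := (isUnit_iff_isUnit_det _).1 hG
  have hGi : ratConst G⁻¹ * ratConst G = 1 := by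
    rw [← ratConst_mul, nonsing_inv_mul _ hGu, ratConst_one]
  have hA' : toRat A = ratConst G * (ratConst S - (RatFunc.X : RatFunc ℂ) • 1) * ratConst K := by
    rw [hA, toRat_mul, toRat_mul, toRat_const, toRat_const]
    congr 2
    ext i j
    simp only [toRat, const, ratConst, map_apply, Matrix.sub_apply, Matrix.smul_apply, one_apply,
      smul_eq_mul, map_sub, RatFunc.algebraMap_C, map_mul, RatFunc.algebraMap_X]
    split_ifs <;> simp
  have h1 : toRat (const (c * K)) = -(V * ratConst G⁻¹) * toRat A := by
    rw [hA', toRat_const, ratConst_mul]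
    have : -(V * ratConst G⁻¹) * (ratConst G * (ratConst S - (RatFunc.X : RatFunc ℂ) • 1) * ratConst K)
        = -(V * (ratConst G⁻¹ * ratConst G) * (ratConst S - (RatFunc.X : RatFunc ℂ) • 1)) *
          ratConst K := by
      simp only [Matrix.mul_assoc, Matrix.neg_mul]
    rw [this, hGi, Matrix.mul_one, Matrix.mul_sub, Matrix.mul_smul, Matrix.mul_one, h.shift]
    congr 1
    abel
  rw [h1, mul_nonsing_inv_cancel_right _ _ hAu, toRat_neg, toRat_const, ratConst_mul,
    Matrix.neg_mul, Matrix.mul_neg, neg_neg, Matrix.mul_assoc, ← Matrix.mul_assoc (ratConst G⁻¹),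
    hGi, Matrix.one_mul]
  exact h.out.symm

end StrictlyProperPart

end

section

/-! ### The adjoint of a rational function -/

/-- The polynomial whose value at `η z̄` is the conjugate of the value of `p` at `z`. -/
def daggerPoly (τ : SelfConj) : ℂ[X] →+* ℂ[X] :=
  eval₂RingHom (C.comp (starRingEnd ℂ)) (C τ.eta * X)

lemma daggerPoly_coeff (τ : SelfConj) (p : ℂ[X]) (n : ℕ) :
    (daggerPoly τ p).coeff n = τ.eta ^ n * star (p.coeff n) := by
  induction p using Polynomial.induction_on' with
  | add p q hp hq => simp [hp, hq, mul_add]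
  | monomial k a =>
    simp only [daggerPoly, coe_eval₂RingHom, eval₂_monomial, RingHom.comp_apply, mul_pow, ← C_pow,
      ← mul_assoc, ← C_mul, coeff_C_mul, coeff_X_pow, coeff_monomial]
    obtain rfl | h := eq_or_ne n k
    · simp [mul_comm]
    · simp [h, Ne.symm h]

lemma SelfConj.eta_pow_ne_zero (τ : SelfConj) (n : ℕ) : τ.eta ^ n ≠ 0 :=
  pow_ne_zero _ fun h => by simpa [h] using τ.eta_mul_self

lemma daggerPoly_degree (τ : SelfConj) (p : ℂ[X]) : (daggerPoly τ p).degree = p.degree := by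
  have : (daggerPoly τ p).support = p.support := by
    ext n
    simp [mem_support_iff, daggerPoly_coeff, τ.eta_pow_ne_zero n]
  rw [degree, degree, this]

lemma daggerPoly_injective (τ : SelfConj) : Function.Injective (daggerPoly τ) := by
  rw [injective_iff_map_eq_zero]
  intro p hp
  rw [← degree_eq_bot, ← daggerPoly_degree τ, hp, degree_zero]

lemma SelfConj.reflect_reflect (τ : SelfConj) (z : ℂ) : τ.reflect (τ.reflect z) = z := by
  cases τ <;> simp [SelfConj.reflect]

lemma daggerPoly_eval (τ : SelfConj) (p : ℂ[X]) (z : ℂ) :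
    (daggerPoly τ p).eval z = star (p.eval (τ.reflect z)) := by
  induction p using Polynomial.induction_on' with
  | add p q hp hq => simp [hp, hq]
  | monomial k a =>
    simp only [daggerPoly, coe_eval₂RingHom, eval₂_monomial, RingHom.comp_apply, mul_pow,
      eval_mul, eval_pow, eval_C, eval_X, eval_monomial, τ.reflect_eq, star_mul', star_pow,
      τ.star_eta, star_star]
    rfl

/-- The adjoint of a rational function. -/
def dagger (τ : SelfConj) : RatFunc ℂ →+* RatFunc ℂ :=
  RatFunc.mapRingHom (daggerPoly τ)
    (nonZeroDivisors_le_comap_nonZeroDivisors_of_injective _ (daggerPoly_injective τ))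

lemma dagger_eq (τ : SelfConj) (f : RatFunc ℂ) : dagger τ f =
    algebraMap _ _ (daggerPoly τ f.num) / algebraMap _ _ (daggerPoly τ f.denom) := by
  rw [dagger, RatFunc.coe_mapRingHom_eq_coe_map, RatFunc.map_apply]

lemma dagger_algebraMap (τ : SelfConj) (p : ℂ[X]) :
    dagger τ (algebraMap _ _ p) = algebraMap _ _ (daggerPoly τ p) := by
  rw [dagger_eq]
  simp

lemma dagger_C (τ : SelfConj) (a : ℂ) : dagger τ (RatFunc.C a) = RatFunc.C (star a) := by
  rw [← RatFunc.algebraMap_C, dagger_algebraMap, ← RatFunc.algebraMap_C]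
  simp [daggerPoly]

lemma dagger_X (τ : SelfConj) : dagger τ RatFunc.X = RatFunc.C τ.eta * RatFunc.X := by
  rw [← RatFunc.algebraMap_X, dagger_algebraMap, ← RatFunc.algebraMap_C, ← map_mul]
  simp [daggerPoly]

lemma dagger_mem_strictlyProper (τ : SelfConj) {f : RatFunc ℂ} (hf : f ∈ strictlyProper) :
    dagger τ f ∈ strictlyProper := by
  rw [dagger_eq]
  apply div_mem_strictlyProper
  rw [daggerPoly_degree, daggerPoly_degree]
  exact (mem_strictlyProper_iff_degree f).1 hf

lemma laurentCoeff_C_of_neg (a : ℂ) {i : ℤ} (hi : i < 0) : laurentCoeff (RatFunc.C a) i = 0 := by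
  rw [← RatFunc.algebraMap_C, laurentCoeff_polynomial_neg _ hi]

/-- Replacing `f` by `λ f` minus its constant term moves every coefficient up by one, and the
adjoint contributes one factor `η` each time. -/
lemma laurentCoeff_dagger (τ : SelfConj) {f : RatFunc ℂ} (hf : f ∈ strictlyProper) (n : ℕ) :
    laurentCoeff (dagger τ f) (-((n : ℤ) + 1)) =
      τ.eta ^ (n + 1) * star (laurentCoeff f (-((n : ℤ) + 1))) := by
  have h1 := X_mul_sub_mem_strictlyProper hf
  have h2 : dagger τ (RatFunc.X * f - RatFunc.C (laurentCoeff f (-1))) =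
      RatFunc.C τ.eta * (RatFunc.X * dagger τ f) - RatFunc.C (star (laurentCoeff f (-1))) := by
    rw [map_sub, map_mul, dagger_X, dagger_C, mul_assoc]
  induction n generalizing f with
  | zero =>
    have h3 := dagger_mem_strictlyProper τ h1 0
    have h4 : ∀ a : ℂ, laurentCoeff (RatFunc.C a) ((0 : ℕ) : ℤ) = a := fun a => by
      rw [← RatFunc.algebraMap_C, laurentCoeff_polynomial, coeff_C_zero]
    rw [h2, laurentCoeff_sub, laurentCoeff_C_mul, laurentCoeff_X_mul, h4, sub_eq_zero] at h3
    simp only [Nat.cast_zero, zero_sub, zero_add, pow_one] at h3 ⊢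
    rw [← h3, ← mul_assoc, τ.eta_mul_self, one_mul]
  | succ n ih =>
    have e1 : -(((n + 1 : ℕ) : ℤ) + 1) = -((n : ℤ) + 1) - 1 := by push_cast; ring
    have h3 := ih h1 (X_mul_sub_mem_strictlyProper h1)
      (by rw [map_sub, map_mul, dagger_X, dagger_C, mul_assoc])
    rw [h2, laurentCoeff_sub, laurentCoeff_sub, laurentCoeff_C_mul, laurentCoeff_X_mul,
      laurentCoeff_X_mul, laurentCoeff_C_of_neg _ (by omega), laurentCoeff_C_of_neg _ (by omega),
      sub_zero, sub_zero, ← e1] at h3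
    rw [pow_succ', mul_assoc, ← h3, ← mul_assoc, τ.eta_mul_self, one_mul]

variable {m : ℕ}

lemma SelfConj.RatHas.dagger_eq {τ : SelfConj} {R : Matrix (Fin m) (Fin m) (RatFunc ℂ)}
    (h : τ.RatHas R) (i j : Fin m) : dagger τ (R j i) = RatFunc.C τ.sign * R i j := by
  -- `Q` vanishes at all poles, so the hypothesis applies wherever `Q(w)` and `Q` at the reflected
  -- point are nonzero. Multiplying by `Q` and its adjoint makes the polynomial identity hold at
  -- every point.
  let Q : ℂ[X] := ∏ a, ∏ b, (R a b).denom
  have hQ : Q ≠ 0 := Finset.prod_ne_zero_iff.2 fun a _ => Finset.prod_ne_zero_iff.2 fun b _ =>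
    (R a b).denom_ne_zero
  have hQdef : ∀ z, Q.eval z ≠ 0 → DefinedAt R z := by
    intro z hz a b h0
    apply hz
    rw [eval_prod]
    refine Finset.prod_eq_zero (Finset.mem_univ a) ?_
    rw [eval_prod]
    exact Finset.prod_eq_zero (Finset.mem_univ b) h0
  have key : daggerPoly τ (R j i).num * (R i j).denom -
      C τ.sign * (R i j).num * daggerPoly τ (R j i).denom = 0 := by
    have h0 : (daggerPoly τ (R j i).num * (R i j).denom -
        C τ.sign * (R i j).num * daggerPoly τ (R j i).denom) * (Q * daggerPoly τ Q) = 0 := by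
      apply Polynomial.funext
      intro w
      rw [eval_mul, eval_mul, eval_zero, daggerPoly_eval]
      by_cases h1 : Q.eval w = 0
      · rw [h1, zero_mul, mul_zero]
      by_cases h2 : Q.eval (τ.reflect w) = 0
      · rw [h2, star_zero, mul_zero, mul_zero]
      have d1 := hQdef w h1
      have d2 := hQdef _ h2
      have h3 := h (τ.reflect w) d2 (by rwa [τ.reflect_reflect])
      rw [τ.reflect_reflect] at h3
      have h4 := congrFun (congrFun h3 i) j
      simp only [conjTranspose_apply, Matrix.smul_apply, ratEval, map_apply, RatFunc.eval,
        smul_eq_mul] at h4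
      have hid : ∀ (p : ℂ[X]) (z : ℂ), eval₂ (RingHom.id ℂ) z p = p.eval z := fun p z => rfl
      simp only [hid] at h4
      have n1 : (R i j).denom.eval w ≠ 0 := d1 i j
      have n2 : star ((R j i).denom.eval (τ.reflect w)) ≠ 0 := star_ne_zero.2 (d2 j i)
      rw [star_div₀, ← mul_div_assoc, div_eq_div_iff n2 n1] at h4
      rw [eval_sub, eval_mul, eval_mul, eval_mul, eval_C, daggerPoly_eval, daggerPoly_eval, h4,
        sub_self, zero_mul]
    have hQQ : Q * daggerPoly τ Q ≠ 0 :=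
      mul_ne_zero hQ ((map_ne_zero_iff _ (daggerPoly_injective τ)).2 hQ)
    exact (mul_eq_zero.1 h0).resolve_right hQQ
  rw [sub_eq_zero] at key
  have n1 : algebraMap ℂ[X] (RatFunc ℂ) (R i j).denom ≠ 0 := by
    simpa using (R i j).denom_ne_zero
  have n2 : algebraMap ℂ[X] (RatFunc ℂ) (daggerPoly τ (R j i).denom) ≠ 0 := by
    simpa using (map_ne_zero_iff _ (daggerPoly_injective τ)).2 (R j i).denom_ne_zero
  rw [StrongLin.dagger_eq]
  conv_rhs => rw [← RatFunc.num_div_denom (R i j), ← mul_div_assoc, ← RatFunc.algebraMap_C]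
  rw [div_eq_div_iff n2 n1, ← map_mul, ← map_mul, ← map_mul, key]

/-- The polynomial and the strictly proper part inherit the structure. -/
lemma SelfConj.RatHas.coeff {τ : SelfConj} {R : Matrix (Fin m) (Fin m) (RatFunc ℂ)}
    (h : τ.RatHas R) {P : Matrix (Fin m) (Fin m) ℂ[X]} {Rsp : Matrix (Fin m) (Fin m) (RatFunc ℂ)}
    (hdec : R = toRat P + Rsp) (hsp : IsStrictlyProper Rsp) :
    (∀ n i j, star (polyCoeff P n j i) = τ.sign * τ.eta ^ n * polyCoeff P n i j) ∧
    ∀ (n : ℕ) i j, star (laurentCoeff (Rsp j i) (-((n : ℤ) + 1))) =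
      τ.sign * τ.eta ^ (n + 1) * laurentCoeff (Rsp i j) (-((n : ℤ) + 1)) := by
  have hmem : ∀ i j, Rsp i j ∈ strictlyProper := fun i j =>
    (mem_strictlyProper_iff_degree _).2 (hsp i j)
  have hpow : ∀ n : ℕ, τ.eta ^ n * τ.eta ^ n = 1 := fun n => by
    rw [← mul_pow, τ.eta_mul_self, one_pow]
  have h1 : ∀ i j, daggerPoly τ (P j i) = C τ.sign * P i j ∧
      dagger τ (Rsp j i) = RatFunc.C τ.sign * Rsp i j := by
    intro i j
    have h2 := h.dagger_eq i j
    have hR : ∀ a b, R a b = algebraMap _ _ (P a b) + Rsp a b := fun a b => by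
      rw [hdec]; rfl
    rw [hR, hR, map_add, dagger_algebraMap, mul_add, ← RatFunc.algebraMap_C, ← map_mul] at h2
    -- The left side is polynomial and the right side strictly proper, so both are zero.
    have h3 : algebraMap ℂ[X] (RatFunc ℂ) (daggerPoly τ (P j i) - C τ.sign * P i j) =
        algebraMap ℂ[X] (RatFunc ℂ) (C τ.sign) * Rsp i j - dagger τ (Rsp j i) := by
      rw [map_sub]
      linear_combination h2
    have h4 : algebraMap ℂ[X] (RatFunc ℂ) (daggerPoly τ (P j i) - C τ.sign * P i j) ∈
        strictlyProper := by
      rw [h3]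
      refine sub_mem ?_ (dagger_mem_strictlyProper τ (hmem j i))
      rw [RatFunc.algebraMap_C, ← RatFunc.smul_eq_C_mul]
      exact strictlyProper.smul_mem _ (hmem i j)
    have h5 := polynomial_mem_strictlyProper h4
    rw [h5, map_zero, eq_comm, sub_eq_zero] at h3
    exact ⟨sub_eq_zero.1 h5, by rw [← h3, RatFunc.algebraMap_C]⟩
  constructor
  · intro n i j
    have h2 := congrArg (fun p => p.coeff n) (h1 i j).1
    simp only [daggerPoly_coeff, coeff_C_mul] at h2
    simp only [polyCoeff, map_apply]
    linear_combination τ.eta ^ n * h2 - star ((P j i).coeff n) * hpow n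
  · intro n i j
    have h2 := congrArg (fun f => laurentCoeff f (-((n : ℤ) + 1))) (h1 i j).2
    simp only [laurentCoeff_dagger τ (hmem j i), laurentCoeff_C_mul] at h2
    linear_combination τ.eta ^ (n + 1) * h2 -
      star (laurentCoeff (Rsp j i) (-((n : ℤ) + 1))) * hpow (n + 1)

/-! ### Existence of the unitary compressions -/

lemma exists_unitary_diagonalization {ι : Type*} [Fintype ι] [DecidableEq ι] {N : Matrix ι ι ℂ}
    {s : ℂ} (hs : s = 1 ∨ s = -1) (hN : Nᴴ = s • N) :
    ∃ (V : Matrix ι ι ℂ) (e : ι → ℂ), IsUnitary V ∧ Vᴴ * N * V = diagonal e := by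
  have herm : ∀ M : Matrix ι ι ℂ, M.IsHermitian →
      ∃ (V : Matrix ι ι ℂ) (e : ι → ℂ), IsUnitary V ∧ Vᴴ * M * V = diagonal e := by
    intro M hM
    refine ⟨hM.eigenvectorUnitary, fun i => (hM.eigenvalues i : ℂ), ⟨?_, ?_⟩, ?_⟩
    · exact Unitary.coe_star_mul_self hM.eigenvectorUnitary
    · exact Unitary.coe_mul_star_self hM.eigenvectorUnitary
    · have := hM.conjStarAlgAut_star_eigenvectorUnitary
      rw [Unitary.conjStarAlgAut_star_apply] at this
      exact this
  obtain rfl | rfl := hs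
  · exact herm N (by rw [Matrix.IsHermitian, hN, one_smul])
  -- A skew-Hermitian matrix becomes Hermitian after multiplication by `i`.
  · obtain ⟨V, e, hV, h⟩ := herm (Complex.I • N) (by
      rw [Matrix.IsHermitian, conjTranspose_smul, hN]
      simp)
    refine ⟨V, fun i => -Complex.I * e i, hV, ?_⟩
    rw [Matrix.mul_smul, Matrix.smul_mul] at h
    have h2 := congrArg (fun M => (-Complex.I) • M) h
    simp only [smul_smul, neg_mul, Complex.I_mul_I, neg_neg, one_smul] at h2
    rw [h2, ← diagonal_smul]
    rfl

lemma conj_submatrix {ι κ κ' : Type*} [Fintype ι] (V : Matrix ι κ ℂ) (N : Matrix ι ι ℂ)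
    (f : κ' → κ) :
    (V.submatrix id f)ᴴ * N * V.submatrix id f = (Vᴴ * N * V).submatrix f f := rfl

lemma IsUnitary.submatrix_equiv {ι κ κ' : Type*} [Fintype ι] [Fintype κ] [Fintype κ']
    [DecidableEq ι] [DecidableEq κ] [DecidableEq κ'] {V : Matrix ι κ ℂ} (hV : IsUnitary V)
    (e : κ' ≃ κ) : IsUnitary (V.submatrix id e) := by
  constructor
  · have h1 := conj_submatrix V 1 e
    rw [Matrix.mul_one, Matrix.mul_one, hV.1] at h1
    rw [h1, submatrix_one_equiv]
  · rw [conjTranspose_submatrix, submatrix_mul_equiv, hV.2, submatrix_id_id]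

lemma exists_unitary_compression {ι : Type*} [Fintype ι] [DecidableEq ι] {N : Matrix ι ι ℂ}
    {s : ℂ} (hs : s = 1 ∨ s = -1) (hN : Nᴴ = s • N) :
    ∃ (p r : ℕ) (V : Matrix ι (Fin p ⊕ Fin r) ℂ) (D : Matrix (Fin r) (Fin r) ℂ), IsUnitary V ∧
      Vᴴ * N * V = fromBlocks 0 0 0 D ∧ IsUnit D := by
  classical
  obtain ⟨V, e, hV, h⟩ := exists_unitary_diagonalization hs hN
  -- Zero eigenvalues are sorted to the front, nonzero ones to the back.
  let f : Fin (Fintype.card {i // e i = 0}) ⊕ Fin (Fintype.card {i // ¬ e i = 0}) ≃ ι :=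
    (Equiv.sumCongr (Fintype.equivFin _).symm (Fintype.equivFin _).symm).trans
      (Equiv.sumCompl fun i => e i = 0)
  have f1 : ∀ i, e (f (Sum.inl i)) = 0 := fun i => by
    simpa [f] using ((Fintype.equivFin {i // e i = 0}).symm i).2
  have f2 : ∀ i, e (f (Sum.inr i)) ≠ 0 := fun i => by
    simpa [f] using ((Fintype.equivFin {i // ¬ e i = 0}).symm i).2
  refine ⟨_, _, V.submatrix id f, diagonal fun i => e (f (Sum.inr i)), hV.submatrix_equiv f, ?_, ?_⟩
  · have h2 : (0 : Matrix (Fin (Fintype.card {i // e i = 0})) (Fin (Fintype.card {i // e i = 0})) ℂ)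
        = diagonal fun i => e (f (Sum.inl i)) := by
      simp [f1]
    rw [conj_submatrix, h, h2, fromBlocks_diagonal, submatrix_diagonal_equiv]
    congr 1
    ext i
    cases i <;> rfl
  · rw [isUnit_iff_isUnit_det, det_diagonal]
    exact IsUnit.prod_univ_iff.2 fun i => isUnit_iff_ne_zero.2 (f2 i)

lemma SelfConj.sign_eq (τ : SelfConj) : τ.sign = 1 ∨ τ.sign = -1 := by
  cases τ <;> simp [SelfConj.sign]

lemma SelfConj.sign_mul_eta_eq (τ : SelfConj) : τ.sign * τ.eta = 1 ∨ τ.sign * τ.eta = -1 := by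
  cases τ <;> simp [SelfConj.sign, SelfConj.eta]

lemma SelfConj.eta_pow_mul_self (τ : SelfConj) (n : ℕ) : τ.eta ^ n * τ.eta ^ n = 1 := by
  rw [← mul_pow, τ.eta_mul_self, one_pow]

lemma isUnitary_scaling {ι κ : Type*} [Fintype ι] [Fintype κ] [DecidableEq ι] [DecidableEq κ]
    {D : Matrix ι ι ℂ} {V : Matrix ι κ ℂ} (hD : Dᴴ = D) (hD2 : D * D = 1) (hV : IsUnitary V) :
    IsUnitary (D * V) := by
  constructor
  · rw [conjTranspose_mul, hD, Matrix.mul_assoc, ← Matrix.mul_assoc D, hD2, Matrix.one_mul, hV.1]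
  · rw [conjTranspose_mul, hD, Matrix.mul_assoc, ← Matrix.mul_assoc V, hV.2, Matrix.one_mul, hD2]

lemma polyScaling_mul_self (τ : SelfConj) (m d : ℕ) :
    polyScaling τ m d * polyScaling τ m d = 1 := by
  rw [polyScaling_eq, diagonal_mul_diagonal, ← diagonal_one]
  congr 1
  ext x
  exact τ.eta_pow_mul_self _

lemma hankelScaling_mul_self (τ : SelfConj) (m k : ℕ) :
    hankelScaling τ m k * hankelScaling τ m k = 1 := by
  rw [hankelScaling_eq, diagonal_mul_diagonal, ← diagonal_one]
  congr 1
  ext x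
  exact τ.eta_pow_mul_self _

section Structure

variable {τ : SelfConj} {P : Matrix (Fin m) (Fin m) ℂ[X]}
  {Rsp : Matrix (Fin m) (Fin m) (RatFunc ℂ)}

/-- The index of the block `(i, j)` of `T` is `(d-1-i) + (d-1-j)`. Its sign `η^n` splits
accordingly: the column factor cancels the scaling and the row factor recreates it. -/
lemma scaling_mul_blockT (hP : ∀ n i j, star (polyCoeff P n j i) =
    τ.sign * τ.eta ^ n * polyCoeff P n i j) (d : ℕ) :
    (polyScaling τ m d * blockT P d)ᴴ = τ.sign • (polyScaling τ m d * blockT P d) := by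
  ext x y
  have e : 2 * d - 2 - (y.1 : ℕ) - (x.1 : ℕ) = (d - 1 - x.1) + (d - 1 - y.1) := by omega
  have e' : 2 * d - 2 - (x.1 : ℕ) - (y.1 : ℕ) = (d - 1 - x.1) + (d - 1 - y.1) := by omega
  rw [polyScaling_eq, conjTranspose_apply, Matrix.smul_apply, diagonal_mul, diagonal_mul, star_mul',
    star_pow, τ.star_eta]
  simp only [blockT, of_apply, e, e', hP, smul_eq_mul, pow_add]
  linear_combination (τ.sign * τ.eta ^ (d - 1 - (x.1 : ℕ)) *
    polyCoeff P (d - 1 - (x.1 : ℕ) + (d - 1 - (y.1 : ℕ))) x.2 y.2) *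
      τ.eta_pow_mul_self (d - 1 - (y.1 : ℕ))

/-- The block `(i, j)` carries `η^(i+j+1)`, one power short of the scalings `η^(i+1) η^(j+1)`; this
leaves the extra `η`, which the shifted Hankel matrix does not have. -/
lemma scaling_mul_hankel (hR : ∀ (n : ℕ) i j, star (laurentCoeff (Rsp j i) (-((n : ℤ) + 1))) =
    τ.sign * τ.eta ^ (n + 1) * laurentCoeff (Rsp i j) (-((n : ℤ) + 1))) (k : ℕ) :
    (hankelScaling τ m k * hankel Rsp k)ᴴ =
      (τ.sign * τ.eta) • (hankelScaling τ m k * hankel Rsp k) := by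
  ext x y
  have e : -(((y.1 : ℕ) : ℤ) + ((x.1 : ℕ) : ℤ) + 1) = -(((x.1 + y.1 : ℕ) : ℤ) + 1) := by
    push_cast; ring
  have e' : -(((x.1 : ℕ) : ℤ) + ((y.1 : ℕ) : ℤ) + 1) = -(((x.1 + y.1 : ℕ) : ℤ) + 1) := by
    push_cast; ring
  rw [hankelScaling_eq, conjTranspose_apply, Matrix.smul_apply, diagonal_mul, diagonal_mul, star_mul',
    star_pow, τ.star_eta]
  simp only [hankel, of_apply, e, e', hR, smul_eq_mul]
  have h1 := τ.eta_pow_mul_self ((y.1 : ℕ) + 1)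
  have h2 := τ.eta_mul_self
  rw [pow_add, pow_add, pow_add] at *
  linear_combination (τ.sign * τ.eta ^ (x.1 : ℕ) *
    laurentCoeff (Rsp x.2 y.2) (-(((x.1 + y.1 : ℕ) : ℤ) + 1))) * (h1 - h2)

lemma scaling_mul_shiftedHankel
    (hR : ∀ (n : ℕ) i j, star (laurentCoeff (Rsp j i) (-((n : ℤ) + 1))) =
      τ.sign * τ.eta ^ (n + 1) * laurentCoeff (Rsp i j) (-((n : ℤ) + 1))) (k : ℕ) :
    (hankelScaling τ m k * shiftedHankel Rsp k)ᴴ =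
      τ.sign • (hankelScaling τ m k * shiftedHankel Rsp k) := by
  ext x y
  have e : -(((y.1 : ℕ) : ℤ) + ((x.1 : ℕ) : ℤ) + 2) = -(((x.1 + y.1 + 1 : ℕ) : ℤ) + 1) := by
    push_cast; ring
  have e' : -(((x.1 : ℕ) : ℤ) + ((y.1 : ℕ) : ℤ) + 2) = -(((x.1 + y.1 + 1 : ℕ) : ℤ) + 1) := by
    push_cast; ring
  rw [hankelScaling_eq, conjTranspose_apply, Matrix.smul_apply, diagonal_mul, diagonal_mul, star_mul',
    star_pow, τ.star_eta]
  simp only [shiftedHankel, of_apply, e, e', hR, smul_eq_mul]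
  have h1 := τ.eta_pow_mul_self ((y.1 : ℕ) + 1)
  have h3 : τ.eta ^ ((x.1 : ℕ) + y.1 + 1 + 1) = τ.eta ^ ((x.1 : ℕ) + 1) * τ.eta ^ ((y.1 : ℕ) + 1) := by
    rw [← pow_add]; congr 1; ring
  rw [h3]
  linear_combination (τ.sign * τ.eta ^ ((x.1 : ℕ) + 1) *
    laurentCoeff (Rsp x.2 y.2) (-(((x.1 + y.1 + 1 : ℕ) : ℤ) + 1))) * h1

theorem exists_polyCompression (hP : ∀ n i j, star (polyCoeff P n j i) =
    τ.sign * τ.eta ^ n * polyCoeff P n i j) (d : ℕ) :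
    ∃ (p r : ℕ) (U V : Matrix (Fin (d - 1) × Fin m) (Fin p ⊕ Fin r) ℂ)
      (That : Matrix (Fin r) (Fin r) ℂ), IsPolyCompression τ P d U V That := by
  -- With `U = S V` one has `U* T V = V* (S T) V`, so diagonalizing `S T` suffices.
  obtain ⟨p, r, V, D, hV, h, hD⟩ := exists_unitary_compression τ.sign_eq (scaling_mul_blockT hP d)
  refine ⟨p, r, polyScaling τ m d * V, V, D,
    isUnitary_scaling (polyScaling_conjTranspose τ m d) (polyScaling_mul_self τ m d) hV, hV, rfl,
    ?_, hD⟩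
  rw [conjTranspose_mul, polyScaling_conjTranspose, Matrix.mul_assoc Vᴴ, h]

theorem exists_hankelCompression
    (hR : ∀ (n : ℕ) i j, star (laurentCoeff (Rsp j i) (-((n : ℤ) + 1))) =
      τ.sign * τ.eta ^ (n + 1) * laurentCoeff (Rsp i j) (-((n : ℤ) + 1))) (k : ℕ) :
    ∃ (r q : ℕ) (Y W : Matrix (Fin k × Fin m) (Fin r ⊕ Fin q) ℂ)
      (Hhat : Matrix (Fin r) (Fin r) ℂ), IsHankelCompression τ Rsp k Y W Hhat := by
  -- Here the kernel block has to come last, so the two groups of columns are interchanged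
  -- afterwards.
  obtain ⟨q, r, V, D, hV, h, hD⟩ :=
    exists_unitary_compression τ.sign_mul_eta_eq (scaling_mul_hankel hR k)
  have hW := hV.submatrix_equiv (Equiv.sumComm (Fin r) (Fin q))
  refine ⟨r, q, hankelScaling τ m k * V.submatrix id (Equiv.sumComm _ _),
    V.submatrix id (Equiv.sumComm _ _), D,
    isUnitary_scaling (hankelScaling_conjTranspose τ m k) (hankelScaling_mul_self τ m k) hW, hW, rfl,
    ?_, hD⟩
  rw [conjTranspose_mul, hankelScaling_conjTranspose, Matrix.mul_assoc (_ᴴ), conj_submatrix, h]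
  ext (i | i) (j | j) <;> rfl

end Structure

end

section

variable {m : ℕ}

/-! ### Structure of the blocks of the pencil -/

section Structure

variable {τ : SelfConj} {P : Matrix (Fin m) (Fin m) ℂ[X]}
  {Rsp : Matrix (Fin m) (Fin m) (RatFunc ℂ)}

lemma pencilA_structure (hP : ∀ n i j, star (polyCoeff P n j i) =
    τ.sign * τ.eta ^ n * polyCoeff P n i j) (d : ℕ) (z : ℂ) :
    (polyScaling τ m d * polyEval (pencilA P d) z)ᴴ =
      τ.sign • (polyScaling τ m d * polyEval (pencilA P d) (τ.reflect z)) := by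
  ext x y
  have hx := x.1.2
  have hy := y.1.2
  have e : 2 * d - 2 - (y.1 : ℕ) - (x.1 : ℕ) = (d - 1 - x.1) + (d - 1 - y.1) := by omega
  have e' : 2 * d - 2 - (x.1 : ℕ) - (y.1 : ℕ) = (d - 1 - x.1) + (d - 1 - y.1) := by omega
  have f : 2 * d - 1 - (y.1 : ℕ) - (x.1 : ℕ) = (d - 1 - x.1) + (d - 1 - y.1) + 1 := by omega
  have f' : 2 * d - 1 - (x.1 : ℕ) - (y.1 : ℕ) = (d - 1 - x.1) + (d - 1 - y.1) + 1 := by omega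
  rw [polyScaling_eq, conjTranspose_apply, Matrix.smul_apply, diagonal_mul, diagonal_mul, star_mul',
    star_pow, τ.star_eta]
  simp only [polyEval, map_apply, pencilA, of_apply, e, e', f, f', eval_sub, eval_mul, eval_X, eval_C,
    star_sub, star_mul', hP, smul_eq_mul, τ.reflect_eq, pow_add, pow_one]
  linear_combination (τ.sign * τ.eta ^ (d - 1 - (x.1 : ℕ)) * (τ.eta * star z *
    polyCoeff P (d - 1 - (x.1 : ℕ) + (d - 1 - (y.1 : ℕ)) + 1) x.2 y.2 -
    polyCoeff P (d - 1 - (x.1 : ℕ) + (d - 1 - (y.1 : ℕ))) x.2 y.2)) *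
      τ.eta_pow_mul_self (d - 1 - (y.1 : ℕ))

lemma pencilNegB_structure (hP : ∀ n i j, star (polyCoeff P n j i) =
    τ.sign * τ.eta ^ n * polyCoeff P n i j) (d : ℕ) (z : ℂ) :
    (polyEval (pencilNegB P d) z)ᴴ * polyScaling τ m d =
      τ.sign • polyEval (pencilC P d) (τ.reflect z) := by
  ext b x
  have hx := x.1.2
  have e : d - (x.1 : ℕ) = d - 1 - x.1 + 1 := by omega
  rw [polyScaling_eq, Matrix.smul_apply, mul_diagonal, conjTranspose_apply]
  simp only [polyEval, map_apply, pencilNegB, pencilC, of_apply, e, eval_mul, eval_X, eval_C,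
    star_mul', hP, smul_eq_mul, τ.reflect_eq, pow_succ]
  linear_combination (τ.sign * τ.eta * star z * polyCoeff P (d - 1 - (x.1 : ℕ) + 1) b x.2) *
      τ.eta_pow_mul_self (d - 1 - (x.1 : ℕ))

lemma pencilD_structure (hP : ∀ n i j, star (polyCoeff P n j i) =
    τ.sign * τ.eta ^ n * polyCoeff P n i j) (z : ℂ) :
    (polyEval (pencilD P) z)ᴴ = τ.sign • polyEval (pencilD P) (τ.reflect z) := by
  ext a b
  rw [conjTranspose_apply, Matrix.smul_apply]
  simp only [polyEval, map_apply, pencilD, of_apply, eval_add, eval_mul, eval_X, eval_C,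
    star_add, star_mul', hP, smul_eq_mul, τ.reflect_eq]
  ring

/-- Reflection and sign are involutions, so the relation for the upper right block implies that for
the lower left one. -/
lemma structure_swap {ι κ : Type*} {A : Matrix ι κ ℂ[X]} {B : Matrix κ ι ℂ[X]}
    (h : ∀ z, (polyEval A z)ᴴ = τ.sign • polyEval B (τ.reflect z)) (z : ℂ) :
    (polyEval B z)ᴴ = τ.sign • polyEval A (τ.reflect z) := by
  have h1 := congrArg conjTranspose (h (τ.reflect z))
  rw [conjTranspose_conjTranspose, τ.reflect_reflect, conjTranspose_smul, τ.star_sign] at h1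
  rw [h1, smul_smul, τ.sign_mul_self, one_smul]

variable {d p r : ℕ} {U V : Matrix (Fin (d - 1) × Fin m) (Fin p ⊕ Fin r) ℂ}

lemma toCols₂_conjTranspose (hU : U = polyScaling τ m d * V) :
    U.toCols₂ᴴ = V.toCols₂ᴴ * polyScaling τ m d := by
  rw [hU, ← mul_toCols₂, conjTranspose_mul, polyScaling_conjTranspose]

lemma hatA_structure (hP : ∀ n i j, star (polyCoeff P n j i) =
    τ.sign * τ.eta ^ n * polyCoeff P n i j) (hU : U = polyScaling τ m d * V) (z : ℂ) :
    (polyEval (hatA P d U V) z)ᴴ = τ.sign • polyEval (hatA P d U V) (τ.reflect z) := by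
  have h1 : ∀ z, polyEval (hatA P d U V) z =
      V.toCols₂ᴴ * (polyScaling τ m d * polyEval (pencilA P d) z) * V.toCols₂ := by
    intro z
    rw [hatA, polyEval_mul, polyEval_mul, polyEval_const, polyEval_const, toCols₂_conjTranspose hU]
    simp only [Matrix.mul_assoc]
  rw [h1, h1, conjTranspose_mul, conjTranspose_mul, conjTranspose_conjTranspose,
    pencilA_structure hP, Matrix.smul_mul, Matrix.mul_smul]
  simp only [Matrix.mul_assoc]

lemma hatNegB_structure (hP : ∀ n i j, star (polyCoeff P n j i) =
    τ.sign * τ.eta ^ n * polyCoeff P n i j) (hU : U = polyScaling τ m d * V) (z : ℂ) :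
    (polyEval (hatNegB P d U) z)ᴴ = τ.sign • polyEval (hatC P d V) (τ.reflect z) := by
  rw [hatNegB, hatC, polyEval_mul, polyEval_mul, polyEval_const, polyEval_const,
    toCols₂_conjTranspose hU, Matrix.mul_assoc, conjTranspose_mul, conjTranspose_conjTranspose,
    conjTranspose_mul, polyScaling_conjTranspose, pencilNegB_structure hP, Matrix.smul_mul]

variable {k rf q : ℕ} {Y W : Matrix (Fin k × Fin m) (Fin rf ⊕ Fin q) ℂ}
  {Hhat : Matrix (Fin rf) (Fin rf) ℂ}

lemma Hhat_conjTranspose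
    (hR : ∀ (n : ℕ) i j, star (laurentCoeff (Rsp j i) (-((n : ℤ) + 1))) =
      τ.sign * τ.eta ^ (n + 1) * laurentCoeff (Rsp i j) (-((n : ℤ) + 1)))
    (h : IsHankelCompression τ Rsp k Y W Hhat) : Hhatᴴ = (τ.sign * τ.eta) • Hhat := by
  have h1 := h.compress
  rw [h.left_eq, conjTranspose_mul, hankelScaling_conjTranspose, Matrix.mul_assoc Wᴴ] at h1
  have h2 := congrArg conjTranspose h1
  rw [conjTranspose_mul, conjTranspose_mul, conjTranspose_conjTranspose, scaling_mul_hankel hR,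
    Matrix.smul_mul, Matrix.mul_smul, ← Matrix.mul_assoc, h1, fromBlocks_conjTranspose,
    fromBlocks_smul] at h2
  exact (fromBlocks_inj.1 h2).1.symm

/-- The factor `η` in `Ĥ* = σ η Ĥ` is what turns the conjugate of `z` into the reflected point `η
z̄` in the term `λ Ĥ`. -/
lemma spA_structure
    (hR : ∀ (n : ℕ) i j, star (laurentCoeff (Rsp j i) (-((n : ℤ) + 1))) =
      τ.sign * τ.eta ^ (n + 1) * laurentCoeff (Rsp i j) (-((n : ℤ) + 1)))
    (h : IsHankelCompression τ Rsp k Y W Hhat) (z : ℂ) :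
    (polyEval (spA τ Rsp W Hhat) z)ᴴ = τ.sign • polyEval (spA τ Rsp W Hhat) (τ.reflect z) := by
  rw [spA, polyEval_sub, polyEval_sub, polyEval_X_smul, polyEval_X_smul, polyEval_const,
    polyEval_const, polyEval_const, polyEval_const, conjTranspose_sub, conjTranspose_smul,
    Hhat_conjTranspose hR h, conjTranspose_mul, conjTranspose_mul, conjTranspose_conjTranspose,
    scaling_mul_shiftedHankel hR, Matrix.smul_mul, Matrix.mul_smul, smul_sub, smul_smul, smul_smul,
    τ.reflect_eq, show star z * (τ.sign * τ.eta) = τ.sign * (τ.eta * star z) by ring]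
  simp only [Matrix.mul_assoc]

/-- `(Ĥ W₁₁*)* = W₁₁ Ĥ* = σ η W₁₁ Ĥ`, which forces the sign chosen in `C_sp`. -/
lemma spNegB_structure
    (hR : ∀ (n : ℕ) i j, star (laurentCoeff (Rsp j i) (-((n : ℤ) + 1))) =
      τ.sign * τ.eta ^ (n + 1) * laurentCoeff (Rsp i j) (-((n : ℤ) + 1)))
    (h : IsHankelCompression τ Rsp k Y W Hhat) (hk : 0 < k) (z : ℂ) :
    (polyEval (spNegB hk W Hhat) z)ᴴ = τ.sign • polyEval (spC τ hk W Hhat) (τ.reflect z) := by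
  rw [spC_eq, spNegB, polyEval_const, polyEval_const, conjTranspose_mul, conjTranspose_conjTranspose,
    Hhat_conjTranspose hR h, Matrix.mul_smul, smul_smul]

end Structure

/-! ### The combined pencil -/

section Combined

variable {r s n : Type*}

lemma rank_rows [Fintype r] [Fintype s] [Fintype n] {a₁ : Matrix r r ℂ}
    {a₂ : Matrix s s ℂ} {b₁ : Matrix r n ℂ} {b₂ : Matrix s n ℂ}
    (h : ∀ u₁ u₂, u₁ ᵥ* a₁ = 0 → u₂ ᵥ* a₂ = 0 → u₁ ᵥ* b₁ + u₂ ᵥ* b₂ = 0 → u₁ = 0 ∧ u₂ = 0) :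
    (fromCols (fromBlocks a₁ 0 0 a₂) (fromRows b₁ b₂)).rank = Fintype.card (r ⊕ s) := by
  rw [rank_eq_card_iff_vecMul]
  intro u hu
  rw [vecMul_fromCols] at hu
  have h1 : u ᵥ* fromBlocks a₁ 0 0 a₂ = 0 := by
    ext i; exact congrFun hu (Sum.inl i)
  have h2 : u ᵥ* fromRows b₁ b₂ = 0 := by
    ext i; exact congrFun hu (Sum.inr i)
  rw [vecMul_fromBlocks] at h1
  simp only [vecMul_zero, add_zero, zero_add] at h1
  have h3 : u = Sum.elim (u ∘ Sum.inl) (u ∘ Sum.inr) := (Sum.elim_comp_inl_inr u).symm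
  rw [h3, sumElim_vecMul_fromRows] at h2
  obtain ⟨e1, e2⟩ := h (u ∘ Sum.inl) (u ∘ Sum.inr) (by ext i; exact congrFun h1 (Sum.inl i))
    (by ext i; exact congrFun h1 (Sum.inr i)) h2
  rw [h3, e1, e2]
  ext (i | i) <;> rfl

lemma rank_cols [Fintype r] [Fintype s] [Fintype n] {a₁ : Matrix r r ℂ}
    {a₂ : Matrix s s ℂ} {c₁ : Matrix n r ℂ} {c₂ : Matrix n s ℂ}
    (h : ∀ w₁ w₂, a₁ *ᵥ w₁ = 0 → a₂ *ᵥ w₂ = 0 → c₁ *ᵥ w₁ + c₂ *ᵥ w₂ = 0 → w₁ = 0 ∧ w₂ = 0) :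
    (fromRows (fromBlocks a₁ 0 0 a₂) (fromCols c₁ c₂)).rank = Fintype.card (r ⊕ s) := by
  rw [← rank_transpose, transpose_fromRows, fromBlocks_transpose, transpose_fromCols,
    transpose_zero, transpose_zero]
  apply rank_rows
  intro u₁ u₂
  simp only [vecMul_transpose]
  exact h u₁ u₂

variable {A₁ : Matrix r r ℂ[X]} {A₂ : Matrix s s ℂ[X]} {B₁ : Matrix r n ℂ[X]}
  {B₂ : Matrix s n ℂ[X]} {C₁ : Matrix n r ℂ[X]} {C₂ : Matrix n s ℂ[X]} {D : Matrix n n ℂ[X]}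

lemma map_rows (f : ℂ[X] → ℂ) (hf : f 0 = 0) (A₁ : Matrix r r ℂ[X]) (A₂ : Matrix s s ℂ[X])
    (B₁ : Matrix r n ℂ[X]) (B₂ : Matrix s n ℂ[X]) (C₁ : Matrix n r ℂ[X]) (C₂ : Matrix n s ℂ[X])
    (D : Matrix n n ℂ[X]) :
    (fromBlocks (fromBlocks A₁ 0 0 A₂) (fromRows B₁ B₂) (fromCols C₁ C₂) D).toRows₁.map f =
      fromCols (fromBlocks (A₁.map f) 0 0 (A₂.map f)) (fromRows (B₁.map f) (B₂.map f)) := by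
  ext (i | i) ((j | j) | j) <;> simp [toRows₁, hf]

lemma map_cols (f : ℂ[X] → ℂ) (hf : f 0 = 0) (A₁ : Matrix r r ℂ[X]) (A₂ : Matrix s s ℂ[X])
    (B₁ : Matrix r n ℂ[X]) (B₂ : Matrix s n ℂ[X]) (C₁ : Matrix n r ℂ[X]) (C₂ : Matrix n s ℂ[X])
    (D : Matrix n n ℂ[X]) :
    (fromBlocks (fromBlocks A₁ 0 0 A₂) (fromRows B₁ B₂) (fromCols C₁ C₂) D).toCols₁.map f =
      fromRows (fromBlocks (A₁.map f) 0 0 (A₂.map f)) (fromCols (C₁.map f) (C₂.map f)) := by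
  ext ((i | i) | i) (j | j) <;> simp [toCols₁, hf]

/-- A polynomial part minimal because `A₁` is unimodular and a strictly proper part minimal at
infinity because the leading coefficient of `A₂` is invertible combine to a strongly minimal
pencil. -/
lemma isStronglyMinimal_combine [Fintype r] [Fintype s] [Fintype n] [DecidableEq r] [DecidableEq s]
    (h₁ : ∀ z, IsUnit (polyEval A₁ z)) (h₂ : IsUnit (polyCoeff A₂ 1))
    (hr : ∀ z u, u ᵥ* polyEval A₂ z = 0 → u ᵥ* polyEval B₂ z = 0 → u = 0)
    (hc : ∀ z w, polyEval A₂ z *ᵥ w = 0 → polyEval C₂ z *ᵥ w = 0 → w = 0)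
    (hr' : ∀ u, u ᵥ* polyCoeff A₁ 1 = 0 → u ᵥ* polyCoeff B₁ 1 = 0 → u = 0)
    (hc' : ∀ w, polyCoeff A₁ 1 *ᵥ w = 0 → polyCoeff C₁ 1 *ᵥ w = 0 → w = 0) :
    IsStronglyMinimal
      (fromBlocks (fromBlocks A₁ 0 0 A₂) (fromRows B₁ B₂) (fromCols C₁ C₂) D) where
  row_finite z := by
    rw [polyEval, map_rows _ eval_zero]
    refine rank_rows fun u₁ u₂ e₁ e₂ e₃ => ?_
    obtain rfl := vecMul_injective_of_isUnit (h₁ z) e₁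
    rw [zero_vecMul, zero_add] at e₃
    exact ⟨rfl, hr z u₂ e₂ e₃⟩
  col_finite z := by
    rw [polyEval, map_cols _ eval_zero]
    refine rank_cols fun w₁ w₂ e₁ e₂ e₃ => ?_
    obtain rfl := mulVec_injective_of_isUnit (h₁ z) e₁
    rw [mulVec_zero, zero_add] at e₃
    exact ⟨rfl, hc z w₂ e₂ e₃⟩
  row_infinity := by
    rw [polyCoeff, map_rows _ (coeff_zero 1)]
    refine rank_rows fun u₁ u₂ e₁ e₂ e₃ => ?_
    obtain rfl := vecMul_injective_of_isUnit h₂ e₂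
    rw [zero_vecMul, add_zero] at e₃
    exact ⟨hr' u₁ e₁ e₃, rfl⟩
  col_infinity := by
    rw [polyCoeff, map_cols _ (coeff_zero 1)]
    refine rank_cols fun w₁ w₂ e₁ e₂ e₃ => ?_
    obtain rfl := mulVec_injective_of_isUnit h₂ e₂
    rw [mulVec_zero, add_zero] at e₃
    exact ⟨hc' w₁ e₁ e₃, rfl⟩

lemma transferFunction_combine [Fintype r] [Fintype s] [DecidableEq r] [DecidableEq s]
    (h₁ : A₁.det ≠ 0) (h₂ : A₂.det ≠ 0) :
    transferFunction (fromBlocks (fromBlocks A₁ 0 0 A₂) (fromRows B₁ B₂) (fromCols C₁ C₂) D) =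
      toRat D + toRat C₁ * (toRat A₁)⁻¹ * toRat (-B₁) + toRat C₂ * (toRat A₂)⁻¹ * toRat (-B₂) := by
  have e₁ : toRat (fromBlocks A₁ 0 0 A₂) = fromBlocks (toRat A₁) 0 0 (toRat A₂) := by
    simp [toRat, fromBlocks_map]
  have e₂ : (fromBlocks (toRat A₁) 0 0 (toRat A₂))⁻¹ =
      fromBlocks (toRat A₁)⁻¹ 0 0 (toRat A₂)⁻¹ := by
    apply inv_eq_right_inv
    rw [fromBlocks_multiply, mul_nonsing_inv _ (isUnit_toRat_det h₁),
      mul_nonsing_inv _ (isUnit_toRat_det h₂)]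
    simp
  have e₃ : toRat (fromCols C₁ C₂) = fromCols (toRat C₁) (toRat C₂) := by
    ext i (j | j) <;> rfl
  have e₄ : toRat (-fromRows B₁ B₂) = fromRows (toRat (-B₁)) (toRat (-B₂)) := by
    ext (i | i) j <;> rfl
  rw [transferFunction, toBlocks_fromBlocks₁₁, toBlocks_fromBlocks₁₂, toBlocks_fromBlocks₂₁,
    toBlocks_fromBlocks₂₂, e₁, e₂, e₃, e₄, fromCols_mul_fromBlocks, fromCols_mul_fromRows]
  simp [add_assoc]

lemma polyHas_combine {τ : SelfConj}
    (hA₁ : ∀ z, (polyEval A₁ z)ᴴ = τ.sign • polyEval A₁ (τ.reflect z))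
    (hA₂ : ∀ z, (polyEval A₂ z)ᴴ = τ.sign • polyEval A₂ (τ.reflect z))
    (hB₁ : ∀ z, (polyEval B₁ z)ᴴ = τ.sign • polyEval C₁ (τ.reflect z))
    (hB₂ : ∀ z, (polyEval B₂ z)ᴴ = τ.sign • polyEval C₂ (τ.reflect z))
    (hD : ∀ z, (polyEval D z)ᴴ = τ.sign • polyEval D (τ.reflect z)) :
    τ.PolyHas (fromBlocks (fromBlocks A₁ 0 0 A₂) (fromRows B₁ B₂) (fromCols C₁ C₂) D) := by
  intro z
  have hC₁ := structure_swap hB₁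
  have hC₂ := structure_swap hB₂
  ext ((i | i) | i) ((j | j) | j)
  · exact congrFun (congrFun (hA₁ z) i) j
  · simp [polyEval]
  · exact congrFun (congrFun (hC₁ z) i) j
  · simp [polyEval]
  · exact congrFun (congrFun (hA₂ z) i) j
  · exact congrFun (congrFun (hC₂ z) i) j
  · exact congrFun (congrFun (hB₁ z) i) j
  · exact congrFun (congrFun (hB₂ z) i) j
  · exact congrFun (congrFun (hD z) i) j

lemma natDegree_const_mul_le {l m n : Type*} [Fintype m] {M : Matrix l m ℂ} {A : Matrix m n ℂ[X]}
    (hA : ∀ i j, (A i j).natDegree ≤ 1) (i : l) (j : n) : ((const M * A) i j).natDegree ≤ 1 := by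
  rw [mul_apply]
  refine natDegree_sum_le_of_forall_le _ _ fun k _ => ?_
  exact (natDegree_C_mul_le _ _).trans (hA k j)

lemma natDegree_mul_const_le {l m n : Type*} [Fintype m] {A : Matrix l m ℂ[X]} {M : Matrix m n ℂ}
    (hA : ∀ i j, (A i j).natDegree ≤ 1) (i : l) (j : n) : ((A * const M) i j).natDegree ≤ 1 := by
  rw [mul_apply]
  refine natDegree_sum_le_of_forall_le _ _ fun k _ => ?_
  exact (natDegree_mul_C_le _ _).trans (hA i k)

lemma natDegree_combine (hA₁ : ∀ i j, (A₁ i j).natDegree ≤ 1) (hA₂ : ∀ i j, (A₂ i j).natDegree ≤ 1)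
    (hB₁ : ∀ i j, (B₁ i j).natDegree ≤ 1) (hB₂ : ∀ i j, (B₂ i j).natDegree ≤ 1)
    (hC₁ : ∀ i j, (C₁ i j).natDegree ≤ 1) (hC₂ : ∀ i j, (C₂ i j).natDegree ≤ 1)
    (hD : ∀ i j, (D i j).natDegree ≤ 1) (i j) :
    (fromBlocks (fromBlocks A₁ 0 0 A₂) (fromRows B₁ B₂) (fromCols C₁ C₂) D i j).natDegree ≤ 1 := by
  rcases i with (i | i) | i <;> rcases j with (j | j) | j <;> simp [*]

end Combined

/-! ### Assembly of the linearization -/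

section Main

variable {τ : SelfConj} {P : Matrix (Fin m) (Fin m) ℂ[X]} {d p r : ℕ}
  {U V : Matrix (Fin (d - 1) × Fin m) (Fin p ⊕ Fin r) ℂ} {k rf q : ℕ}

lemma natDegree_X_mul_C_le (a : ℂ) : (X * C a : ℂ[X]).natDegree ≤ 1 :=
  (natDegree_mul_C_le _ _).trans natDegree_X_le

lemma combined_pencil (hk : 0 < k) (Rsp : Matrix (Fin m) (Fin m) (RatFunc ℂ))
    (W : Matrix (Fin k × Fin m) (Fin rf ⊕ Fin q) ℂ) (Hhat : Matrix (Fin rf) (Fin rf) ℂ) (i j) :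
    (combined τ hk P d U V Rsp W Hhat i j).natDegree ≤ 1 := by
  have hc : ∀ {l n : Type} (M : Matrix l n ℂ) i j, (const M i j).natDegree ≤ 1 := fun M i j => by
    simp [const]
  apply natDegree_combine
  · refine natDegree_mul_const_le (natDegree_const_mul_le fun i j => ?_)
    exact (natDegree_sub_le _ _).trans (max_le (natDegree_X_mul_C_le _) (by simp))
  · intro i j
    refine (natDegree_sub_le _ _).trans (max_le (hc _ i j) ?_)
    exact natDegree_X_mul_C_le _
  · exact natDegree_const_mul_le fun i j => natDegree_X_mul_C_le _
  · exact hc _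
  · exact natDegree_mul_const_le fun i j => natDegree_X_mul_C_le _
  · rw [spC_eq]
    exact hc _
  · exact fun i j => (natDegree_add_le _ _).trans (max_le (natDegree_X_mul_C_le _) (by simp))

theorem combined_isStronglyMinimalLinearization {R Rsp : Matrix (Fin m) (Fin m) (RatFunc ℂ)}
    (hdec : R = toRat P + Rsp) (hsp : IsStrictlyProper Rsp)
    (hd : ∀ i j, (P i j).natDegree ≤ d) {That : Matrix (Fin r) (Fin r) ℂ}
    (hP : IsPolyCompression τ P d U V That) (hk : 0 < k) (hl : IsLargeEnough Rsp k)
    {Y W : Matrix (Fin k × Fin m) (Fin rf ⊕ Fin q) ℂ} {Hhat : Matrix (Fin rf) (Fin rf) ℂ}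
    (hH : IsHankelCompression τ Rsp k Y W Hhat) :
    IsStronglyMinimalLinearization (combined τ hk P d U V Rsp W Hhat) R := by
  obtain ⟨Vr, S, b, c, G, K, hr, hG, hK, eA, eB, eC⟩ := exists_sp_factorization hk hsp hl hH
  have hdet₁ := hatA_det_ne_zero hd hP.unitary_left hP.unitary_right hP.compress hP.invertible
  have hdet₂ : (spA τ Rsp W Hhat).det ≠ 0 := by
    rw [eA]; exact det_pencil_ne_zero hG hK
  refine ⟨⟨fun i j => combined_pencil hk Rsp W Hhat i j, ?_⟩, ?_, ?_⟩
  · rw [combined, toBlocks_fromBlocks₁₁, det_fromBlocks_zero₂₁]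
    exact mul_ne_zero hdet₁ hdet₂
  · apply isStronglyMinimal_combine
    · exact hatA_eval_isUnit hd hP.unitary_left hP.unitary_right hP.compress hP.invertible
    · have : polyCoeff (spA τ Rsp W Hhat) 1 = -Hhat := by
        ext i j
        simp only [polyCoeff, map_apply, spA, const, Matrix.sub_apply, Matrix.smul_apply,
          smul_eq_mul, coeff_sub, coeff_X_mul, coeff_C_zero, coeff_C_succ, zero_sub,
          Matrix.neg_apply]
      rw [this]
      exact hH.invertible.neg
    · intro z u h₁ h₂
      rw [eA, polyEval_pencil] at h₁
      rw [eB, polyEval_const] at h₂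
      exact hr.row_finite hG hK z h₁ h₂
    · intro z w h₁ h₂
      rw [eA, polyEval_pencil] at h₁
      rw [eC, polyEval_const] at h₂
      exact hr.col_finite hG hK z h₁ h₂
    · exact fun u => hat_row_infinity hd hP.unitary_left hP.unitary_right hP.compress hP.invertible
    · exact fun w => hat_col_infinity hd hP.unitary_left hP.unitary_right hP.compress hP.invertible
  · obtain ⟨Z, hZ₁, hZ₂⟩ := hat_transfer hd hP.unitary_left hP.unitary_right hP.compress
    have h₂ := hr.transfer hG hK
    rw [← eA, ← eB, ← eC] at h₂
    -- Since `-(-B̂_s) = Â_s Z`, the inverse of `Â_s` cancels and the polynomial part contributes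
    -- `D̂_s + Ĉ_s Z = P`.
    rw [combined, transferFunction_combine hdet₁ hdet₂, h₂, ← hZ₁, toRat_mul, Matrix.mul_assoc,
      nonsing_inv_mul_cancel_left _ _ (isUnit_toRat_det hdet₁), ← toRat_mul, ← toRat_add, hZ₂, hdec]

end Main

end

end StrongLin

end

/-! ### The main theorem -/

theorem mainTheorem8 {m : ℕ} (τ : StrongLin.SelfConj)
    (R : Matrix (Fin m) (Fin m) (RatFunc ℂ)) (hR : τ.RatHas R)
    (P : Matrix (Fin m) (Fin m) (Polynomial ℂ)) (Rsp : Matrix (Fin m) (Fin m) (RatFunc ℂ))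
    (hdec : R = StrongLin.toRat P + Rsp) (hsp : StrongLin.IsStrictlyProper Rsp) :
    -- the data of the construction exist
    (∃ K : ℕ, ∀ k : ℕ, K ≤ k → StrongLin.IsLargeEnough Rsp k) ∧
    (∀ d : ℕ, (∀ i j, (P i j).natDegree ≤ d) →
      ∃ (p r : ℕ) (U V : Matrix (Fin (d - 1) × Fin m) (Fin p ⊕ Fin r) ℂ)
        (That : Matrix (Fin r) (Fin r) ℂ), StrongLin.IsPolyCompression τ P d U V That) ∧
    (∀ k : ℕ, ∃ (rf q : ℕ) (Y W : Matrix (Fin k × Fin m) (Fin rf ⊕ Fin q) ℂ)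
        (Hhat : Matrix (Fin rf) (Fin rf) ℂ), StrongLin.IsHankelCompression τ Rsp k Y W Hhat) ∧
    -- every choice of the data gives a structured strongly minimal linearization
    (∀ (d : ℕ), (∀ i j, (P i j).natDegree ≤ d) →
      ∀ (p r : ℕ) (U V : Matrix (Fin (d - 1) × Fin m) (Fin p ⊕ Fin r) ℂ)
        (That : Matrix (Fin r) (Fin r) ℂ), StrongLin.IsPolyCompression τ P d U V That →
      ∀ (k : ℕ) (hk : 0 < k), StrongLin.IsLargeEnough Rsp k →
      ∀ (rf q : ℕ) (Y W : Matrix (Fin k × Fin m) (Fin rf ⊕ Fin q) ℂ)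
        (Hhat : Matrix (Fin rf) (Fin rf) ℂ), StrongLin.IsHankelCompression τ Rsp k Y W Hhat →
      StrongLin.IsStronglyMinimalLinearization
          (StrongLin.combined τ hk P d U V Rsp W Hhat) R ∧
        τ.PolyHas (StrongLin.combined τ hk P d U V Rsp W Hhat)) := by
  obtain ⟨hPc, hRc⟩ := hR.coeff hdec hsp
  refine ⟨StrongLin.exists_isLargeEnough hsp, fun d _ => StrongLin.exists_polyCompression hPc d,
    fun k => StrongLin.exists_hankelCompression hRc k, ?_⟩
  intro d hd p r U V That hP k hk hl rf q Y W Hhat hH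
  exact ⟨StrongLin.combined_isStronglyMinimalLinearization hdec hsp hd hP hk hl hH,
    StrongLin.polyHas_combine (StrongLin.hatA_structure hPc hP.left_eq)
      (StrongLin.spA_structure hRc hH) (StrongLin.hatNegB_structure hPc hP.left_eq)
      (StrongLin.spNegB_structure hRc hH hk) (StrongLin.pencilD_structure hPc)⟩
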